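/- Let $f(z) = z + \sum_{k\ge 1} f_k z^{k+1}$, $f_k \in \mathbb{C}$, be a formal power series that satisfies, for some constant $c \in \mathbb{C}$, the Hirzebruch functional equation for $n = 5$, \[ \sum_{i=1}^{5} \prod_{j \ne i} \frac{1}{f(z_j - z_i)} = c, \] read as an identity in the field of fractions of $\mathbb{C}[[z_1,\dots,z_5]]$. Then $f$ is a series corresponding to the Todd function or a series corresponding to the elliptic function of level $5$. Here the terms have the following meaning. For a series $f(z) = z + \sum_{k \ge 1} f_k z^{k+1}$ write $z/f(z) = 1 + \sum_{k\ge 1} q_k z^k$ and call $(q_1,q_2,q_3,q_4) \in \mathbb{C}^4$ the parameters of $f$. Consider the family of differential equations \[ f f''' - 3 f' f'' = 6 p_1 (f')^2 + 12 p_2 f f' + 12 p_3 f^2, \qquad (p_1,p_2,p_3) \in \mathbb{C}^3. \tag{$*$} \] A series $f(z) = z + \dots$ solves $(*)$ if it satisfies it for some $(p_1,p_2,p_3)$ (then necessarily $p_k = q_k$ for $k=1,2,3$). A series corresponding to the Todd function $\frac{e^{az}-e^{bz}}{a e^{bz} - b e^{az}}$ is a series $f(z) = z + \dots$ that solves $(*)$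 and whose parameters lie in $M_0 = \{q_3 = 0,\ 5 q_4 = - q_2^2\} \subset \mathbb{C}^4$. An elliptic function of level $N$ is a meromorphic function $F$ on $\mathbb{C}$ with $F(0)=0$, $F'(0)=1$ such that, for some lattice $L \subset \mathbb{C}$ and some $\rho \in \mathbb{C}$, the function $F^N$ is elliptic with lattice $L$ and has divisor $N\cdot 0 - N\cdot \rho$ on $\mathbb{C}/L$, and such that $N$ is the smallest positive integer with this property. Let $U_N \subset \mathbb{C}^4$ be the set of parameters of those series solutions of $(*)$ that are the series expansion at zero of some elliptic function of level $N$, and let $M_N$ be the Zariski closure of $U_N$ in $\mathbb{C}^4$. A series corresponding to the elliptic function of level $N$ is a series $f(z) = z + \dots$ that solves $(*)$ and whose parameters lie in $M_N$. (The trivial solution $f(z) = z$ has all $q_k = 0$ and is among the series corresponding to the Todd function.) -/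

import Mathlib

namespace HirzebruchFE

noncomputable section

/-- A normalized formal series `f(z) = z + ∑_{k ≥ 1} f_k z^{k+1}` over `ℂ`. -/
def IsNormalized (f : PowerSeries ℂ) : Prop :=
  PowerSeries.coeff 0 f = 0 ∧ PowerSeries.coeff 1 f = 1

/-- The formal series `f(z_j - z_i)` in the variables `z_1, …, z_n`, viewed in the field of
fractions of `ℂ⟦z_1, …, z_n⟧`. For normalized `f` and `i ≠ j` it is not zero. -/
def evalDiff (n : ℕ) (f : PowerSeries ℂ) (i j : Fin n) :
    FractionRing (MvPowerSeries (Fin n) ℂ) :=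
  algebraMap (MvPowerSeries (Fin n) ℂ) (FractionRing (MvPowerSeries (Fin n) ℂ))
    (PowerSeries.subst (MvPowerSeries.X j - MvPowerSeries.X i : MvPowerSeries (Fin n) ℂ) f)

/-- The Hirzebruch functional equation in `n` variables with constant `c`:
`∑_i ∏_{j ≠ i} 1 / f(z_j - z_i) = c`, as an identity between formal expressions. -/
def HirzebruchEquation (n : ℕ) (c : ℂ) (f : PowerSeries ℂ) : Prop :=
  ∑ i : Fin n, ∏ j ∈ Finset.univ.erase i, 1 / evalDiff n f i j =
    algebraMap (MvPowerSeries (Fin n) ℂ) (FractionRing (MvPowerSeries (Fin n) ℂ))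
      (MvPowerSeries.C c)

/-- The series `Q(z) = z / f(z) = 1 + ∑_{k ≥ 1} q_k z^k` of a normalized series `f`. -/
def qSeries (f : PowerSeries ℂ) : PowerSeries ℂ :=
  (PowerSeries.mk fun k => PowerSeries.coeff (k + 1) f)⁻¹

/-- The parameters `(q_1, q_2, q_3, q_4)` of a normalized series; the index `i : Fin 4` stands
for `q_{i+1}`. -/
def params (f : PowerSeries ℂ) : Fin 4 → ℂ :=
  fun i => PowerSeries.coeff ((i : ℕ) + 1) (qSeries f)

/-- `f` solves a member of the family of differential equations
`f f''' - 3 f' f'' = 6 p_1 (f')² + 12 p_2 f f' + 12 p_3 f²`. -/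
def SolvesODE (f : PowerSeries ℂ) : Prop :=
  ∃ p₁ p₂ p₃ : ℂ,
    f * (PowerSeries.derivative ℂ)^[3] f
        - 3 * ((PowerSeries.derivative ℂ)^[1] f * (PowerSeries.derivative ℂ)^[2] f) =
      (6 * p₁) • ((PowerSeries.derivative ℂ)^[1] f) ^ 2
        + (12 * p₂) • (f * (PowerSeries.derivative ℂ)^[1] f) + (12 * p₃) • f ^ 2

/-- The manifold `M_0`: `q_3 = 0` and `5 q_4 = - q_2²`. -/
def toddManifold : Set (Fin 4 → ℂ) :=
  {q | q 2 = 0 ∧ 5 * q 3 = -(q 1) ^ 2}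

/-- A series corresponding to the Todd function. -/
def CorrespondsToTodd (f : PowerSeries ℂ) : Prop :=
  IsNormalized f ∧ SolvesODE f ∧ params f ∈ toddManifold

open Classical in
/-- `g` is an elliptic function with lattice `L` and divisor `N · 0 - N · ρ` on `ℂ / L`.
Meromorphic functions are represented by functions in normal form (value `0` at the poles). -/
structure IsEllipticWithDivisor (g : ℂ → ℂ) (L : PeriodPair) (N : ℕ) (ρ : ℂ) : Prop where
  meromorphic : MeromorphicNFOn g Set.univ
  periodic : ∀ w ∈ L.lattice, Function.Periodic g w
  divisor : ∀ z : ℂ, meromorphicOrderAt g z =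
    (((if z ∈ L.lattice then (N : ℤ) else 0) - (if z - ρ ∈ L.lattice then (N : ℤ) else 0) : ℤ) :
      WithTop ℤ)

/-- `f` is an elliptic function of level `N`: a meromorphic function on `ℂ` with `f(0) = 0`,
`f'(0) = 1`, such that `N` is the smallest positive integer for which `f ^ N` is elliptic with
divisor `N · 0 - N · ρ` with respect to some lattice, for some `ρ`. -/
structure IsEllipticOfLevel (N : ℕ) (f : ℂ → ℂ) : Prop where
  meromorphic : MeromorphicNFOn f Set.univ
  map_zero : f 0 = 0
  deriv_zero : deriv f 0 = 1
  level : IsLeast {M : ℕ | 0 < M ∧ ∃ (L : PeriodPair) (ρ : ℂ),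
    IsEllipticWithDivisor (fun z => f z ^ M) L M ρ} N

/-- The formal series `f` is the series expansion at zero of the function `F`. -/
def IsExpansionAtZero (f : PowerSeries ℂ) (F : ℂ → ℂ) : Prop :=
  HasFPowerSeriesAt F
    (FormalMultilinearSeries.ofScalars ℂ fun k => PowerSeries.coeff k f) 0

/-- The set `U_N` of parameters `(q_1, q_2, q_3, q_4)` for which the series solution of the
differential equation is the expansion at zero of some elliptic function of level `N`. -/
def ellipticParams (N : ℕ) : Set (Fin 4 → ℂ) :=
  {q | ∃ f : PowerSeries ℂ, IsNormalized f ∧ SolvesODE f ∧ params f = q ∧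
    ∃ F : ℂ → ℂ, IsEllipticOfLevel N F ∧ IsExpansionAtZero f F}

/-- The manifold `M_N`: the Zariski closure of `U_N` in `ℂ⁴`. -/
def ellipticManifold (N : ℕ) : Set (Fin 4 → ℂ) :=
  MvPolynomial.zeroLocus ℂ (MvPolynomial.vanishingIdeal ℂ (ellipticParams N))

/-- A series corresponding to the elliptic function of level `N`. -/
def CorrespondsToElliptic (N : ℕ) (f : PowerSeries ℂ) : Prop :=
  IsNormalized f ∧ SolvesODE f ∧ params f ∈ ellipticManifold N

end

end HirzebruchFE

/-!
Write `Q = X / f` and let `w k` be the coefficients of the logarithmic derivative `X * Q' / Q`, so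
that `f` and the sequence `w` determine each other (`IsNormalized.eq_of_logCoeff_eq`). Restricted to
a line `z = a * X` with distinct `a i`, the functional equation says that all but one of the
coefficients of an explicit series in `w` vanish (`lineSeries_of_hirzebruchEquation`, `LineRel`).
Three lines suffice for the theorem.

*Elimination.* The relations of weights `6` to `11` along the lines `(0, 1, 2, 3, 5)`,
`(0, 1, 2, 3, 6)` and `(0, 1, 2, 4, 5)` express `w 6`, …, `w 10` through `w 1`, …, `w 5` and leave a
system of polynomial equations, whose radical is found by explicit ideal-membership
certificates: `w 5 = -(w 2 * w 3)`, and `(w 1, w 2, w 3, w 4)` lies on the Todd surface or on the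
elliptic surface (`components_of_lineRel`). Moreover, the relations along the first line alone
determine `w k` for `k ≥ 6` from its predecessors (`LineRel.eq_of_eq_le_five`), so a solution is
determined by its point on one of the two surfaces. The differential equation has the same
feature: its solutions are the series with `w = odeCoeff a b c d` (`solvesODE_of_logCoeff`,
`logCoeff_of_solvesODE`). Hence it is enough to exhibit, for every point of either surface, a
solution of both equations.

*Todd surface.* The Todd functions are the normalized solutions of the Riccati equations
`f' = 1 + s f + p f²`. They satisfy the functional equation along the first line, and their points
exhaust the Todd surface (`exists_todd`, `riccati_of_isToddPoint`).

*Elliptic surface.* For `τ` in the upper half plane let `F` be the multiple with `F'(0) = 1` of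
`θ(z) / θ(z - 1/5)`, where `θ` is a theta function with simple zeros on `ℤ + ℤτ`. By Liouville's
theorem `F` satisfies the functional equation with constant `0`
(`inv_levelFun_functional_equation`) as well as the differential equation (`solvesODE_levelSeries`).
As `F` solves no Riccati equation, it lies on the elliptic surface (`components_levelSeries`). The
functions `μ⁻¹ F(μz)` are elliptic of level `5` too.

The elliptic surface is the image of the plane under a polynomial map that is equivariant for these
homotheties (`IsEllipticPoint.exists_param`). A given `F` is homothetic to only countably many
others (`countable_homothetic`), while there are uncountably many `τ`. Therefore the parameters of
the functions `μ⁻¹ F(μz)` are Zariski dense in that plane (`eq_zero_of_mem_polyFun`). By density the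
solutions of the differential equation attached to the points of the elliptic surface satisfy the
functional equation along the first line (`lineRel_curveCoeff`), and their parameters lie in `M₅`
(`expCoeff_curveCoeff_mem_ellipticManifold`).
-/


namespace HirzebruchFE

open Finset

/-! ### Coefficients of exponentials and the identity along a line -/

/-- The coefficients of `exp (∑ m ≥ 1, s m * X ^ m / m)`, through Newton's recursion. -/
noncomputable def expCoeff (s : ℕ → ℂ) : ℕ → ℂ
  | 0 => 1
  | k + 1 => (∑ m : Fin (k + 1), s (m + 1) * expCoeff s (k - m)) / (k + 1)

lemma expCoeff_zero (s : ℕ → ℂ) : expCoeff s 0 = 1 := by rw [expCoeff]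

lemma expCoeff_succ (s : ℕ → ℂ) (k : ℕ) :
    expCoeff s (k + 1) = (∑ m ∈ range (k + 1), s (m + 1) * expCoeff s (k - m)) / (k + 1) := by
  rw [expCoeff, ← Fin.sum_univ_eq_sum_range (fun m => s (m + 1) * expCoeff s (k - m))]

/-- The coefficient at `X ^ k` of `∑ i, ∏ j ≠ i, Q ((a j - a i) X) / (a j - a i)`, where `w` holds
the coefficients of `X * Q' / Q`. -/
noncomputable def lineSum (a : Fin 5 → ℂ) (w : ℕ → ℂ) (k : ℕ) : ℂ :=
  ∑ i : Fin 5, (∏ j : Fin 4, (a (i.succAbove j) - a i))⁻¹ *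
    expCoeff (fun m => (∑ j : Fin 4, (a (i.succAbove j) - a i) ^ m) * w m) k

/-- The functional equation restricted to the line `z = a * X`, in terms of the coefficients of
`X * Q' / Q`: only the coefficient at `X ^ 4` may survive. -/
def LineRel (a : Fin 5 → ℂ) (w : ℕ → ℂ) : Prop :=
  ∀ k, k ≠ 4 → lineSum a w k = 0

/-! The closed forms of the coefficients up to degree eleven follow by unfolding the recursion: the
coefficient at `∏ s i ^ m i` in `expCoeff s k` is `∏ 1 / (m i ! * i ^ m i)`. -/

lemma expCoeff_one (s : ℕ → ℂ) : expCoeff s 1 =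
      s 1 := by
  simp only [expCoeff_succ s 0, sum_range_succ, sum_range_zero, Nat.reduceSub, Nat.reduceAdd,
    expCoeff_zero]
  push_cast
  ring

lemma expCoeff_two (s : ℕ → ℂ) : expCoeff s 2 =
      1 / 2 * s 1 ^ 2 + 1 / 2 * s 2 := by
  simp only [expCoeff_succ s 1, sum_range_succ, sum_range_zero, Nat.reduceSub, Nat.reduceAdd,
    expCoeff_zero, expCoeff_one]
  push_cast
  ring

lemma expCoeff_three (s : ℕ → ℂ) : expCoeff s 3 =
      1 / 6 * s 1 ^ 3 + 1 / 2 * s 1 * s 2 + 1 / 3 * s 3 := by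
  simp only [expCoeff_succ s 2, sum_range_succ, sum_range_zero, Nat.reduceSub, Nat.reduceAdd,
    expCoeff_zero, expCoeff_one, expCoeff_two]
  push_cast
  ring

lemma expCoeff_four (s : ℕ → ℂ) : expCoeff s 4 =
      1 / 24 * s 1 ^ 4 + 1 / 4 * s 1 ^ 2 * s 2 + 1 / 3 * s 1 * s 3 + 1 / 8 * s 2 ^ 2 + 1 /
      4 * s 4 := by
  simp only [expCoeff_succ s 3, sum_range_succ, sum_range_zero, Nat.reduceSub, Nat.reduceAdd,
    expCoeff_zero, expCoeff_one, expCoeff_two, expCoeff_three]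
  push_cast
  ring

lemma expCoeff_five (s : ℕ → ℂ) : expCoeff s 5 =
      1 / 120 * s 1 ^ 5 + 1 / 12 * s 1 ^ 3 * s 2 + 1 / 6 * s 1 ^ 2 * s 3 + 1 / 8 * s 1 * s
      2 ^ 2 + 1 / 4 * s 1 * s 4 + 1 / 6 * s 2 * s 3 + 1 / 5 * s 5 := by
  simp only [expCoeff_succ s 4, sum_range_succ, sum_range_zero, Nat.reduceSub, Nat.reduceAdd,
    expCoeff_zero, expCoeff_one, expCoeff_two, expCoeff_three, expCoeff_four]
  push_cast
  ring

lemma expCoeff_six (s : ℕ → ℂ) : expCoeff s 6 =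
      1 / 720 * s 1 ^ 6 + 1 / 48 * s 1 ^ 4 * s 2 + 1 / 18 * s 1 ^ 3 * s 3 + 1 / 16 * s 1 ^
      2 * s 2 ^ 2 + 1 / 8 * s 1 ^ 2 * s 4 + 1 / 6 * s 1 * s 2 * s 3 + 1 / 5 * s 1 * s 5 +
      1 / 48 * s 2 ^ 3 + 1 / 8 * s 2 * s 4 + 1 / 18 * s 3 ^ 2 + 1 / 6 * s 6 := by
  simp only [expCoeff_succ s 5, sum_range_succ, sum_range_zero, Nat.reduceSub, Nat.reduceAdd,
    expCoeff_zero, expCoeff_one, expCoeff_two, expCoeff_three, expCoeff_four, expCoeff_five]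
  push_cast
  ring

lemma expCoeff_seven (s : ℕ → ℂ) : expCoeff s 7 =
      1 / 5040 * s 1 ^ 7 + 1 / 240 * s 1 ^ 5 * s 2 + 1 / 72 * s 1 ^ 4 * s 3 + 1 / 48 * s 1
      ^ 3 * s 2 ^ 2 + 1 / 24 * s 1 ^ 3 * s 4 + 1 / 12 * s 1 ^ 2 * s 2 * s 3 + 1 / 10 * s 1
      ^ 2 * s 5 + 1 / 48 * s 1 * s 2 ^ 3 + 1 / 8 * s 1 * s 2 * s 4 + 1 / 18 * s 1 * s 3 ^
      2 + 1 / 6 * s 1 * s 6 + 1 / 24 * s 2 ^ 2 * s 3 + 1 / 10 * s 2 * s 5 + 1 / 12 * s 3 *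
      s 4 + 1 / 7 * s 7 := by
  simp only [expCoeff_succ s 6, sum_range_succ, sum_range_zero, Nat.reduceSub, Nat.reduceAdd,
    expCoeff_zero, expCoeff_one, expCoeff_two, expCoeff_three, expCoeff_four, expCoeff_five,
    expCoeff_six]
  push_cast
  ring

lemma expCoeff_eight (s : ℕ → ℂ) : expCoeff s 8 =
      1 / 40320 * s 1 ^ 8 + 1 / 1440 * s 1 ^ 6 * s 2 + 1 / 360 * s 1 ^ 5 * s 3 + 1 / 192 *
      s 1 ^ 4 * s 2 ^ 2 + 1 / 96 * s 1 ^ 4 * s 4 + 1 / 36 * s 1 ^ 3 * s 2 * s 3 + 1 / 30 *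
      s 1 ^ 3 * s 5 + 1 / 96 * s 1 ^ 2 * s 2 ^ 3 + 1 / 16 * s 1 ^ 2 * s 2 * s 4 + 1 / 36 *
      s 1 ^ 2 * s 3 ^ 2 + 1 / 12 * s 1 ^ 2 * s 6 + 1 / 24 * s 1 * s 2 ^ 2 * s 3 + 1 / 10 *
      s 1 * s 2 * s 5 + 1 / 12 * s 1 * s 3 * s 4 + 1 / 7 * s 1 * s 7 + 1 / 384 * s 2 ^ 4 +
      1 / 32 * s 2 ^ 2 * s 4 + 1 / 36 * s 2 * s 3 ^ 2 + 1 / 12 * s 2 * s 6 + 1 / 15 * s 3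
      * s 5 + 1 / 32 * s 4 ^ 2 + 1 / 8 * s 8 := by
  simp only [expCoeff_succ s 7, sum_range_succ, sum_range_zero, Nat.reduceSub, Nat.reduceAdd,
    expCoeff_zero, expCoeff_one, expCoeff_two, expCoeff_three, expCoeff_four, expCoeff_five,
    expCoeff_six, expCoeff_seven]
  push_cast
  ring

lemma expCoeff_nine (s : ℕ → ℂ) : expCoeff s 9 =
      1 / 362880 * s 1 ^ 9 + 1 / 10080 * s 1 ^ 7 * s 2 + 1 / 2160 * s 1 ^ 6 * s 3 + 1 /
      960 * s 1 ^ 5 * s 2 ^ 2 + 1 / 480 * s 1 ^ 5 * s 4 + 1 / 144 * s 1 ^ 4 * s 2 * s 3 +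
      1 / 120 * s 1 ^ 4 * s 5 + 1 / 288 * s 1 ^ 3 * s 2 ^ 3 + 1 / 48 * s 1 ^ 3 * s 2 * s 4
      + 1 / 108 * s 1 ^ 3 * s 3 ^ 2 + 1 / 36 * s 1 ^ 3 * s 6 + 1 / 48 * s 1 ^ 2 * s 2 ^ 2
      * s 3 + 1 / 20 * s 1 ^ 2 * s 2 * s 5 + 1 / 24 * s 1 ^ 2 * s 3 * s 4 + 1 / 14 * s 1 ^
      2 * s 7 + 1 / 384 * s 1 * s 2 ^ 4 + 1 / 32 * s 1 * s 2 ^ 2 * s 4 + 1 / 36 * s 1 * s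
      2 * s 3 ^ 2 + 1 / 12 * s 1 * s 2 * s 6 + 1 / 15 * s 1 * s 3 * s 5 + 1 / 32 * s 1 * s
      4 ^ 2 + 1 / 8 * s 1 * s 8 + 1 / 144 * s 2 ^ 3 * s 3 + 1 / 40 * s 2 ^ 2 * s 5 + 1 /
      24 * s 2 * s 3 * s 4 + 1 / 14 * s 2 * s 7 + 1 / 162 * s 3 ^ 3 + 1 / 18 * s 3 * s 6 +
      1 / 20 * s 4 * s 5 + 1 / 9 * s 9 := by
  simp only [expCoeff_succ s 8, sum_range_succ, sum_range_zero, Nat.reduceSub, Nat.reduceAdd,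
    expCoeff_zero, expCoeff_one, expCoeff_two, expCoeff_three, expCoeff_four, expCoeff_five,
    expCoeff_six, expCoeff_seven, expCoeff_eight]
  push_cast
  ring

lemma expCoeff_ten (s : ℕ → ℂ) : expCoeff s 10 =
      1 / 3628800 * s 1 ^ 10 + 1 / 80640 * s 1 ^ 8 * s 2 + 1 / 15120 * s 1 ^ 7 * s 3 + 1 /
      5760 * s 1 ^ 6 * s 2 ^ 2 + 1 / 2880 * s 1 ^ 6 * s 4 + 1 / 720 * s 1 ^ 5 * s 2 * s 3
      + 1 / 600 * s 1 ^ 5 * s 5 + 1 / 1152 * s 1 ^ 4 * s 2 ^ 3 + 1 / 192 * s 1 ^ 4 * s 2 *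
      s 4 + 1 / 432 * s 1 ^ 4 * s 3 ^ 2 + 1 / 144 * s 1 ^ 4 * s 6 + 1 / 144 * s 1 ^ 3 * s
      2 ^ 2 * s 3 + 1 / 60 * s 1 ^ 3 * s 2 * s 5 + 1 / 72 * s 1 ^ 3 * s 3 * s 4 + 1 / 42 *
      s 1 ^ 3 * s 7 + 1 / 768 * s 1 ^ 2 * s 2 ^ 4 + 1 / 64 * s 1 ^ 2 * s 2 ^ 2 * s 4 + 1 /
      72 * s 1 ^ 2 * s 2 * s 3 ^ 2 + 1 / 24 * s 1 ^ 2 * s 2 * s 6 + 1 / 30 * s 1 ^ 2 * s 3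
      * s 5 + 1 / 64 * s 1 ^ 2 * s 4 ^ 2 + 1 / 16 * s 1 ^ 2 * s 8 + 1 / 144 * s 1 * s 2 ^
      3 * s 3 + 1 / 40 * s 1 * s 2 ^ 2 * s 5 + 1 / 24 * s 1 * s 2 * s 3 * s 4 + 1 / 14 * s
      1 * s 2 * s 7 + 1 / 162 * s 1 * s 3 ^ 3 + 1 / 18 * s 1 * s 3 * s 6 + 1 / 20 * s 1 *
      s 4 * s 5 + 1 / 9 * s 1 * s 9 + 1 / 3840 * s 2 ^ 5 + 1 / 192 * s 2 ^ 3 * s 4 + 1 /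
      144 * s 2 ^ 2 * s 3 ^ 2 + 1 / 48 * s 2 ^ 2 * s 6 + 1 / 30 * s 2 * s 3 * s 5 + 1 / 64
      * s 2 * s 4 ^ 2 + 1 / 16 * s 2 * s 8 + 1 / 72 * s 3 ^ 2 * s 4 + 1 / 21 * s 3 * s 7 +
      1 / 24 * s 4 * s 6 + 1 / 50 * s 5 ^ 2 + 1 / 10 * s 10 := by
  simp only [expCoeff_succ s 9, sum_range_succ, sum_range_zero, Nat.reduceSub, Nat.reduceAdd,
    expCoeff_zero, expCoeff_one, expCoeff_two, expCoeff_three, expCoeff_four, expCoeff_five,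
    expCoeff_six, expCoeff_seven, expCoeff_eight, expCoeff_nine]
  push_cast
  ring

lemma expCoeff_eleven (s : ℕ → ℂ) : expCoeff s 11 =
      1 / 39916800 * s 1 ^ 11 + 1 / 725760 * s 1 ^ 9 * s 2 + 1 / 120960 * s 1 ^ 8 * s 3 +
      1 / 40320 * s 1 ^ 7 * s 2 ^ 2 + 1 / 20160 * s 1 ^ 7 * s 4 + 1 / 4320 * s 1 ^ 6 * s 2
      * s 3 + 1 / 3600 * s 1 ^ 6 * s 5 + 1 / 5760 * s 1 ^ 5 * s 2 ^ 3 + 1 / 960 * s 1 ^ 5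
      * s 2 * s 4 + 1 / 2160 * s 1 ^ 5 * s 3 ^ 2 + 1 / 720 * s 1 ^ 5 * s 6 + 1 / 576 * s 1
      ^ 4 * s 2 ^ 2 * s 3 + 1 / 240 * s 1 ^ 4 * s 2 * s 5 + 1 / 288 * s 1 ^ 4 * s 3 * s 4
      + 1 / 168 * s 1 ^ 4 * s 7 + 1 / 2304 * s 1 ^ 3 * s 2 ^ 4 + 1 / 192 * s 1 ^ 3 * s 2 ^
      2 * s 4 + 1 / 216 * s 1 ^ 3 * s 2 * s 3 ^ 2 + 1 / 72 * s 1 ^ 3 * s 2 * s 6 + 1 / 90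
      * s 1 ^ 3 * s 3 * s 5 + 1 / 192 * s 1 ^ 3 * s 4 ^ 2 + 1 / 48 * s 1 ^ 3 * s 8 + 1 /
      288 * s 1 ^ 2 * s 2 ^ 3 * s 3 + 1 / 80 * s 1 ^ 2 * s 2 ^ 2 * s 5 + 1 / 48 * s 1 ^ 2
      * s 2 * s 3 * s 4 + 1 / 28 * s 1 ^ 2 * s 2 * s 7 + 1 / 324 * s 1 ^ 2 * s 3 ^ 3 + 1 /
      36 * s 1 ^ 2 * s 3 * s 6 + 1 / 40 * s 1 ^ 2 * s 4 * s 5 + 1 / 18 * s 1 ^ 2 * s 9 + 1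
      / 3840 * s 1 * s 2 ^ 5 + 1 / 192 * s 1 * s 2 ^ 3 * s 4 + 1 / 144 * s 1 * s 2 ^ 2 * s
      3 ^ 2 + 1 / 48 * s 1 * s 2 ^ 2 * s 6 + 1 / 30 * s 1 * s 2 * s 3 * s 5 + 1 / 64 * s 1
      * s 2 * s 4 ^ 2 + 1 / 16 * s 1 * s 2 * s 8 + 1 / 72 * s 1 * s 3 ^ 2 * s 4 + 1 / 21 *
      s 1 * s 3 * s 7 + 1 / 24 * s 1 * s 4 * s 6 + 1 / 50 * s 1 * s 5 ^ 2 + 1 / 10 * s 1 *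
      s 10 + 1 / 1152 * s 2 ^ 4 * s 3 + 1 / 240 * s 2 ^ 3 * s 5 + 1 / 96 * s 2 ^ 2 * s 3 *
      s 4 + 1 / 56 * s 2 ^ 2 * s 7 + 1 / 324 * s 2 * s 3 ^ 3 + 1 / 36 * s 2 * s 3 * s 6 +
      1 / 40 * s 2 * s 4 * s 5 + 1 / 18 * s 2 * s 9 + 1 / 90 * s 3 ^ 2 * s 5 + 1 / 96 * s
      3 * s 4 ^ 2 + 1 / 24 * s 3 * s 8 + 1 / 28 * s 4 * s 7 + 1 / 30 * s 5 * s 6 + 1 / 11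
      * s 11 := by
  simp only [expCoeff_succ s 10, sum_range_succ, sum_range_zero, Nat.reduceSub, Nat.reduceAdd,
    expCoeff_zero, expCoeff_one, expCoeff_two, expCoeff_three, expCoeff_four, expCoeff_five,
    expCoeff_six, expCoeff_seven, expCoeff_eight, expCoeff_nine, expCoeff_ten]
  push_cast
  ring

lemma lineSum_01235 (w : ℕ → ℂ) (k : ℕ) : lineSum ![0, 1, 2, 3, 5] w k =
    (1 / 30 : ℂ) * expCoeff (fun m => (1 ^ m + 2 ^ m + 3 ^ m + 5 ^ m) * w m) k +
    (1 / (-8) : ℂ) * expCoeff (fun m => ((-1) ^ m + 1 ^ m + 2 ^ m + 4 ^ m) * w m) k +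
    (1 / 6 : ℂ) * expCoeff (fun m => ((-2) ^ m + (-1) ^ m + 1 ^ m + 3 ^ m) * w m) k +
    (1 / (-12) : ℂ) * expCoeff (fun m => ((-3) ^ m + (-2) ^ m + (-1) ^ m + 2 ^ m) * w m) k +
    (1 / 120 : ℂ) * expCoeff (fun m => ((-5) ^ m + (-4) ^ m + (-3) ^ m + (-2) ^ m) * w m) k := by
  simp only [lineSum, Fin.sum_univ_five, Fin.sum_univ_four, Fin.prod_univ_four]
  simp [Fin.succAbove, Fin.lt_def]
  norm_num

lemma lineSum_01236 (w : ℕ → ℂ) (k : ℕ) : lineSum ![0, 1, 2, 3, 6] w k =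
    (1 / 36 : ℂ) * expCoeff (fun m => (1 ^ m + 2 ^ m + 3 ^ m + 6 ^ m) * w m) k +
    (1 / (-10) : ℂ) * expCoeff (fun m => ((-1) ^ m + 1 ^ m + 2 ^ m + 5 ^ m) * w m) k +
    (1 / 8 : ℂ) * expCoeff (fun m => ((-2) ^ m + (-1) ^ m + 1 ^ m + 4 ^ m) * w m) k +
    (1 / (-18) : ℂ) * expCoeff (fun m => ((-3) ^ m + (-2) ^ m + (-1) ^ m + 3 ^ m) * w m) k +
    (1 / 360 : ℂ) * expCoeff (fun m => ((-6) ^ m + (-5) ^ m + (-4) ^ m + (-3) ^ m) * w m) k := by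
  simp only [lineSum, Fin.sum_univ_five, Fin.sum_univ_four, Fin.prod_univ_four]
  simp [Fin.succAbove, Fin.lt_def]
  norm_num

lemma lineSum_01245 (w : ℕ → ℂ) (k : ℕ) : lineSum ![0, 1, 2, 4, 5] w k =
    (1 / 40 : ℂ) * expCoeff (fun m => (1 ^ m + 2 ^ m + 4 ^ m + 5 ^ m) * w m) k +
    (1 / (-12) : ℂ) * expCoeff (fun m => ((-1) ^ m + 1 ^ m + 3 ^ m + 4 ^ m) * w m) k +
    (1 / 12 : ℂ) * expCoeff (fun m => ((-2) ^ m + (-1) ^ m + 2 ^ m + 3 ^ m) * w m) k +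
    (1 / (-24) : ℂ) * expCoeff (fun m => ((-4) ^ m + (-3) ^ m + (-2) ^ m + 1 ^ m) * w m) k +
    (1 / 60 : ℂ) * expCoeff (fun m => ((-5) ^ m + (-4) ^ m + (-3) ^ m + (-1) ^ m) * w m) k := by
  simp only [lineSum, Fin.sum_univ_five, Fin.sum_univ_four, Fin.prod_univ_four]
  simp [Fin.succAbove, Fin.lt_def]
  norm_num

/-! ### Elimination of the coefficients of weight at least six -/

/-! Write `e` for the defect `w 5 + w 2 * w 3`, which vanishes for solutions of the differential
equation. The equation of weight `k` along a line is linear in `w k`, with a factor depending on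
the line. Hence one line determines `w 6` and `w 7`. In the weights `8` to `11` two or three lines
determine `w k` (the lemmas `coeff_*`) and leave relations among `w 1`, `w 2`, `w 3`, `w 4` and `e`
alone (the lemmas `relation_*`): the multipliers of the equations are found by linear
algebra. In weight `11` the multipliers are chosen so that `w 11` cancels. -/

lemma coeff_six {w : ℕ → ℂ} {e : ℂ} (he : w 5 = e - w 2 * w 3)
    (hA : LineRel ![0, 1, 2, 3, 5] w) :
    w 6 = - 625 / 168 * w 1 ^ 6 - 125 / 8 * w 1 ^ 4 * w 2 - 275 / 21 * w 1 ^ 3 * w 3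
      + (-675 / 56 * w 2 ^ 2 - 255 / 28 * w 4) * w 1 ^ 2 + (-5 * w 2 * w 3 - 30 / 7 * e) * w 1
      + (-55 / 56 * w 2 ^ 3 - 57 / 28 * w 2 * w 4 - 17 / 21 * w 3 ^ 2) := by
  have e0 := hA 6 (by norm_num)
  rw [lineSum_01235] at e0
  simp only [expCoeff_six, he] at e0
  linear_combination (6 / 259) * e0

lemma coeff_seven {w : ℕ → ℂ} {e : ℂ} (he : w 5 = e - w 2 * w 3)
    (hA : LineRel ![0, 1, 2, 3, 5] w) :
    w 7 = 625 / 48 * w 1 ^ 7 + 875 / 16 * w 1 ^ 5 * w 2 + 2075 / 48 * w 1 ^ 4 * w 3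
      + (2075 / 48 * w 2 ^ 2 + 80 / 3 * w 4) * w 1 ^ 3 + (175 / 8 * w 2 * w 3
      + 75 / 8 * e) * w 1 ^ 2 + (65 / 16 * w 2 ^ 3 + 5 * w 2 * w 4 + 5 / 2 * w 3 ^ 2) * w 1
      + (49 / 48 * w 2 ^ 2 * w 3 - 7 / 8 * w 2 * e - 7 / 24 * w 3 * w 4) := by
  have e0 := hA 7 (by norm_num)
  rw [lineSum_01235] at e0
  simp only [expCoeff_seven, he, coeff_six he hA] at e0
  linear_combination (1 / 48) * e0

lemma coeff_eight {w : ℕ → ℂ} {e : ℂ} (he : w 5 = e - w 2 * w 3)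
    (hA : LineRel ![0, 1, 2, 3, 5] w)
    (hB : LineRel ![0, 1, 2, 3, 6] w) :
    w 8 = - 15625 / 648 * w 1 ^ 8 - 6250 / 63 * w 1 ^ 6 * w 2 - 6250 / 81 * w 1 ^ 5 * w 3
      + (-15625 / 216 * w 2 ^ 2 - 9625 / 216 * w 4) * w 1 ^ 4 + (-6500 / 189 * w 2 * w 3
      - 125 / 9 * e) * w 1 ^ 3 + (-325 / 252 * w 2 ^ 3 - 475 / 252 * w 2 * w 4 - 100 / 27 * w
      3 ^ 2) * w 1 ^ 2 + (35 / 27 * w 2 ^ 2 * w 3 + 85 / 21 * w 2 * e + 35 / 27 * w 3 * w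
      4) * w 1 + (215 / 378 * w 2 ^ 4 + 1885 / 1512 * w 2 ^ 2 * w 4 + 40 / 63 * w 2 * w 3 ^ 2
      + 7 / 108 * w 4 ^ 2) := by
  have e0 := hA 8 (by norm_num)
  rw [lineSum_01235] at e0
  have e1 := hB 8 (by norm_num)
  rw [lineSum_01236] at e1
  simp only [expCoeff_eight, he, coeff_six he hA, coeff_seven he hA] at e0 e1
  linear_combination (-7181 / 597240) * e0 + (3421 / 597240) * e1

lemma relation_eight {w : ℕ → ℂ} {e : ℂ} (he : w 5 = e - w 2 * w 3)
    (hA : LineRel ![0, 1, 2, 3, 5] w)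
    (hB : LineRel ![0, 1, 2, 3, 6] w) :
    -625 * w 1 ^ 8 - 4500 * w 1 ^ 6 * w 2 - 200 * w 1 ^ 5 * w 3 + (-10200 * w 2 ^ 2 - 30 * w
      4) * w 1 ^ 4 - 1200 * w 1 ^ 3 * w 2 * w 3 + (-7200 * w 2 ^ 3 - 180 * w 2 * w 4
      + 4800 * w 3 ^ 2) * w 1 ^ 2 + (-2760 * w 2 ^ 2 * w 3 + 4800 * w 3 * w 4) * w 1
      + (-651 * w 2 ^ 4 - 510 * w 2 ^ 2 * w 4 - 576 * w 2 * w 3 ^ 2 + 1152 * w 3 * e + 600 * w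
      4 ^ 2) = 0 := by
  have e0 := hA 8 (by norm_num)
  rw [lineSum_01235] at e0
  have e1 := hB 8 (by norm_num)
  rw [lineSum_01236] at e1
  simp only [expCoeff_eight, he, coeff_six he hA, coeff_seven he hA] at e0 e1
  linear_combination (6054 / 395) * e0 + (-2694 / 395) * e1

lemma coeff_nine {w : ℕ → ℂ} {e : ℂ} (he : w 5 = e - w 2 * w 3)
    (hA : LineRel ![0, 1, 2, 3, 5] w)
    (hB : LineRel ![0, 1, 2, 3, 6] w) :
    w 9 = 11875 / 384 * w 1 ^ 9 + 3875 / 32 * w 1 ^ 7 * w 2 + 48925 / 504 * w 1 ^ 6 * w 3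
      + (1625 / 24 * w 2 ^ 2 + 10285 / 192 * w 4) * w 1 ^ 5 + (155 / 6 * w 2 * w 3
      + 125 / 8 * e) * w 1 ^ 4 + (-295 / 16 * w 2 ^ 3 - 371 / 32 * w 2 * w 4 + 115 / 21 * w
      3 ^ 2) * w 1 ^ 3 + (-235 / 21 * w 2 ^ 2 * w 3 - 75 / 8 * w 2 * e - 197 / 168 * w 3 * w
      4) * w 1 ^ 2 + (-1015 / 384 * w 2 ^ 4 - 739 / 192 * w 2 ^ 2 * w 4 - 3 / 2 * w 2 * w
      3 ^ 2 + 3 / 7 * w 3 * e - 5 / 48 * w 4 ^ 2) * w 1 + (-51 / 140 * w 2 ^ 3 * w 3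
      + 9 / 20 * w 2 ^ 2 * e + 3 / 7 * w 2 * w 3 * w 4 + 29 / 315 * w 3 ^ 3) := by
  have e0 := hA 9 (by norm_num)
  rw [lineSum_01235] at e0
  have e1 := hB 9 (by norm_num)
  rw [lineSum_01236] at e1
  simp only [expCoeff_nine, he, coeff_six he hA, coeff_seven he hA, coeff_eight he hA hB] at e0 e1
  linear_combination (-159 / 5600) * e0 + (37 / 5600) * e1

lemma relation_nine {w : ℕ → ℂ} {e : ℂ} (he : w 5 = e - w 2 * w 3)
    (hA : LineRel ![0, 1, 2, 3, 5] w)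
    (hB : LineRel ![0, 1, 2, 3, 6] w) :
    625 * w 1 ^ 9 + 4500 * w 1 ^ 7 * w 2 - 7300 * w 1 ^ 6 * w 3 + (10200 * w 2 ^ 2 + 30 * w
      4) * w 1 ^ 5 - 30300 * w 1 ^ 4 * w 2 * w 3 + (7200 * w 2 ^ 3 + 180 * w 2 * w 4
      - 26400 * w 3 ^ 2) * w 1 ^ 3 + (-23700 * w 2 ^ 2 * w 3 - 12360 * w 3 * w 4) * w 1 ^ 2
      + (795 * w 2 ^ 4 - 930 * w 2 ^ 2 * w 4 - 15840 * w 2 * w 3 ^ 2 - 2880 * w 3 * e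
      + 3000 * w 4 ^ 2) * w 1 + (-1836 * w 2 ^ 3 * w 3 - 432 * w 2 ^ 2 * e - 5400 * w 2 * w
      3 * w 4 - 1536 * w 3 ^ 3 + 2160 * w 4 * e) = 0 := by
  have e0 := hA 9 (by norm_num)
  rw [lineSum_01235] at e0
  have e1 := hB 9 (by norm_num)
  rw [lineSum_01236] at e1
  simp only [expCoeff_nine, he, coeff_six he hA, coeff_seven he hA, coeff_eight he hA hB] at e0 e1
  linear_combination (5976 / 35) * e0 + (-1368 / 35) * e1

lemma coeff_ten {w : ℕ → ℂ} {e : ℂ} (he : w 5 = e - w 2 * w 3)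
    (hA : LineRel ![0, 1, 2, 3, 5] w)
    (hB : LineRel ![0, 1, 2, 3, 6] w)
    (hC : LineRel ![0, 1, 2, 4, 5] w) :
    w 10 = - 1009375 / 33264 * w 1 ^ 10 - 85671875 / 798336 * w 1 ^ 8 * w 2 - 67250 / 693 * w
      1 ^ 7 * w 3 + (-378625 / 22176 * w 2 ^ 2 - 60475 / 1232 * w 4) * w 1 ^ 6
      + (-437075 / 99792 * w 2 * w 3 - 625 / 44 * e) * w 1 ^ 5 + (524525 / 8316 * w 2 ^ 3
      + 4954685 / 133056 * w 2 * w 4 - 9775 / 616 * w 3 ^ 2) * w 1 ^ 4 + (45625 / 2376 * w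
      2 ^ 2 * w 3 + 2875 / 198 * w 2 * e - 555 / 308 * w 3 * w 4) * w 1 ^ 3
      + (33505 / 2772 * w 2 ^ 4 + 233615 / 22176 * w 2 ^ 2 * w 4 - 8615 / 1188 * w 2 * w 3 ^ 2
      - 905 / 308 * w 3 * e + 2525 / 1848 * w 4 ^ 2) * w 1 ^ 2 + (59947 / 33264 * w 2 ^ 3 * w
      3 - 1921 / 924 * w 2 ^ 2 * e - 28625 / 8316 * w 2 * w 3 * w 4 - 2153 / 2079 * w
      3 ^ 3) * w 1 + (21499 / 38016 * w 2 ^ 5 + 73285 / 133056 * w 2 ^ 3 * w 4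
      - 1913 / 5544 * w 2 ^ 2 * w 3 ^ 2 - 821 / 924 * w 2 * w 3 * e - 955 / 33264 * w 2 * w
      4 ^ 2 + 5 / 28 * w 3 ^ 2 * w 4) := by
  have e0 := hA 10 (by norm_num)
  rw [lineSum_01235] at e0
  have e1 := hB 10 (by norm_num)
  rw [lineSum_01236] at e1
  have e2 := hC 10 (by norm_num)
  rw [lineSum_01245] at e2
  simp only [expCoeff_ten, he, coeff_six he hA, coeff_seven he hA, coeff_eight he hA hB,
    coeff_nine he hA hB] at e0 e1 e2
  linear_combination (15032147 / 3718970640) * e0 + (-346891 / 413218960) * e1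
    + (-20404 / 21130515) * e2

lemma relation_ten {w : ℕ → ℂ} {e : ℂ} (he : w 5 = e - w 2 * w 3)
    (hA : LineRel ![0, 1, 2, 3, 5] w)
    (hB : LineRel ![0, 1, 2, 3, 6] w)
    (hC : LineRel ![0, 1, 2, 4, 5] w) :
    -3125 * w 1 ^ 10 - 35000 * w 1 ^ 8 * w 2 - 11000 * w 1 ^ 7 * w 3 + (-133500 * w 2 ^ 2
      - 37650 * w 4) * w 1 ^ 6 - 52000 * w 1 ^ 5 * w 2 * w 3 + (-208500 * w 2 ^ 3 - 159000 * w
      2 * w 4 + 4800 * w 3 ^ 2) * w 1 ^ 4 + (-53400 * w 2 ^ 2 * w 3 - 84480 * w 3 * w 4) * w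
      1 ^ 3 + (-121035 * w 2 ^ 4 - 128490 * w 2 ^ 2 * w 4 + 75840 * w 2 * w 3 ^ 2 + 11520 * w
      3 * e - 40800 * w 4 ^ 2) * w 1 ^ 2 + (-40080 * w 2 ^ 3 * w 3 + 960 * w 2 * w 3 * w 4
      + 10240 * w 3 ^ 3) * w 1 + (-10752 * w 2 ^ 5 - 18300 * w 2 ^ 3 * w 4 - 1152 * w
      2 ^ 2 * w 3 ^ 2 + 12672 * w 2 * w 3 * e - 4200 * w 2 * w 4 ^ 2 + 3456 * e ^ 2) = 0 := by
  have e0 := hA 10 (by norm_num)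
  rw [lineSum_01235] at e0
  have e1 := hB 10 (by norm_num)
  rw [lineSum_01236] at e1
  have e2 := hC 10 (by norm_num)
  rw [lineSum_01245] at e2
  simp only [expCoeff_ten, he, coeff_six he hA, coeff_seven he hA, coeff_eight he hA hB,
    coeff_nine he hA hB] at e0 e1 e2
  linear_combination (8783112 / 335405) * e0 + (-405864 / 67081) * e1 + (-1504128 / 335405) * e2

lemma relation_ten_alt {w : ℕ → ℂ} {e : ℂ} (he : w 5 = e - w 2 * w 3)
    (hA : LineRel ![0, 1, 2, 3, 5] w)
    (hB : LineRel ![0, 1, 2, 3, 6] w)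
    (hC : LineRel ![0, 1, 2, 4, 5] w) :
    -3125 * w 1 ^ 10 - 33750 * w 1 ^ 8 * w 2 - 1000 * w 1 ^ 7 * w 3 + (-128250 * w 2 ^ 2
      - 18900 * w 4) * w 1 ^ 6 - 9600 * w 1 ^ 5 * w 2 * w 3 + (-203850 * w 2 ^ 3 - 80190 * w
      2 * w 4 + 36000 * w 3 ^ 2) * w 1 ^ 4 + (-29400 * w 2 ^ 2 * w 3 - 6000 * w 3 * w 4) * w
      1 ^ 3 + (-119265 * w 2 ^ 4 - 71760 * w 2 ^ 2 * w 4 + 80640 * w 2 * w 3 ^ 2 + 14400 * w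
      3 * e - 6900 * w 4 ^ 2) * w 1 ^ 2 + (-38592 * w 2 ^ 3 * w 3 - 864 * w 2 ^ 2 * e
      + 30960 * w 2 * w 3 * w 4 + 8448 * w 3 ^ 3 + 4320 * w 4 * e) * w 1 + (-10584 * w 2 ^ 5
      - 13230 * w 2 ^ 3 * w 4 - 2784 * w 2 ^ 2 * w 3 ^ 2 + 15552 * w 2 * w 3 * e + 2700 * w
      2 * w 4 ^ 2 + 960 * w 3 ^ 2 * w 4) = 0 := by
  have e0 := hA 10 (by norm_num)
  rw [lineSum_01235] at e0
  have e1 := hB 10 (by norm_num)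
  rw [lineSum_01236] at e1
  have e2 := hC 10 (by norm_num)
  rw [lineSum_01245] at e2
  simp only [expCoeff_ten, he, coeff_six he hA, coeff_seven he hA, coeff_eight he hA hB,
    coeff_nine he hA hB] at e0 e1 e2
  linear_combination (15499192 / 335405) * e0 + (-3362904 / 335405) * e1 + (-3358624 / 335405) * e2

lemma relation_eleven {w : ℕ → ℂ} {e : ℂ} (he : w 5 = e - w 2 * w 3)
    (hA : LineRel ![0, 1, 2, 3, 5] w)
    (hB : LineRel ![0, 1, 2, 3, 6] w)
    (hC : LineRel ![0, 1, 2, 4, 5] w) :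
    -1368750 * w 1 ^ 11 - 14366875 * w 1 ^ 9 * w 2 + 7227000 * w 1 ^ 8 * w 3 + (-52236000 * w
      2 ^ 2 - 13003200 * w 4) * w 1 ^ 7 + (28856200 * w 2 * w 3 + 630000 * e) * w 1 ^ 6
      + (-78534300 * w 2 ^ 3 - 54948270 * w 2 * w 4 + 37316800 * w 3 ^ 2) * w 1 ^ 5
      + (20764800 * w 2 ^ 2 * w 3 + 2646000 * w 2 * e - 8476080 * w 3 * w 4) * w 1 ^ 4
      + (-44310990 * w 2 ^ 4 - 45079620 * w 2 ^ 2 * w 4 + 45864000 * w 2 * w 3 ^ 2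
      + 10419840 * w 3 * e - 12657000 * w 4 ^ 2) * w 1 ^ 3 + (-7457496 * w 2 ^ 3 * w 3
      + 2358288 * w 2 ^ 2 * e + 923520 * w 2 * w 3 * w 4 + 2499584 * w 3 ^ 3 - 43200 * w
      4 * e) * w 1 ^ 2 + (-3935253 * w 2 ^ 5 - 6294750 * w 2 ^ 3 * w 4 + 2504832 * w 2 ^ 2 * w
      3 ^ 2 + 5223168 * w 2 * w 3 * e - 1711200 * w 2 * w 4 ^ 2 - 3866880 * w 3 ^ 2 * w 4
      + 411264 * e ^ 2) * w 1 + (243096 * w 2 ^ 4 * w 3 + 244944 * w 2 ^ 3 * e + 320880 * w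
      2 ^ 2 * w 3 * w 4 + 516096 * w 2 * w 3 ^ 3 - 580608 * w 3 ^ 2 * e - 537600 * w 3 * w
      4 ^ 2) = 0 := by
  have e0 := hA 11 (by norm_num)
  rw [lineSum_01235] at e0
  have e1 := hB 11 (by norm_num)
  rw [lineSum_01236] at e1
  have e2 := hC 11 (by norm_num)
  rw [lineSum_01245] at e2
  simp only [expCoeff_eleven, he, coeff_six he hA, coeff_seven he hA, coeff_eight he hA hB,
    coeff_nine he hA hB, coeff_ten he hA hB hC] at e0 e1 e2
  linear_combination (-824344 / 315) * e0 + (14632 / 35) * e1 + (-12224 / 63) * e2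

/-! ### The two components -/

/-- The equations of the Todd surface in terms of the coefficients of `X * Q' / Q`. -/
def IsToddPoint (a b c d : ℂ) : Prop :=
  a ^ 3 + 3 * a * b + 2 * c = 0 ∧
    22 * a ^ 4 + 84 * a ^ 2 * b + 80 * a * c + 42 * b ^ 2 + 60 * d = 0

/-- The equations of the surface of elliptic functions of level `5` in terms of the coefficients
of `X * Q' / Q`. -/
def IsEllipticPoint (a b c d : ℂ) : Prop :=
  125 * a ^ 4 + 150 * a ^ 2 * b + 40 * a * c + 15 * b ^ 2 + 6 * d = 0 ∧
    31250 * a ^ 6 + 41250 * a ^ 4 * b + 8000 * a ^ 3 * c + 8550 * a ^ 2 * b ^ 2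
      + 960 * a * b * c + 486 * b ^ 3 - 64 * c ^ 2 = 0

/-- First step towards `e = 0`: the relations of weights `8` to `11` generate `c ^ 2 * e ^ 2`. The
cofactors certify the ideal membership, which amounts to linear algebra in each weight; the same
holds for the next four lemmas. -/
lemma sq_mul_sq_eq_zero_of_relations {F : Type*} [Field F] [CharZero F] {a b c d e : F}
    (r8 : - 625 * a ^ 8 - 4500 * a ^ 6 * b - 200 * a ^ 5 * c + (-10200 * b ^ 2
      - 30 * d) * a ^ 4 - 1200 * a ^ 3 * b * c + (-7200 * b ^ 3 - 180 * b * d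
      + 4800 * c ^ 2) * a ^ 2 + (-2760 * b ^ 2 * c + 4800 * c * d) * a + (-651 * b ^ 4
      - 510 * b ^ 2 * d - 576 * b * c ^ 2 + 1152 * c * e + 600 * d ^ 2) = 0)
    (r9 : 625 * a ^ 9 + 4500 * a ^ 7 * b - 7300 * a ^ 6 * c + (10200 * b ^ 2 + 30 * d) * a ^ 5
      - 30300 * a ^ 4 * b * c + (7200 * b ^ 3 + 180 * b * d - 26400 * c ^ 2) * a ^ 3
      + (-23700 * b ^ 2 * c - 12360 * c * d) * a ^ 2 + (795 * b ^ 4 - 930 * b ^ 2 * d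
      - 15840 * b * c ^ 2 - 2880 * c * e + 3000 * d ^ 2) * a + (-1836 * b ^ 3 * c
      - 432 * b ^ 2 * e - 5400 * b * c * d - 1536 * c ^ 3 + 2160 * d * e) = 0)
    (r10a : - 3125 * a ^ 10 - 35000 * a ^ 8 * b - 11000 * a ^ 7 * c + (-133500 * b ^ 2
      - 37650 * d) * a ^ 6 - 52000 * a ^ 5 * b * c + (-208500 * b ^ 3 - 159000 * b * d
      + 4800 * c ^ 2) * a ^ 4 + (-53400 * b ^ 2 * c - 84480 * c * d) * a ^ 3
      + (-121035 * b ^ 4 - 128490 * b ^ 2 * d + 75840 * b * c ^ 2 + 11520 * c * e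
      - 40800 * d ^ 2) * a ^ 2 + (-40080 * b ^ 3 * c + 960 * b * c * d + 10240 * c ^ 3) * a
      + (-10752 * b ^ 5 - 18300 * b ^ 3 * d - 1152 * b ^ 2 * c ^ 2 + 12672 * b * c * e
      - 4200 * b * d ^ 2 + 3456 * e ^ 2) = 0)
    (r10b : - 3125 * a ^ 10 - 33750 * a ^ 8 * b - 1000 * a ^ 7 * c + (-128250 * b ^ 2
      - 18900 * d) * a ^ 6 - 9600 * a ^ 5 * b * c + (-203850 * b ^ 3 - 80190 * b * d
      + 36000 * c ^ 2) * a ^ 4 + (-29400 * b ^ 2 * c - 6000 * c * d) * a ^ 3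
      + (-119265 * b ^ 4 - 71760 * b ^ 2 * d + 80640 * b * c ^ 2 + 14400 * c * e
      - 6900 * d ^ 2) * a ^ 2 + (-38592 * b ^ 3 * c - 864 * b ^ 2 * e + 30960 * b * c * d
      + 8448 * c ^ 3 + 4320 * d * e) * a + (-10584 * b ^ 5 - 13230 * b ^ 3 * d
      - 2784 * b ^ 2 * c ^ 2 + 15552 * b * c * e + 2700 * b * d ^ 2 + 960 * c ^ 2 * d) = 0)
    (r11 : - 1368750 * a ^ 11 - 14366875 * a ^ 9 * b + 7227000 * a ^ 8 * c
      + (-52236000 * b ^ 2 - 13003200 * d) * a ^ 7 + (28856200 * b * c + 630000 * e) * a ^ 6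
      + (-78534300 * b ^ 3 - 54948270 * b * d + 37316800 * c ^ 2) * a ^ 5
      + (20764800 * b ^ 2 * c + 2646000 * b * e - 8476080 * c * d) * a ^ 4
      + (-44310990 * b ^ 4 - 45079620 * b ^ 2 * d + 45864000 * b * c ^ 2 + 10419840 * c * e
      - 12657000 * d ^ 2) * a ^ 3 + (-7457496 * b ^ 3 * c + 2358288 * b ^ 2 * e
      + 923520 * b * c * d + 2499584 * c ^ 3 - 43200 * d * e) * a ^ 2 + (-3935253 * b ^ 5
      - 6294750 * b ^ 3 * d + 2504832 * b ^ 2 * c ^ 2 + 5223168 * b * c * e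
      - 1711200 * b * d ^ 2 - 3866880 * c ^ 2 * d + 411264 * e ^ 2) * a + (243096 * b ^ 4 * c
      + 244944 * b ^ 3 * e + 320880 * b ^ 2 * c * d + 516096 * b * c ^ 3 - 580608 * c ^ 2 * e
      - 537600 * c * d ^ 2) = 0) :
    c ^ 2 * e ^ 2 = 0 := by
  linear_combination
    1 / 8193540096000 * ((9330750 * a ^ 5 + 38069460 * a ^ 3 * b - 61024716 * a ^ 2 * c
      + (35805870 * b ^ 2 - 27871200 * d) * a + (10556892 * b * c + 4482360 * e)) * r11
      + (26320424375 * a ^ 8 + 135799221075 * a ^ 6 * b - 230594273980 * a ^ 5 * c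
      + (203869614375 * b ^ 2 - 21198778650 * d) * a ^ 4 + (-279310690008 * b * c
      + 7526263752 * e) * a ^ 3 + (104927426919 * b ^ 3 - 96368573070 * b * d
      - 52818461248 * c ^ 2) * a ^ 2 + (62356674996 * b ^ 2 * c + 10164167496 * b * e
      - 20954656800 * c * d) * a + (-5885450928 * b ^ 4 + 4012273440 * b ^ 2 * d
      + 14560682304 * b * c ^ 2 + 6909110208 * c * e)) * r8 + (21588350000 * a ^ 7
      + 89887287000 * a ^ 5 * b - 80277540280 * a ^ 4 * c + (79809430680 * b ^ 2
      - 12456775800 * d) * a ^ 3 + (4946226432 * b * c - 868020048 * e) * a ^ 2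
      + (5297019840 * b ^ 3 + 2785368600 * b * d - 1599466624 * c ^ 2) * a
      + (-198347688 * b ^ 2 * c - 401227344 * b * e - 803587680 * c * d)) * r9
      + (-1927456125 * a ^ 6 - 7962072615 * a ^ 4 * b - 2591266020 * a ^ 3 * c
      + (-7734964041 * b ^ 2 + 5449777830 * d) * a ^ 2 + (-4272792300 * b * c
      - 533400840 * e) * a + (-367840683 * b ^ 3 + 250767090 * b * d
      + 820815744 * c ^ 2)) * r10a + (-3105827250 * a ^ 6 - 12475671930 * a ^ 4 * b
      + 36625721568 * a ^ 3 * c + (-11591047098 * b ^ 2 + 11641340340 * d) * a ^ 2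
      + (-3286133856 * b * c - 1227650400 * e) * a + (735681366 * b ^ 3 - 501534180 * b * d
      - 1285740288 * c ^ 2)) * r10b)

/-- Second step towards `e = 0`: for `c = 0` the relations of weights `8` to `10` generate `e ^ 4`.
-/
lemma pow_four_eq_zero_of_relations {F : Type*} [Field F] [CharZero F] {a b d e : F}
    (r8 : - 625 * a ^ 8 - 4500 * a ^ 6 * b + (-10200 * b ^ 2 - 30 * d) * a ^ 4
      + (-7200 * b ^ 3 - 180 * b * d) * a ^ 2 + (-651 * b ^ 4 - 510 * b ^ 2 * d + 600 * d ^ 2)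
      = 0)
    (r9 : 625 * a ^ 9 + 4500 * a ^ 7 * b + (10200 * b ^ 2 + 30 * d) * a ^ 5 + (7200 * b ^ 3
      + 180 * b * d) * a ^ 3 + (795 * b ^ 4 - 930 * b ^ 2 * d + 3000 * d ^ 2) * a
      + (-432 * b ^ 2 * e + 2160 * d * e) = 0)
    (r10a : - 3125 * a ^ 10 - 35000 * a ^ 8 * b + (-133500 * b ^ 2 - 37650 * d) * a ^ 6
      + (-208500 * b ^ 3 - 159000 * b * d) * a ^ 4 + (-121035 * b ^ 4 - 128490 * b ^ 2 * d
      - 40800 * d ^ 2) * a ^ 2 + (-10752 * b ^ 5 - 18300 * b ^ 3 * d - 4200 * b * d ^ 2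
      + 3456 * e ^ 2) = 0)
    (r10b : - 3125 * a ^ 10 - 33750 * a ^ 8 * b + (-128250 * b ^ 2 - 18900 * d) * a ^ 6
      + (-203850 * b ^ 3 - 80190 * b * d) * a ^ 4 + (-119265 * b ^ 4 - 71760 * b ^ 2 * d
      - 6900 * d ^ 2) * a ^ 2 + (-864 * b ^ 2 * e + 4320 * d * e) * a + (-10584 * b ^ 5
      - 13230 * b ^ 3 * d + 2700 * b * d ^ 2) = 0) :
    e ^ 4 = 0 := by
  linear_combination
    1 / 31352832 * ((2700000 * a ^ 6 * d + 11340000 * a ^ 4 * b * d + 50349600 * a ^ 2 * d ^ 2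
      + 5248800 * b * d ^ 2) * r10b + ((51783125 * b ^ 2 - 277815625 * d) * a ^ 8
      + 2377500 * a ^ 7 * e + (211991625 * b ^ 3 - 1187938125 * b * d) * a ^ 6
      + 9805500 * a ^ 5 * b * e + (166449225 * b ^ 4 - 1012463535 * b ^ 2 * d
      - 471960150 * d ^ 2) * a ^ 4 + (-6489000 * b ^ 2 * e + 115876620 * d * e) * a ^ 3
      + (19362285 * b ^ 5 - 275852835 * b ^ 3 * d - 47827350 * b * d ^ 2
      + 24090480 * e ^ 2) * a ^ 2 + (-59542020 * b ^ 3 * e + 306103320 * b * d * e) * a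
      + (-1548288 * b ^ 6 - 2635200 * b ^ 4 * d - 42595200 * b ^ 2 * d ^ 2
      - 181440 * b * e ^ 2)) * r8 + ((53170625 * b ^ 2 - 271253125 * d) * a ^ 7
      + 2377500 * a ^ 6 * e + (223256625 * b ^ 3 - 1138963125 * b * d) * a ^ 5
      + 9805500 * a ^ 4 * b * e + (185979225 * b ^ 4 - 855234435 * b ^ 2 * d
      - 474007650 * d ^ 2) * a ^ 3 + (8595900 * b ^ 2 * e + 40452120 * d * e) * a ^ 2
      + (16105005 * b ^ 5 - 56429235 * b ^ 3 * d - 130976550 * b * d ^ 2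
      + 24135840 * e ^ 2) * a + (797580 * b ^ 3 * e + 4405320 * b * d * e)) * r9
      + ((277500 * b ^ 2 - 1387500 * d) * a ^ 6 + (1143000 * b ^ 3 - 5715000 * b * d) * a ^ 4
      + (10061820 * b ^ 2 * d - 50309100 * d ^ 2) * a ^ 2 + (3016980 * b ^ 2 * e
      - 15084900 * d * e) * a + (93744 * b ^ 5 + 73440 * b ^ 3 * d - 2710800 * b * d ^ 2
      + 9072 * e ^ 2)) * r10a)

/-- For `e = 0` the relations force the product of any equation of the Todd surface with any
equation of the elliptic surface to vanish. Here: the equation of weight `3` of the former and that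
of weight `4` of the latter, squared. -/
lemma todd_three_mul_elliptic_four {F : Type*} [Field F] [CharZero F] {a b c d : F}
    (r8 : - 625 * a ^ 8 - 4500 * a ^ 6 * b - 200 * a ^ 5 * c + (-10200 * b ^ 2
      - 30 * d) * a ^ 4 - 1200 * a ^ 3 * b * c + (-7200 * b ^ 3 - 180 * b * d
      + 4800 * c ^ 2) * a ^ 2 + (-2760 * b ^ 2 * c + 4800 * c * d) * a + (-651 * b ^ 4
      - 510 * b ^ 2 * d - 576 * b * c ^ 2 + 600 * d ^ 2) = 0)
    (r9 : 625 * a ^ 9 + 4500 * a ^ 7 * b - 7300 * a ^ 6 * c + (10200 * b ^ 2 + 30 * d) * a ^ 5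
      - 30300 * a ^ 4 * b * c + (7200 * b ^ 3 + 180 * b * d - 26400 * c ^ 2) * a ^ 3
      + (-23700 * b ^ 2 * c - 12360 * c * d) * a ^ 2 + (795 * b ^ 4 - 930 * b ^ 2 * d
      - 15840 * b * c ^ 2 + 3000 * d ^ 2) * a + (-1836 * b ^ 3 * c - 5400 * b * c * d
      - 1536 * c ^ 3) = 0)
    (r10a : - 3125 * a ^ 10 - 35000 * a ^ 8 * b - 11000 * a ^ 7 * c + (-133500 * b ^ 2
      - 37650 * d) * a ^ 6 - 52000 * a ^ 5 * b * c + (-208500 * b ^ 3 - 159000 * b * d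
      + 4800 * c ^ 2) * a ^ 4 + (-53400 * b ^ 2 * c - 84480 * c * d) * a ^ 3
      + (-121035 * b ^ 4 - 128490 * b ^ 2 * d + 75840 * b * c ^ 2 - 40800 * d ^ 2) * a ^ 2
      + (-40080 * b ^ 3 * c + 960 * b * c * d + 10240 * c ^ 3) * a + (-10752 * b ^ 5
      - 18300 * b ^ 3 * d - 1152 * b ^ 2 * c ^ 2 - 4200 * b * d ^ 2) = 0)
    (r10b : - 3125 * a ^ 10 - 33750 * a ^ 8 * b - 1000 * a ^ 7 * c + (-128250 * b ^ 2
      - 18900 * d) * a ^ 6 - 9600 * a ^ 5 * b * c + (-203850 * b ^ 3 - 80190 * b * d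
      + 36000 * c ^ 2) * a ^ 4 + (-29400 * b ^ 2 * c - 6000 * c * d) * a ^ 3
      + (-119265 * b ^ 4 - 71760 * b ^ 2 * d + 80640 * b * c ^ 2 - 6900 * d ^ 2) * a ^ 2
      + (-38592 * b ^ 3 * c + 30960 * b * c * d + 8448 * c ^ 3) * a + (-10584 * b ^ 5
      - 13230 * b ^ 3 * d - 2784 * b ^ 2 * c ^ 2 + 2700 * b * d ^ 2 + 960 * c ^ 2 * d) = 0)
    (r11 : - 1368750 * a ^ 11 - 14366875 * a ^ 9 * b + 7227000 * a ^ 8 * c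
      + (-52236000 * b ^ 2 - 13003200 * d) * a ^ 7 + 28856200 * a ^ 6 * b * c
      + (-78534300 * b ^ 3 - 54948270 * b * d + 37316800 * c ^ 2) * a ^ 5
      + (20764800 * b ^ 2 * c - 8476080 * c * d) * a ^ 4 + (-44310990 * b ^ 4
      - 45079620 * b ^ 2 * d + 45864000 * b * c ^ 2 - 12657000 * d ^ 2) * a ^ 3
      + (-7457496 * b ^ 3 * c + 923520 * b * c * d + 2499584 * c ^ 3) * a ^ 2
      + (-3935253 * b ^ 5 - 6294750 * b ^ 3 * d + 2504832 * b ^ 2 * c ^ 2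
      - 1711200 * b * d ^ 2 - 3866880 * c ^ 2 * d) * a + (243096 * b ^ 4 * c
      + 320880 * b ^ 2 * c * d + 516096 * b * c ^ 3 - 537600 * c * d ^ 2) = 0) :
    ((a ^ 3 + 3 * a * b + 2 * c) * (125 * a ^ 4 + 150 * a ^ 2 * b + 40 * a * c + 15 * b ^ 2
      + 6 * d)) ^ 2 = 0 := by
  linear_combination
    1 / 840 * ((108500 * a ^ 5 + 382200 * a ^ 3 * b - 8330 * a ^ 2 * c + (147420 * b ^ 2
      - 31752 * d) * a + 43470 * b * c) * r9 + (-15 * c) * r11 + (-122500 * a ^ 6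
      - 1029000 * a ^ 4 * b - 1936025 * a ^ 3 * c + (-1871100 * b ^ 2 - 1474200 * d) * a ^ 2
      - 2077425 * a * b * c + (-580608 * b * d - 129360 * c ^ 2)) * r8 + (-172095 * a * c
      - 36288 * d) * r10a + (42000 * a ^ 4 + 126000 * a ^ 2 * b + 285660 * a * c
      + 72576 * d) * r10b)

/-- The product of the Todd equation of weight `3` and the elliptic equation of weight `6`, squared.
-/
lemma todd_three_mul_elliptic_six {F : Type*} [Field F] [CharZero F] {a b c d : F}
    (r8 : - 625 * a ^ 8 - 4500 * a ^ 6 * b - 200 * a ^ 5 * c + (-10200 * b ^ 2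
      - 30 * d) * a ^ 4 - 1200 * a ^ 3 * b * c + (-7200 * b ^ 3 - 180 * b * d
      + 4800 * c ^ 2) * a ^ 2 + (-2760 * b ^ 2 * c + 4800 * c * d) * a + (-651 * b ^ 4
      - 510 * b ^ 2 * d - 576 * b * c ^ 2 + 600 * d ^ 2) = 0)
    (r9 : 625 * a ^ 9 + 4500 * a ^ 7 * b - 7300 * a ^ 6 * c + (10200 * b ^ 2 + 30 * d) * a ^ 5
      - 30300 * a ^ 4 * b * c + (7200 * b ^ 3 + 180 * b * d - 26400 * c ^ 2) * a ^ 3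
      + (-23700 * b ^ 2 * c - 12360 * c * d) * a ^ 2 + (795 * b ^ 4 - 930 * b ^ 2 * d
      - 15840 * b * c ^ 2 + 3000 * d ^ 2) * a + (-1836 * b ^ 3 * c - 5400 * b * c * d
      - 1536 * c ^ 3) = 0)
    (r10a : - 3125 * a ^ 10 - 35000 * a ^ 8 * b - 11000 * a ^ 7 * c + (-133500 * b ^ 2
      - 37650 * d) * a ^ 6 - 52000 * a ^ 5 * b * c + (-208500 * b ^ 3 - 159000 * b * d
      + 4800 * c ^ 2) * a ^ 4 + (-53400 * b ^ 2 * c - 84480 * c * d) * a ^ 3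
      + (-121035 * b ^ 4 - 128490 * b ^ 2 * d + 75840 * b * c ^ 2 - 40800 * d ^ 2) * a ^ 2
      + (-40080 * b ^ 3 * c + 960 * b * c * d + 10240 * c ^ 3) * a + (-10752 * b ^ 5
      - 18300 * b ^ 3 * d - 1152 * b ^ 2 * c ^ 2 - 4200 * b * d ^ 2) = 0)
    (r10b : - 3125 * a ^ 10 - 33750 * a ^ 8 * b - 1000 * a ^ 7 * c + (-128250 * b ^ 2
      - 18900 * d) * a ^ 6 - 9600 * a ^ 5 * b * c + (-203850 * b ^ 3 - 80190 * b * d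
      + 36000 * c ^ 2) * a ^ 4 + (-29400 * b ^ 2 * c - 6000 * c * d) * a ^ 3
      + (-119265 * b ^ 4 - 71760 * b ^ 2 * d + 80640 * b * c ^ 2 - 6900 * d ^ 2) * a ^ 2
      + (-38592 * b ^ 3 * c + 30960 * b * c * d + 8448 * c ^ 3) * a + (-10584 * b ^ 5
      - 13230 * b ^ 3 * d - 2784 * b ^ 2 * c ^ 2 + 2700 * b * d ^ 2 + 960 * c ^ 2 * d) = 0) :
    ((a ^ 3 + 3 * a * b + 2 * c) * (31250 * a ^ 6 + 41250 * a ^ 4 * b + 8000 * a ^ 3 * c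
      + 8550 * a ^ 2 * b ^ 2 + 960 * a * b * c + 486 * b ^ 3 - 64 * c ^ 2)) ^ 2 = 0 := by
  linear_combination
    1 / 36309000 * ((-56732812500000 * a ^ 10 - 4672759618800000 * a ^ 8 * b
      - 7939465178608750 * a ^ 7 * c + (-31064889351892125 * b ^ 2
      - 20280845920083375 * d) * a ^ 6 - 797854616552790 * a ^ 5 * b * c
      + (-62709096461041305 * b ^ 3 - 167696063813945475 * b * d
      + 153414344117838540 * c ^ 2) * a ^ 4 + (-68027567279087688 * b ^ 2 * c
      - 3503789258799750 * c * d) * a ^ 3 + (-44106790930465236 * b ^ 4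
      - 308241717771135090 * b ^ 2 * d + 31138925207237940 * b * c ^ 2
      - 263003715420313650 * d ^ 2) * a ^ 2 + (-316741622629822974 * b ^ 3 * c
      - 144679612094825400 * b * c * d + 23456543860974976 * c ^ 3) * a
      + (-29087989353229824 * b ^ 5 - 118301204674522260 * b ^ 3 * d
      - 166249798632209304 * b ^ 2 * c ^ 2 - 95223988767203100 * b * d ^ 2
      - 13010171166720000 * c ^ 2 * d)) * r8 + (-4591064368800000 * a ^ 7 * b
      - 7701641228608750 * a ^ 6 * c + (-31039836141892125 * b ^ 2
      - 1820192728011375 * d) * a ^ 5 - 15569712380382570 * a ^ 4 * b * c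
      + (-59714147631986190 * b ^ 3 - 30932133752101050 * b * d
      + 26898029721431760 * c ^ 2) * a ^ 3 + (17256086812343442 * b ^ 2 * c
      + 38712711626168700 * c * d) * a ^ 2 + (-23330266540304091 * b ^ 4
      - 73206664644054315 * b ^ 2 * d + 7987252989049104 * b * c ^ 2
      - 42612450164766150 * d ^ 2) * a + (22729086761314086 * b ^ 3 * c
      + 24630887167481700 * b * c * d - 387296000 * c ^ 3)) * r9
      + (3692675273414400 * a ^ 4 * d + 8134462632754044 * a ^ 3 * b * c
      + (598414631251023 * b ^ 3 + 12582215631111285 * b * d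
      - 6960565940620356 * c ^ 2) * a ^ 2 + (25743784246131150 * b ^ 2 * c
      + 910169076014910 * c * d) * a + (1761186855371337 * b ^ 4
      + 5544944136901575 * b ^ 2 * d - 23555218163364036 * b * c ^ 2
      - 8376126051543300 * d ^ 2)) * r10a + ((31603314589398720 * b * c ^ 2
      + 8131356979200000 * d ^ 2)) * r10b)

/-- The product of the Todd equation of weight `4` and the elliptic equation of weight `4`, squared.
-/
lemma todd_four_mul_elliptic_four {F : Type*} [Field F] [CharZero F] {a b c d : F}
    (r8 : - 625 * a ^ 8 - 4500 * a ^ 6 * b - 200 * a ^ 5 * c + (-10200 * b ^ 2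
      - 30 * d) * a ^ 4 - 1200 * a ^ 3 * b * c + (-7200 * b ^ 3 - 180 * b * d
      + 4800 * c ^ 2) * a ^ 2 + (-2760 * b ^ 2 * c + 4800 * c * d) * a + (-651 * b ^ 4
      - 510 * b ^ 2 * d - 576 * b * c ^ 2 + 600 * d ^ 2) = 0)
    (r9 : 625 * a ^ 9 + 4500 * a ^ 7 * b - 7300 * a ^ 6 * c + (10200 * b ^ 2 + 30 * d) * a ^ 5
      - 30300 * a ^ 4 * b * c + (7200 * b ^ 3 + 180 * b * d - 26400 * c ^ 2) * a ^ 3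
      + (-23700 * b ^ 2 * c - 12360 * c * d) * a ^ 2 + (795 * b ^ 4 - 930 * b ^ 2 * d
      - 15840 * b * c ^ 2 + 3000 * d ^ 2) * a + (-1836 * b ^ 3 * c - 5400 * b * c * d
      - 1536 * c ^ 3) = 0)
    (r10a : - 3125 * a ^ 10 - 35000 * a ^ 8 * b - 11000 * a ^ 7 * c + (-133500 * b ^ 2
      - 37650 * d) * a ^ 6 - 52000 * a ^ 5 * b * c + (-208500 * b ^ 3 - 159000 * b * d
      + 4800 * c ^ 2) * a ^ 4 + (-53400 * b ^ 2 * c - 84480 * c * d) * a ^ 3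
      + (-121035 * b ^ 4 - 128490 * b ^ 2 * d + 75840 * b * c ^ 2 - 40800 * d ^ 2) * a ^ 2
      + (-40080 * b ^ 3 * c + 960 * b * c * d + 10240 * c ^ 3) * a + (-10752 * b ^ 5
      - 18300 * b ^ 3 * d - 1152 * b ^ 2 * c ^ 2 - 4200 * b * d ^ 2) = 0)
    (r10b : - 3125 * a ^ 10 - 33750 * a ^ 8 * b - 1000 * a ^ 7 * c + (-128250 * b ^ 2
      - 18900 * d) * a ^ 6 - 9600 * a ^ 5 * b * c + (-203850 * b ^ 3 - 80190 * b * d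
      + 36000 * c ^ 2) * a ^ 4 + (-29400 * b ^ 2 * c - 6000 * c * d) * a ^ 3
      + (-119265 * b ^ 4 - 71760 * b ^ 2 * d + 80640 * b * c ^ 2 - 6900 * d ^ 2) * a ^ 2
      + (-38592 * b ^ 3 * c + 30960 * b * c * d + 8448 * c ^ 3) * a + (-10584 * b ^ 5
      - 13230 * b ^ 3 * d - 2784 * b ^ 2 * c ^ 2 + 2700 * b * d ^ 2 + 960 * c ^ 2 * d) = 0)
    (r11 : - 1368750 * a ^ 11 - 14366875 * a ^ 9 * b + 7227000 * a ^ 8 * c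
      + (-52236000 * b ^ 2 - 13003200 * d) * a ^ 7 + 28856200 * a ^ 6 * b * c
      + (-78534300 * b ^ 3 - 54948270 * b * d + 37316800 * c ^ 2) * a ^ 5
      + (20764800 * b ^ 2 * c - 8476080 * c * d) * a ^ 4 + (-44310990 * b ^ 4
      - 45079620 * b ^ 2 * d + 45864000 * b * c ^ 2 - 12657000 * d ^ 2) * a ^ 3
      + (-7457496 * b ^ 3 * c + 923520 * b * c * d + 2499584 * c ^ 3) * a ^ 2
      + (-3935253 * b ^ 5 - 6294750 * b ^ 3 * d + 2504832 * b ^ 2 * c ^ 2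
      - 1711200 * b * d ^ 2 - 3866880 * c ^ 2 * d) * a + (243096 * b ^ 4 * c
      + 320880 * b ^ 2 * c * d + 516096 * b * c ^ 3 - 537600 * c * d ^ 2) = 0) :
    ((22 * a ^ 4 + 84 * a ^ 2 * b + 80 * a * c + 42 * b ^ 2 + 60 * d) * (125 * a ^ 4
      + 150 * a ^ 2 * b + 40 * a * c + 15 * b ^ 2 + 6 * d)) ^ 2 = 0 := by
  linear_combination
    1 / 29925 * ((8167252500 * a ^ 8 + 63513858600 * a ^ 6 * b - 84632262200 * a ^ 5 * c
      + (169151494170 * b ^ 2 + 5418073470 * d) * a ^ 4 - 150805171080 * a ^ 3 * b * c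
      + (179451691110 * b ^ 3 + 108546016410 * b * d + 118796337920 * c ^ 2) * a ^ 2
      + (183469740000 * b ^ 2 * c + 161250334080 * c * d) * a + (90684138276 * b ^ 4
      + 77959301040 * b ^ 2 * d + 205997569536 * b * c ^ 2 + 6463800 * d ^ 2)) * r8
      + (8529345000 * a ^ 7 + 59112253800 * a ^ 5 * b - 19034139200 * a ^ 4 * c
      + (122351292120 * b ^ 2 + 10326732960 * d) * a ^ 3 - 53407415040 * a ^ 2 * b * c
      + (63021354840 * b ^ 3 + 57280082400 * b * d - 44882563840 * c ^ 2) * a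
      + (-9947677440 * b ^ 2 * c - 32592734400 * c * d)) * r9 + (-1085726160 * a ^ 4 * b
      - 7900657320 * a ^ 3 * c + (-5137506090 * b ^ 2 + 1446070770 * d) * a ^ 2
      - 25422437880 * a * b * c + (-5491745838 * b ^ 3 + 6860124630 * b * d
      + 36290024832 * c ^ 2)) * r10a + ((-6642570240 * b * d - 52148375040 * c ^ 2)) * r10b
      + (-1969920 * a * d) * r11)

/-- The coefficients of `X * Q' / Q` up to weight `4` of a solution of the functional equation lie
on one of two surfaces, the Todd surface and the surface of elliptic functions of level `5`, and
the coefficient of weight `5` is the one prescribed by the differential equation. -/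
theorem components_of_lineRel {w : ℕ → ℂ} (hA : LineRel ![0, 1, 2, 3, 5] w)
    (hB : LineRel ![0, 1, 2, 3, 6] w) (hC : LineRel ![0, 1, 2, 4, 5] w) :
    w 5 = -(w 2 * w 3) ∧
      ((IsToddPoint (w 1) (w 2) (w 3) (w 4)) ∨ (IsEllipticPoint (w 1) (w 2) (w 3) (w 4))) := by
  obtain ⟨e, he⟩ : ∃ e, w 5 = e - w 2 * w 3 := ⟨w 5 + w 2 * w 3, by ring⟩
  have r8 := relation_eight he hA hB
  have r9 := relation_nine he hA hB
  have r10a := relation_ten he hA hB hC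
  have r10b := relation_ten_alt he hA hB hC
  have r11 := relation_eleven he hA hB hC
  simp only [IsToddPoint, IsEllipticPoint]
  generalize w 1 = a at *
  generalize w 2 = b at *
  generalize w 3 = c at *
  generalize w 4 = d at *
  -- the defect `e` of the differential equation vanishes
  have he0 : e = 0 := by
    rcases mul_eq_zero.1 (sq_mul_sq_eq_zero_of_relations r8 r9 r10a r10b r11) with hc | he'
    · obtain rfl : c = 0 := by simpa using hc
      have : e ^ 4 = 0 := pow_four_eq_zero_of_relations (a := a) (b := b) (d := d)
        (by linear_combination r8) (by linear_combination r9) (by linear_combination r10a)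
        (by linear_combination r10b)
      simpa using this
    · simpa using he'
  subst he0
  refine ⟨by rw [he]; ring, ?_⟩
  have q8 : - 625 * a ^ 8 - 4500 * a ^ 6 * b - 200 * a ^ 5 * c + (-10200 * b ^ 2
    - 30 * d) * a ^ 4 - 1200 * a ^ 3 * b * c + (-7200 * b ^ 3 - 180 * b * d
    + 4800 * c ^ 2) * a ^ 2 + (-2760 * b ^ 2 * c + 4800 * c * d) * a + (-651 * b ^ 4
    - 510 * b ^ 2 * d - 576 * b * c ^ 2 + 600 * d ^ 2) = 0 := by
    linear_combination r8
  have q9 : 625 * a ^ 9 + 4500 * a ^ 7 * b - 7300 * a ^ 6 * c + (10200 * b ^ 2 + 30 * d) * a ^ 5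
    - 30300 * a ^ 4 * b * c + (7200 * b ^ 3 + 180 * b * d - 26400 * c ^ 2) * a ^ 3
    + (-23700 * b ^ 2 * c - 12360 * c * d) * a ^ 2 + (795 * b ^ 4 - 930 * b ^ 2 * d
    - 15840 * b * c ^ 2 + 3000 * d ^ 2) * a + (-1836 * b ^ 3 * c - 5400 * b * c * d
    - 1536 * c ^ 3) = 0 := by
    linear_combination r9
  have q10a : - 3125 * a ^ 10 - 35000 * a ^ 8 * b - 11000 * a ^ 7 * c + (-133500 * b ^ 2
    - 37650 * d) * a ^ 6 - 52000 * a ^ 5 * b * c + (-208500 * b ^ 3 - 159000 * b * d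
    + 4800 * c ^ 2) * a ^ 4 + (-53400 * b ^ 2 * c - 84480 * c * d) * a ^ 3 + (-121035 * b ^ 4
    - 128490 * b ^ 2 * d + 75840 * b * c ^ 2 - 40800 * d ^ 2) * a ^ 2 + (-40080 * b ^ 3 * c
    + 960 * b * c * d + 10240 * c ^ 3) * a + (-10752 * b ^ 5 - 18300 * b ^ 3 * d
    - 1152 * b ^ 2 * c ^ 2 - 4200 * b * d ^ 2) = 0 := by
    linear_combination r10a
  have q10b : - 3125 * a ^ 10 - 33750 * a ^ 8 * b - 1000 * a ^ 7 * c + (-128250 * b ^ 2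
    - 18900 * d) * a ^ 6 - 9600 * a ^ 5 * b * c + (-203850 * b ^ 3 - 80190 * b * d
    + 36000 * c ^ 2) * a ^ 4 + (-29400 * b ^ 2 * c - 6000 * c * d) * a ^ 3 + (-119265 * b ^ 4
    - 71760 * b ^ 2 * d + 80640 * b * c ^ 2 - 6900 * d ^ 2) * a ^ 2 + (-38592 * b ^ 3 * c
    + 30960 * b * c * d + 8448 * c ^ 3) * a + (-10584 * b ^ 5 - 13230 * b ^ 3 * d
    - 2784 * b ^ 2 * c ^ 2 + 2700 * b * d ^ 2 + 960 * c ^ 2 * d) = 0 := by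
    linear_combination r10b
  have q11 : - 1368750 * a ^ 11 - 14366875 * a ^ 9 * b + 7227000 * a ^ 8 * c
    + (-52236000 * b ^ 2 - 13003200 * d) * a ^ 7 + 28856200 * a ^ 6 * b * c + (-78534300 * b ^ 3
    - 54948270 * b * d + 37316800 * c ^ 2) * a ^ 5 + (20764800 * b ^ 2 * c
    - 8476080 * c * d) * a ^ 4 + (-44310990 * b ^ 4 - 45079620 * b ^ 2 * d
    + 45864000 * b * c ^ 2 - 12657000 * d ^ 2) * a ^ 3 + (-7457496 * b ^ 3 * c
    + 923520 * b * c * d + 2499584 * c ^ 3) * a ^ 2 + (-3935253 * b ^ 5 - 6294750 * b ^ 3 * d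
    + 2504832 * b ^ 2 * c ^ 2 - 1711200 * b * d ^ 2 - 3866880 * c ^ 2 * d) * a
    + (243096 * b ^ 4 * c + 320880 * b ^ 2 * c * d + 516096 * b * c ^ 3 - 537600 * c * d ^ 2) =
    0 := by
    linear_combination r11
  have h1 := pow_eq_zero_iff (two_ne_zero) |>.1 (todd_three_mul_elliptic_four q8 q9 q10a q10b q11)
  have h2 := pow_eq_zero_iff (two_ne_zero) |>.1 (todd_three_mul_elliptic_six q8 q9 q10a q10b)
  have h3 := pow_eq_zero_iff (two_ne_zero) |>.1 (todd_four_mul_elliptic_four q8 q9 q10a q10b q11)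
  -- where the elliptic equation of weight `4` holds, the fourth product vanishes as well
  by_cases hK : 125 * a ^ 4 + 150 * a ^ 2 * b + 40 * a * c + 15 * b ^ 2 + 6 * d = 0
  · have h4 : (22 * a ^ 4 + 84 * a ^ 2 * b + 80 * a * c + 42 * b ^ 2 + 60 * d) *
      (31250 * a ^ 6 + 41250 * a ^ 4 * b + 8000 * a ^ 3 * c + 8550 * a ^ 2 * b ^ 2
        + 960 * a * b * c + 486 * b ^ 3 - 64 * c ^ 2) = 0 := by
      linear_combination
        1 / 9 * ((34560 * a ^ 6 + 139320 * a ^ 4 * b + 146160 * a ^ 3 * c + (83520 * b ^ 2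
          + 133200 * d) * a ^ 2 - 10800 * a * b * c + (7560 * b ^ 3 + 10800 * b * d
          - 5760 * c ^ 2)) * hK + (48 * a) * h2 + (-712 * a ^ 2 - 108 * b) * q8
          + (-124 * a) * q9)
    rcases mul_eq_zero.1 h4 with h4 | h4
    · rcases mul_eq_zero.1 h2 with h2 | h2
      · exact Or.inl ⟨h2, h4⟩
      · exact Or.inr ⟨hK, h2⟩
    · exact Or.inr ⟨hK, h4⟩
  · exact Or.inl ⟨(mul_eq_zero.1 h1).resolve_right hK, (mul_eq_zero.1 h3).resolve_right hK⟩

end HirzebruchFE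

namespace HirzebruchFE

open PowerSeries Finset

/-! ### The functional equation along a line -/

/-- The coefficients of a series are determined by those of its logarithmic derivative. -/
lemma coeff_eq_expCoeff {Y S : PowerSeries ℂ} (h0 : coeff 0 Y = 1)
    (h : X * d⁄dX ℂ Y = S * Y) (k : ℕ) : coeff k Y = expCoeff (fun m => coeff m S) k := by
  have hS : coeff 0 S = 0 := by
    have := congrArg (coeff 0) h
    rw [coeff_mul, coeff_mul] at this
    simpa [h0] using this.symm
  induction k using Nat.strong_induction_on with
  | _ k ih =>
    cases k with
    | zero => rw [h0, expCoeff_zero]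
    | succ k =>
      have := congrArg (coeff (k + 1)) h
      rw [coeff_succ_X_mul, coeff_derivative, coeff_mul,
        Nat.sum_antidiagonal_eq_sum_range_succ (fun i j => coeff i S * coeff j Y),
        sum_range_succ', hS, zero_mul, add_zero] at this
      rw [expCoeff_succ, eq_div_iff (Nat.cast_add_one_ne_zero k), this]
      refine sum_congr rfl fun m hm => ?_
      rw [Nat.add_sub_add_right, ih (k - m) (by omega)]

/-- The logarithmic derivative `X * Q' / Q`. -/
noncomputable def logSeries (Q : PowerSeries ℂ) : PowerSeries ℂ := X * d⁄dX ℂ Q * Q⁻¹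

lemma logSeries_mul {Q : PowerSeries ℂ} (h : coeff 0 Q = 1) :
    logSeries Q * Q = X * d⁄dX ℂ Q := by
  rw [logSeries, mul_assoc, PowerSeries.inv_mul_cancel _ (by simp_all), mul_one]

lemma X_mul_derivative_rescale (b : ℂ) (Q : PowerSeries ℂ) :
    X * d⁄dX ℂ (rescale b Q) = rescale b (X * d⁄dX ℂ Q) := by
  ext n
  cases n with
  | zero => simp
  | succ n =>
    rw [coeff_succ_X_mul, coeff_derivative, coeff_rescale, coeff_rescale, coeff_succ_X_mul,
      coeff_derivative]
    ring

lemma X_mul_derivative_prod_rescale {ι : Type*} (s : Finset ι) (b : ι → ℂ) {Q : PowerSeries ℂ}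
    (h : coeff 0 Q = 1) :
    X * d⁄dX ℂ (∏ j ∈ s, rescale (b j) Q) =
      (∑ j ∈ s, rescale (b j) (logSeries Q)) * ∏ j ∈ s, rescale (b j) Q := by
  classical
  induction s using Finset.induction_on with
  | empty => simp
  | insert j s hj ih =>
    rw [prod_insert hj, sum_insert hj, Derivation.leibniz, smul_eq_mul, smul_eq_mul, mul_add]
    have e : X * d⁄dX ℂ (rescale (b j) Q) = rescale (b j) (logSeries Q) * rescale (b j) Q := by
      rw [X_mul_derivative_rescale, ← logSeries_mul h, map_mul]
    linear_combination rescale (b j) Q * ih + (∏ j ∈ s, rescale (b j) Q) * e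

/-- The series `∑ i, ∏ j ≠ i, Q ((a j - a i) X) / (a j - a i)`. -/
noncomputable def lineSeries (a : Fin 5 → ℂ) (Q : PowerSeries ℂ) : PowerSeries ℂ :=
  ∑ i : Fin 5, C (∏ j : Fin 4, (a (i.succAbove j) - a i))⁻¹ *
    ∏ j : Fin 4, rescale (a (i.succAbove j) - a i) Q

lemma coeff_lineSeries (a : Fin 5 → ℂ) {Q : PowerSeries ℂ} (h : coeff 0 Q = 1) (k : ℕ) :
    coeff k (lineSeries a Q) = lineSum a (fun m => coeff m (logSeries Q)) k := by
  rw [lineSeries, lineSum, map_sum]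
  refine sum_congr rfl fun i _ => ?_
  rw [coeff_C_mul, coeff_eq_expCoeff _ (X_mul_derivative_prod_rescale _ _ h)]
  · simp only [map_sum, coeff_rescale, Finset.sum_mul]
  · rw [coeff_zero_eq_constantCoeff_apply, map_prod]
    refine prod_eq_one fun j _ => ?_
    rw [← coeff_zero_eq_constantCoeff_apply, coeff_rescale, h, pow_zero, one_mul]

/-- The coefficients of `X * Q' / Q` for `Q = X / f`. -/
noncomputable def logCoeff (f : PowerSeries ℂ) (k : ℕ) : ℂ := coeff k (logSeries (qSeries f))

lemma IsNormalized.eq_X_mul {f : PowerSeries ℂ} (hf : IsNormalized f) :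
    f = X * PowerSeries.mk fun k => coeff (k + 1) f := by
  ext n
  cases n with
  | zero => simpa using hf.1
  | succ n => simp

lemma IsNormalized.coeff_zero_qSeries {f : PowerSeries ℂ} (hf : IsNormalized f) :
    coeff 0 (qSeries f) = 1 := by
  simp [qSeries, hf.2]

lemma IsNormalized.mul_qSeries {f : PowerSeries ℂ} (hf : IsNormalized f) :
    f * qSeries f = X := by
  conv_lhs => rw [hf.eq_X_mul]
  rw [mul_assoc, qSeries, ← hf.eq_X_mul, PowerSeries.mul_inv_cancel, mul_one]
  simp [hf.2]

lemma lineRel_logCoeff {f : PowerSeries ℂ} (hf : IsNormalized f) {a : Fin 5 → ℂ} {c : ℂ}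
    (h : lineSeries a (qSeries f) = C c * X ^ 4) : LineRel a (logCoeff f) := by
  intro k hk
  have := coeff_lineSeries a hf.coeff_zero_qSeries k
  rw [h, coeff_C_mul, coeff_X_pow, if_neg hk, mul_zero] at this
  exact this.symm

/-- Clearing denominators in the functional equation. -/
lemma sum_prod_one_div_eq_iff {K : Type*} [Field K] {ι : Type*} [Fintype ι] [DecidableEq ι]
    {e : ι → ι → K} (he : ∀ i j, i ≠ j → e i j ≠ 0) (c : K) :
    ∑ i, ∏ j ∈ univ.erase i, 1 / e i j = c ↔
      ∑ i, ∏ l ∈ univ.erase i, ∏ j ∈ univ.erase l, e l j = c * ∏ i, ∏ j ∈ univ.erase i, e i j := by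
  have hP : ∀ i, ∏ j ∈ univ.erase i, e i j ≠ 0 := fun i =>
    prod_ne_zero_iff.2 fun j hj => he i j (ne_of_mem_erase hj).symm
  have hPP : ∏ i, ∏ j ∈ univ.erase i, e i j ≠ 0 := prod_ne_zero_iff.2 fun i _ => hP i
  rw [← mul_left_inj' hPP, Finset.sum_mul]
  refine Eq.congr_left (sum_congr rfl fun i _ => ?_)
  rw [← mul_prod_erase univ (fun i => ∏ j ∈ univ.erase i, e i j) (mem_univ i), ← mul_assoc,
    prod_div_distrib, prod_const_one, one_div, inv_mul_cancel₀ (hP i), one_mul]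

lemma prod_erase_eq_prod_succAbove {M : Type*} [CommMonoid M] {n : ℕ} (i : Fin (n + 1))
    (g : Fin (n + 1) → M) : ∏ j ∈ univ.erase i, g j = ∏ j : Fin n, g (i.succAbove j) := by
  rw [← Finset.compl_singleton, ← Fin.image_succAbove_univ, prod_image]
  exact fun _ _ _ _ h => Fin.succAbove_right_injective h

/-- Substituting `z = a * X` into the functional equation. -/
theorem lineSeries_of_hirzebruchEquation {f : PowerSeries ℂ} (hf : IsNormalized f) {c : ℂ}
    (h : HirzebruchEquation 5 c f) {a : Fin 5 → ℂ} (ha : Function.Injective a) :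
    lineSeries a (qSeries f) = C c * X ^ 4 := by
  -- the substitution homomorphism
  let b : Fin 5 → MvPowerSeries Unit ℂ := fun i => (a i • X : PowerSeries ℂ)
  have hb : MvPowerSeries.HasSubst b :=
    MvPowerSeries.hasSubst_of_constantCoeff_zero fun i => by
      change constantCoeff (a i • X : PowerSeries ℂ) = 0
      simp
  let φ := MvPowerSeries.substAlgHom (R := ℂ) hb
  let F : Fin 5 → Fin 5 → MvPowerSeries (Fin 5) ℂ := fun i j =>
    PowerSeries.subst (MvPowerSeries.X j - MvPowerSeries.X i : MvPowerSeries (Fin 5) ℂ) f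
  have hφF : ∀ i j, φ (F i j) = rescale (a j - a i) f := by
    intro i j
    have hs : PowerSeries.HasSubst
        (MvPowerSeries.X j - MvPowerSeries.X i : MvPowerSeries (Fin 5) ℂ) :=
      PowerSeries.HasSubst.of_constantCoeff_zero (by simp)
    rw [rescale_eq_subst]
    change φ (PowerSeries.subst _ f) = _
    rw [MvPowerSeries.substAlgHom_apply, PowerSeries.subst,
      MvPowerSeries.subst_comp_subst_apply hs.const hb, MvPowerSeries.subst_sub hb,
      MvPowerSeries.subst_X hb, MvPowerSeries.subst_X hb, PowerSeries.subst, sub_smul]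
  have hr : ∀ i j, i ≠ j → rescale (a j - a i) f ≠ 0 := by
    intro i j hij h0
    have := congrArg (coeff 1) h0
    rw [coeff_rescale, hf.2] at this
    simp [sub_eq_zero, ha.eq_iff, hij.symm] at this
  have hF : ∀ i j, i ≠ j → F i j ≠ 0 := fun i j hij h0 => hr i j hij (by rw [← hφF, h0, map_zero])
  -- clear denominators, substitute, and divide again
  have h1 := (sum_prod_one_div_eq_iff (e := evalDiff 5 f) (fun i j hij h0 => hF i j hij
    (IsFractionRing.injective (MvPowerSeries (Fin 5) ℂ) (FractionRing (MvPowerSeries (Fin 5) ℂ))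
      (by rw [map_zero]; exact h0))) _).1 h
  have h2 : ∑ i, ∏ l ∈ univ.erase i, ∏ j ∈ univ.erase l, F l j =
      MvPowerSeries.C c * ∏ i, ∏ j ∈ univ.erase i, F i j := by
    apply IsFractionRing.injective (MvPowerSeries (Fin 5) ℂ)
      (FractionRing (MvPowerSeries (Fin 5) ℂ))
    simp only [map_sum, map_prod, map_mul]
    exact h1
  have h3 := congrArg φ h2
  have hφC : φ (MvPowerSeries.C c) = C c := φ.commutes c
  simp only [map_sum, map_prod, map_mul, hφF, hφC] at h3
  let K := FractionRing (PowerSeries ℂ)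
  have inj := IsFractionRing.injective (PowerSeries ℂ) K
  let ψ : PowerSeries ℂ →+* K := algebraMap (PowerSeries ℂ) K
  have hX : ψ X ≠ 0 := fun h0 => X_ne_zero (inj (by rw [map_zero]; exact h0))
  have hC : ∀ i j, i ≠ j → ψ (C (a j - a i)) ≠ 0 := fun i j hij h0 => by
    have : C (a j - a i) = 0 := inj (by rw [map_zero]; exact h0)
    rw [map_eq_zero_iff _ C_injective, sub_eq_zero] at this
    exact hij (ha this).symm
  have hψ : ∀ i j, i ≠ j → ψ (rescale (a j - a i) f) ≠ 0 := fun i j hij h0 =>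
    hr i j hij (inj (by rw [map_zero]; exact h0))
  have hQ : ∀ i j, i ≠ j → 1 / ψ (rescale (a j - a i) f) =
      (ψ (C (a j - a i)))⁻¹ * ψ (rescale (a j - a i) (qSeries f)) / ψ X := by
    intro i j hij
    have e : ψ (rescale (a j - a i) f) * ψ (rescale (a j - a i) (qSeries f)) =
        ψ (C (a j - a i)) * ψ X := by
      rw [← map_mul, ← map_mul, ← map_mul, hf.mul_qSeries, rescale_X]
    rw [eq_div_iff hX, eq_inv_mul_iff_mul_eq₀ (hC i j hij), one_div, mul_left_comm, ← e,
      inv_mul_cancel_left₀ (hψ i j hij)]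
  have h4 := (sum_prod_one_div_eq_iff (e := fun i j => ψ (rescale (a j - a i) f)) hψ
    (ψ (C c))).2 (by simpa only [map_sum, map_prod, map_mul] using congrArg ψ h3)
  apply inj
  change ψ _ = ψ _
  rw [map_mul, map_pow, ← h4, lineSeries, map_sum, Finset.sum_mul]
  refine sum_congr rfl fun i _ => ?_
  rw [prod_erase_eq_prod_succAbove, prod_congr rfl fun j _ => hQ i _ (Fin.succAbove_ne i j).symm,
    prod_div_distrib, prod_mul_distrib, prod_const, card_univ, Fintype.card_fin,
    div_mul_cancel₀ _ (pow_ne_zero 4 hX), map_mul, map_prod, prod_inv_distrib, ← map_prod,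
    ← map_prod]
  congr 1
  refine eq_inv_of_mul_eq_one_left ?_
  rw [← map_mul, ← map_prod, ← map_mul, inv_mul_cancel₀, map_one, map_one]
  exact prod_ne_zero_iff.2 fun j _ => sub_ne_zero.2 (ha.ne (Fin.succAbove_ne i j))

/-! ### A solution is determined by its coefficients up to weight five -/

lemma expCoeff_congr {s s' : ℕ → ℂ} {k : ℕ} (h : ∀ m, 1 ≤ m → m ≤ k → s m = s' m) :
    expCoeff s k = expCoeff s' k := by
  induction k using Nat.strong_induction_on with
  | _ k ih =>
    cases k with
    | zero => rw [expCoeff_zero, expCoeff_zero]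
    | succ k =>
      rw [expCoeff_succ, expCoeff_succ]
      congr 1
      refine sum_congr rfl fun m hm => ?_
      have hm := mem_range.1 hm
      rw [h (m + 1) (by omega) (by omega), ih (k - m) (by omega) fun i h1 h2 => h i h1 (by omega)]

/-- The coefficient of weight `k` depends on `s k` through the summand `s k / k`. -/
lemma expCoeff_sub_expCoeff {s s' : ℕ → ℂ} {k : ℕ} (hk : 1 ≤ k)
    (h : ∀ m, 1 ≤ m → m < k → s m = s' m) :
    expCoeff s k - expCoeff s' k = (s k - s' k) / k := by
  obtain ⟨k, rfl⟩ := Nat.exists_eq_add_of_le' hk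
  rw [expCoeff_succ, expCoeff_succ, ← sub_div, sum_range_succ, sum_range_succ]
  have : ∀ m ∈ range k, s (m + 1) * expCoeff s (k - m) = s' (m + 1) * expCoeff s' (k - m) := by
    intro m hm
    have hm := mem_range.1 hm
    rw [h (m + 1) (by omega) (by omega),
      expCoeff_congr (s := s) (s' := s') fun i h1 h2 => h i h1 (by omega)]
  rw [sum_congr rfl this, Nat.sub_self, expCoeff_zero, expCoeff_zero]
  push_cast
  ring

/-- The factor of `w k / k` in the relation of weight `k` along the line `(0, 1, 2, 3, 5)` does not
vanish for `k ≥ 6`; it does vanish for `k = 5`. -/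
lemma weight_factor_ne_zero {k : ℕ} (hk : 6 ≤ k) :
    4 * (1 + 2 ^ k + 3 ^ k + 5 ^ k) - 15 * ((-1) ^ k + 1 + 2 ^ k + 4 ^ k) +
      20 * ((-2) ^ k + (-1) ^ k + 1 + 3 ^ k) - 10 * ((-3) ^ k + (-2) ^ k + (-1) ^ k + 2 ^ k) +
      ((-5) ^ k + (-4) ^ k + (-3) ^ k + (-2) ^ k) ≠ (0 : ℤ) := by
  apply ne_of_gt
  have h94 : ∀ m : ℕ, (4 : ℤ) ^ m ≤ 9 ^ m := fun m => by gcongr; norm_num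
  have h4 : ∀ m : ℕ, (0 : ℤ) < 4 ^ m := fun m => by positivity
  rcases Nat.even_or_odd' k with ⟨m, rfl | rfl⟩
  · have hm : 3 ≤ m := by omega
    have h : (14 : ℤ) * 16 ^ m ≤ 5 * 25 ^ m := by
      induction m, hm using Nat.le_induction with
      | base => norm_num
      | succ m _ ih =>
        rw [pow_succ, pow_succ]
        linarith [ih (by omega), pow_pos (show (0 : ℤ) < 25 by norm_num) m]
    simp only [pow_mul]
    norm_num
    linarith [h94 m, h4 m]
  · have hm : 3 ≤ m := by omega
    rcases hm.eq_or_lt with rfl | hm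
    · norm_num
    have h : (64 : ℤ) * 16 ^ m ≤ 15 * 25 ^ m := by
      have hm : 4 ≤ m := hm
      clear hk
      induction m, hm using Nat.le_induction with
      | base => norm_num
      | succ m _ ih =>
        rw [pow_succ, pow_succ]
        linarith [ih (by omega) (by omega), pow_pos (show (0 : ℤ) < 25 by norm_num) m]
    simp only [pow_succ, pow_mul]
    norm_num
    linarith [h94 m, h4 m]

lemma lineSum_congr (a : Fin 5 → ℂ) {w w' : ℕ → ℂ} (h : ∀ m, 1 ≤ m → w m = w' m) (k : ℕ) :
    lineSum a w k = lineSum a w' k :=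
  sum_congr rfl fun i _ => congrArg _ (expCoeff_congr fun m h1 _ => by rw [h m h1])

/-- Uniqueness: two solutions along the line `(0, 1, 2, 3, 5)` agree as soon as they agree up to
weight `5`. -/
theorem LineRel.eq_of_eq_le_five {w w' : ℕ → ℂ} (hw : LineRel ![0, 1, 2, 3, 5] w)
    (hw' : LineRel ![0, 1, 2, 3, 5] w') (h : ∀ k, 1 ≤ k → k ≤ 5 → w k = w' k) {k : ℕ}
    (hk : 1 ≤ k) : w k = w' k := by
  induction k using Nat.strong_induction_on with
  | _ k ih =>
    by_cases h5 : k ≤ 5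
    · exact h k hk h5
    have e1 := hw k (by omega)
    have e2 := hw' k (by omega)
    rw [lineSum_01235] at e1 e2
    have key (p : ℕ → ℂ) : expCoeff (fun m => p m * w m) k - expCoeff (fun m => p m * w' m) k =
        p k * (w k - w' k) / k := by
      rw [expCoeff_sub_expCoeff hk fun m h1 h2 => by simp only [ih m h2 h1], ← mul_sub]
    have k1 := key fun m => 1 ^ m + 2 ^ m + 3 ^ m + 5 ^ m
    have k2 := key fun m => (-1) ^ m + 1 ^ m + 2 ^ m + 4 ^ m
    have k3 := key fun m => (-2) ^ m + (-1) ^ m + 1 ^ m + 3 ^ m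
    have k4 := key fun m => (-3) ^ m + (-2) ^ m + (-1) ^ m + 2 ^ m
    have k5 := key fun m => (-5) ^ m + (-4) ^ m + (-3) ^ m + (-2) ^ m
    have hk0 : (k : ℂ) ≠ 0 := by exact_mod_cast (by omega : k ≠ 0)
    have hN : ((4 * (1 + 2 ^ k + 3 ^ k + 5 ^ k) - 15 * ((-1) ^ k + 1 + 2 ^ k + 4 ^ k) +
      20 * ((-2) ^ k + (-1) ^ k + 1 + 3 ^ k) - 10 * ((-3) ^ k + (-2) ^ k + (-1) ^ k + 2 ^ k) +
      ((-5) ^ k + (-4) ^ k + (-3) ^ k + (-2) ^ k) : ℤ) : ℂ) ≠ 0 := by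
      exact_mod_cast weight_factor_ne_zero (by omega : 6 ≤ k)
    push_cast at hN
    have hz : (4 * (1 + 2 ^ k + 3 ^ k + 5 ^ k) - 15 * ((-1) ^ k + 1 + 2 ^ k + 4 ^ k) +
      20 * ((-2) ^ k + (-1) ^ k + 1 + 3 ^ k) - 10 * ((-3) ^ k + (-2) ^ k + (-1) ^ k + 2 ^ k) +
      ((-5) ^ k + (-4) ^ k + (-3) ^ k + (-2) ^ k)) * ((w k - w' k) / k) = 0 := by
      simp only [one_pow] at *
      linear_combination 120 * (e1 - e2) - 4 * k1 + 15 * k2 - 20 * k3 + 10 * k4 - k5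
    have := (mul_eq_zero.1 hz).resolve_left hN
    rw [div_eq_zero_iff] at this
    exact sub_eq_zero.1 (this.resolve_right hk0)

lemma IsNormalized.coeff_qSeries {f : PowerSeries ℂ} (hf : IsNormalized f) (k : ℕ) :
    coeff k (qSeries f) = expCoeff (logCoeff f) k :=
  coeff_eq_expCoeff hf.coeff_zero_qSeries (logSeries_mul hf.coeff_zero_qSeries).symm k

/-- A normalized series is determined by the coefficients of its logarithmic derivative. -/
lemma IsNormalized.eq_of_logCoeff_eq {f g : PowerSeries ℂ} (hf : IsNormalized f)
    (hg : IsNormalized g) (h : ∀ k, 1 ≤ k → logCoeff f k = logCoeff g k) : f = g := by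
  have hQ : qSeries f = qSeries g := by
    ext k
    rw [hf.coeff_qSeries, hg.coeff_qSeries, expCoeff_congr fun m h1 _ => h m h1]
  have h0 : qSeries f ≠ 0 := fun h => by
    have h1 := hf.coeff_zero_qSeries
    simp [h] at h1
  apply mul_right_cancel₀ h0
  rw [hf.mul_qSeries, hQ, hg.mul_qSeries]

/-! ### The differential equation in terms of logarithmic derivatives -/

/-- The coefficients `w k` of `X * Q' / Q` for the solution of the differential equation with
`w 1 = a`, `w 2 = b`, `w 3 = c`, `w 4 = d`. Weight `4` is a resonance of the recursion, so that
`d` is a free parameter. -/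
noncomputable def odeCoeff (a b c d : ℂ) : ℕ → ℂ
  | 0 => 0
  | 1 => a
  | 2 => b
  | 3 => c
  | 4 => d
  | k + 5 =>
    let T : PowerSeries ℂ :=
      PowerSeries.mk fun m => if _h : 2 ≤ m ∧ m < k + 5 then odeCoeff a b c d m else 0
    coeff (k + 5) (C (6 * b) * (X ^ 2 * T) + 2 * (T * T * T) - 6 * (T * T)) / ((k + 1) * (k + 6))

/-- The part of `∑ w k * X ^ k` of weight at least two. -/
noncomputable def tail (w : ℕ → ℂ) : PowerSeries ℂ :=
  PowerSeries.mk fun m => if 2 ≤ m then w m else 0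

lemma coeff_mul_congr {S T : PowerSeries ℂ} {S' T' : PowerSeries ℂ} {k : ℕ}
    (hS : ∀ m < k, coeff m S = coeff m S') (hT : ∀ m < k, coeff m T = coeff m T')
    (h1 : coeff 0 S = 0) (h2 : coeff 0 T = 0) (h1' : coeff 0 S' = 0) (h2' : coeff 0 T' = 0) :
    coeff k (S * T) = coeff k (S' * T') := by
  rw [coeff_mul, coeff_mul]
  refine sum_congr rfl fun p hp => ?_
  obtain ⟨i, j⟩ := p
  have hp : i + j = k := by simpa using hp
  dsimp only
  rcases Nat.eq_zero_or_pos i with rfl | hi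
  · rw [h1, h1', zero_mul, zero_mul]
  rcases Nat.eq_zero_or_pos j with rfl | hj
  · rw [h2, h2', mul_zero, mul_zero]
  rw [hS i (by omega), hT j (by omega)]

lemma coeff_X_mul_derivative (A : PowerSeries ℂ) (k : ℕ) :
    coeff k (X * d⁄dX ℂ A) = k * coeff k A := by
  cases k with
  | zero => simp
  | succ k => rw [coeff_succ_X_mul, coeff_derivative]; push_cast; ring

lemma coeff_ofNat_mul (n : ℕ) [n.AtLeastTwo] (A : PowerSeries ℂ) (m : ℕ) :
    coeff m ((no_index (OfNat.ofNat n) : PowerSeries ℂ) * A) = (OfNat.ofNat n : ℂ) * coeff m A := by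
  rw [← coeff_C_mul]; rfl

/-- The recursion reads off the coefficient of degree `k + 5` of the equation satisfied by the tail.
-/
lemma odeCoeff_add_five (a b c d : ℂ) (k : ℕ) :
    ((k + 1) * (k + 6)) * odeCoeff a b c d (k + 5) =
      -coeff (k + 5) (6 * (tail (odeCoeff a b c d) * tail (odeCoeff a b c d)) -
        2 * (tail (odeCoeff a b c d) * tail (odeCoeff a b c d) * tail (odeCoeff a b c d)) -
        C (6 * b) * (X ^ 2 * tail (odeCoeff a b c d))) := by
  rw [odeCoeff]
  set S := tail (odeCoeff a b c d) with hS
  set T : PowerSeries ℂ :=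
      PowerSeries.mk fun m => if _h : 2 ≤ m ∧ m < k + 5 then odeCoeff a b c d m else 0 with hT
  have e : ∀ m < k + 5, coeff m T = coeff m S := by
    intro m hm
    simp [hT, hS, tail, hm]
  have hT0 : coeff 0 T = 0 := by simp [hT]
  have hS0 : coeff 0 S = 0 := by simp [hS, tail]
  have e2 : ∀ m ≤ k + 5, coeff m (T * T) = coeff m (S * S) := fun m hm =>
    coeff_mul_congr (fun i hi => e i (by omega)) (fun i hi => e i (by omega)) hT0 hT0 hS0 hS0
  have e3 : coeff (k + 5) (T * T * T) = coeff (k + 5) (S * S * S) := by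
    refine coeff_mul_congr (fun i hi => e2 i (by omega)) e ?_ hT0 ?_ hS0 <;>
      simp_all
  have e1 : coeff (k + 5) (X ^ 2 * T) = coeff (k + 5) (X ^ 2 * S) := by
    rw [show k + 5 = (k + 3) + 2 by ring, coeff_X_pow_mul, coeff_X_pow_mul, e _ (by omega)]
  rw [mul_div_cancel₀]
  · simp only [map_sub, map_add, coeff_ofNat_mul, coeff_C_mul, e1, e2 _ le_rfl, e3]
    ring
  · have h1 : (k : ℂ) + 1 ≠ 0 := Nat.cast_add_one_ne_zero k
    have h2 : (k : ℂ) + 6 ≠ 0 := by exact_mod_cast (by omega : k + 6 ≠ 0)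
    exact mul_ne_zero h1 h2

lemma odeCoeff_five (a b c d : ℂ) : odeCoeff a b c d 5 = -(b * c) := by
  have h := odeCoeff_add_five a b c d 0
  set S := tail (odeCoeff a b c d) with hS
  have h0 : coeff 0 S = 0 := by simp [hS, tail]
  have h1 : coeff 1 S = 0 := by simp [hS, tail]
  have h2 : coeff 2 S = b := by simp [hS, tail, odeCoeff]
  have h3 : coeff 3 S = c := by simp [hS, tail, odeCoeff]
  simp only [map_sub, coeff_ofNat_mul, coeff_C_mul] at h
  simp [coeff_mul, Nat.sum_antidiagonal_eq_sum_range_succ_mk, sum_range_succ, coeff_X_pow,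
    h0, h1, h2, h3, -coeff_zero_eq_constantCoeff] at h
  linear_combination 1 / 6 * h

/-- The differential equation for `V = 1 - tail w`, with `θ = X * d/dX`. -/
lemma tail_odeCoeff_equation (a b c d : ℂ) :
    let V := 1 - tail (odeCoeff a b c d)
    X * d⁄dX ℂ (X * d⁄dX ℂ V) - 3 * (X * d⁄dX ℂ V) + 2 * V =
      2 * V ^ 3 + C (6 * b) * (X ^ 2 * V) + C (4 * c) * X ^ 3 := by
  intro V
  set S := tail (odeCoeff a b c d) with hS
  have hS0 : coeff 0 S = 0 := by simp [hS, tail]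
  have hS1 : coeff 1 S = 0 := by simp [hS, tail]
  have hSk : ∀ k, coeff (k + 2) S = odeCoeff a b c d (k + 2) := by simp [hS, tail]
  have hS2 := hSk 0
  have hS3 := hSk 1
  have hS4 := hSk 2
  simp only [odeCoeff, zero_add, Nat.reduceAdd] at hS2 hS3 hS4
  have exp : X * d⁄dX ℂ (X * d⁄dX ℂ V) - 3 * (X * d⁄dX ℂ V) + 2 * V -
      (2 * V ^ 3 + C (6 * b) * (X ^ 2 * V) + C (4 * c) * X ^ 3) =
      -(X * d⁄dX ℂ (X * d⁄dX ℂ S)) + 3 * (X * d⁄dX ℂ S) + 4 * S -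
      (6 * (S * S) - 2 * (S * S * S) - C (6 * b) * (X ^ 2 * S)) - C (6 * b) * X ^ 2
      - C (4 * c) * X ^ 3 := by
    simp only [V, map_sub, Derivation.map_one_eq_zero]
    simp only [zero_sub, mul_neg, map_neg]
    ring
  rw [← sub_eq_zero, exp]
  ext k
  simp only [map_sub, map_add, map_neg, coeff_X_mul_derivative, coeff_ofNat_mul, coeff_C_mul,
    coeff_X_pow, map_zero]
  match k with
  | 0 => simp [hS0, coeff_mul]
  | 1 => simp [hS0, hS1, coeff_mul, Nat.sum_antidiagonal_eq_sum_range_succ_mk, sum_range_succ,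
      coeff_X_pow]
  | 2 =>
    simp [hS0, hS1, hS2, coeff_mul, Nat.sum_antidiagonal_eq_sum_range_succ_mk, sum_range_succ,
      coeff_X_pow]
    ring
  | 3 =>
    simp [hS0, hS1, hS2, hS3, coeff_mul, Nat.sum_antidiagonal_eq_sum_range_succ_mk, sum_range_succ,
      coeff_X_pow]
  | 4 =>
    simp [hS0, hS1, hS2, hS3, hS4, coeff_mul, Nat.sum_antidiagonal_eq_sum_range_succ_mk,
      sum_range_succ, coeff_X_pow]
    ring
  | k + 5 =>
    have := odeCoeff_add_five a b c d k
    rw [← hS] at this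
    simp only [map_sub, coeff_ofNat_mul, coeff_C_mul] at this
    have h5 := hSk (k + 3)
    simp only [show k + 3 + 2 = k + 5 by ring] at h5
    rw [h5]
    have n2 : k + 5 ≠ 2 := by omega
    have n3 : k + 5 ≠ 3 := by omega
    simp only [n2, n3, if_false]
    push_cast
    linear_combination -this

lemma X_mul_derivative_add_C_mul_X (A : PowerSeries ℂ) (a : ℂ) :
    X * d⁄dX ℂ (A + C a * X) = X * d⁄dX ℂ A + C a * X := by
  rw [map_add, Derivation.leibniz, smul_eq_mul, smul_eq_mul, derivative_X, derivative_C]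
  ring

lemma IsNormalized.X_mul_derivative {f : PowerSeries ℂ} (hf : IsNormalized f) :
    X * d⁄dX ℂ f = f * (1 - logSeries (qSeries f)) := by
  have hQ0 := hf.coeff_zero_qSeries
  have hQ : qSeries f ≠ 0 := fun h => by simp [h] at hQ0
  have e := congrArg (fun g => X * d⁄dX ℂ g) hf.mul_qSeries
  have e2 := logSeries_mul hQ0
  simp only [Derivation.leibniz, smul_eq_mul, derivative_X] at e
  apply mul_right_cancel₀ hQ
  linear_combination e + f * e2 - hf.mul_qSeries

/-- The left side of the differential equation in terms of `Y = X * f' / f`. -/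
lemma X_pow_three_mul_of_X_mul_derivative {f Y : PowerSeries ℂ} (h1 : X * d⁄dX ℂ f = f * Y) :
    X ^ 3 * (f * d⁄dX ℂ (d⁄dX ℂ (d⁄dX ℂ f)) - 3 * (d⁄dX ℂ f * d⁄dX ℂ (d⁄dX ℂ f))) =
      f ^ 2 * (X * d⁄dX ℂ (X * d⁄dX ℂ Y) - 3 * (X * d⁄dX ℂ Y) + 2 * Y - 2 * Y ^ 3) := by
  set Z1 := X * d⁄dX ℂ Y with hZ1
  set Z2 := X * d⁄dX ℂ Z1 with hZ2
  have h2 : X ^ 2 * d⁄dX ℂ (d⁄dX ℂ f) = f * (Y ^ 2 + Z1 - Y) := by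
    have e := congrArg (fun g => X * d⁄dX ℂ g) h1
    simp only [Derivation.leibniz, smul_eq_mul, derivative_X] at e
    linear_combination e + (Y - 1) * h1 - f * hZ1
  have h3 : X ^ 3 * d⁄dX ℂ (d⁄dX ℂ (d⁄dX ℂ f)) =
      f * (Y ^ 3 + 3 * Y * Z1 + Z2 - 3 * Y ^ 2 - 3 * Z1 + 2 * Y) := by
    have e := congrArg (fun g => X * d⁄dX ℂ g) h2
    simp only [Derivation.leibniz, smul_eq_mul, derivative_X, pow_two, map_sub, map_add] at e
    linear_combination e + (Y ^ 2 + Z1 - Y) * h1 - 2 * h2 - f * (2 * Y - 1) * hZ1 - f * hZ2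
  linear_combination f * h3 - 3 * X ^ 2 * d⁄dX ℂ (d⁄dX ℂ f) * h1 - 3 * f * Y * h2

/-- A normalized series whose logarithmic derivative obeys the recursion solves the differential
equation. -/
theorem solvesODE_of_logCoeff {f : PowerSeries ℂ} (hf : IsNormalized f) {a b c d : ℂ}
    (h : ∀ k, 1 ≤ k → logCoeff f k = odeCoeff a b c d k) : SolvesODE f := by
  refine ⟨a, (a ^ 2 + b) / 2, (2 * a ^ 3 + 6 * a * b + 4 * c) / 12, ?_⟩
  set S := tail (odeCoeff a b c d) with hS
  set Y : PowerSeries ℂ := 1 - S - C a * X with hY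
  have hW : 1 - logSeries (qSeries f) = Y := by
    rw [hY, sub_sub, sub_right_inj]
    ext k
    match k with
    | 0 => simp [hS, tail, logSeries]
    | 1 =>
      rw [show coeff 1 (logSeries (qSeries f)) = logCoeff f 1 from rfl, h 1 le_rfl]
      simp [hS, tail, odeCoeff]
    | k + 2 =>
      rw [show coeff (k + 2) (logSeries (qSeries f)) = logCoeff f (k + 2) from rfl,
        h _ (by omega)]
      simp [hS, tail]
  have h1 : X * d⁄dX ℂ f = f * Y := hW ▸ hf.X_mul_derivative
  have h3 := X_pow_three_mul_of_X_mul_derivative h1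
  have hE := tail_odeCoeff_equation a b c d
  simp only at hE
  rw [← hS] at hE
  have hV : (1 : PowerSeries ℂ) - S = Y + C a * X := by rw [hY]; ring
  rw [hV, X_mul_derivative_add_C_mul_X, X_mul_derivative_add_C_mul_X] at hE
  have hX3 : (X : PowerSeries ℂ) ^ 3 ≠ 0 := pow_ne_zero _ X_ne_zero
  apply mul_left_cancel₀ hX3
  simp only [Function.iterate_succ, Function.iterate_zero, Function.comp, id, smul_eq_C_mul]
  have c1 : (C (6 * a) : PowerSeries ℂ) = 6 * C a := by rw [map_mul]; rfl
  have c2 : (C (12 * ((a ^ 2 + b) / 2)) : PowerSeries ℂ) = 6 * (C a ^ 2 + C b) := by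
    rw [show 12 * ((a ^ 2 + b) / 2) = 6 * (a ^ 2 + b) by ring, map_mul, map_add, map_pow]; rfl
  have c3 : (C (12 * ((2 * a ^ 3 + 6 * a * b + 4 * c) / 12)) : PowerSeries ℂ) =
      2 * C a ^ 3 + 6 * C a * C b + 4 * C c := by
    rw [show 12 * ((2 * a ^ 3 + 6 * a * b + 4 * c) / 12) = 2 * a ^ 3 + 6 * a * b + 4 * c by ring]
    simp only [map_add, map_mul, map_pow]; rfl
  have c4 : (C (6 * b) : PowerSeries ℂ) = 6 * C b := by rw [map_mul]; rfl
  have c5 : (C (4 * c) : PowerSeries ℂ) = 4 * C c := by rw [map_mul]; rfl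
  rw [c1, c2, c3]
  rw [c4, c5] at hE
  linear_combination h3 - 6 * C a * X * (X * d⁄dX ℂ f + f * Y) * h1
    - 6 * (C a ^ 2 + C b) * X ^ 2 * f * h1 + f ^ 2 * hE

/-- Conversely, a solution of the differential equation obeys the recursion. -/
theorem logCoeff_of_solvesODE {f : PowerSeries ℂ} (hf : IsNormalized f) (h : SolvesODE f) {k : ℕ}
    (hk : 1 ≤ k) : logCoeff f k =
      odeCoeff (logCoeff f 1) (logCoeff f 2) (logCoeff f 3) (logCoeff f 4) k := by
  obtain ⟨p₁, p₂, p₃, h⟩ := h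
  simp only [Function.iterate_succ, Function.iterate_zero, Function.comp, id, smul_eq_C_mul] at h
  set a := logCoeff f 1 with ha
  set S := tail (logCoeff f) with hS
  have hS0 : coeff 0 S = 0 := by simp [hS, tail]
  have hS1 : coeff 1 S = 0 := by simp [hS, tail]
  have hSk : ∀ k, coeff (k + 2) S = logCoeff f (k + 2) := by simp [hS, tail]
  have hS2 : coeff 2 S = logCoeff f 2 := hSk 0
  have hS3 : coeff 3 S = logCoeff f 3 := hSk 1
  set Y : PowerSeries ℂ := 1 - S - C a * X with hY
  have hW : 1 - logSeries (qSeries f) = Y := by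
    rw [hY, sub_sub, sub_right_inj]
    ext k
    match k with
    | 0 => simp [hS, tail, logSeries]
    | 1 =>
      rw [show coeff 1 (logSeries (qSeries f)) = logCoeff f 1 from rfl]
      simp [hS, tail, ha]
    | k + 2 =>
      rw [show coeff (k + 2) (logSeries (qSeries f)) = logCoeff f (k + 2) from rfl]
      simp [hS, tail]
  have h1 : X * d⁄dX ℂ f = f * Y := hW ▸ hf.X_mul_derivative
  have h3 := X_pow_three_mul_of_X_mul_derivative h1
  have hf0 : f ≠ 0 := fun h => by
    have h1 := hf.2
    simp [h] at h1
  have hV : Y = 1 - S + C (-a) * X := by rw [hY, map_neg]; ring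
  -- the equation in terms of `S`, with undetermined coefficients
  obtain ⟨α, β, γ, hE⟩ : ∃ α β γ : ℂ, -(X * d⁄dX ℂ (X * d⁄dX ℂ S)) + 3 * (X * d⁄dX ℂ S) + 4 * S -
      6 * (S * S) + 2 * (S * S * S) =
      C α * X - C (2 * α) * (X * S) + C α * (X * (S * S)) + C β * X ^ 2 - C β * (X ^ 2 * S) +
        C γ * X ^ 3 := by
    refine ⟨6 * p₁ - 6 * a, 12 * p₂ - 12 * p₁ * a + 6 * a ^ 2,
      12 * p₃ - 12 * p₂ * a + 6 * p₁ * a ^ 2 - 2 * a ^ 3, ?_⟩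
    apply mul_left_cancel₀ (pow_ne_zero 2 hf0)
    have e1 : X * d⁄dX ℂ Y = -(X * d⁄dX ℂ S) + C (-a) * X := by
      rw [hV, X_mul_derivative_add_C_mul_X, map_sub, Derivation.map_one_eq_zero, zero_sub, mul_neg]
    have e2 : X * d⁄dX ℂ (X * d⁄dX ℂ Y) = -(X * d⁄dX ℂ (X * d⁄dX ℂ S)) + C (-a) * X := by
      rw [e1, X_mul_derivative_add_C_mul_X, map_neg, mul_neg]
    rw [e2, e1, hV] at h3
    rw [hV] at h1
    have n6 : (C (6 : ℂ) : PowerSeries ℂ) = 6 := rfl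
    have n12 : (C (12 : ℂ) : PowerSeries ℂ) = 12 := rfl
    have n2 : (C (2 : ℂ) : PowerSeries ℂ) = 2 := rfl
    simp only [map_add, map_sub, map_mul, map_pow, map_neg, n6, n12, n2] at h h1 h3 ⊢
    linear_combination X ^ 3 * h - h3 +
      6 * C p₁ * X * (X * d⁄dX ℂ f + f * (1 - S - C a * X)) * h1 + 12 * C p₂ * X ^ 2 * f * h1
  have hco : ∀ m, coeff m (-(X * d⁄dX ℂ (X * d⁄dX ℂ S)) + 3 * (X * d⁄dX ℂ S) + 4 * S -
      6 * (S * S) + 2 * (S * S * S)) = coeff m (C α * X - C (2 * α) * (X * S) +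
        C α * (X * (S * S)) + C β * X ^ 2 - C β * (X ^ 2 * S) + C γ * X ^ 3) :=
    fun m => congrArg _ hE
  simp only [map_sub, map_add, map_neg, coeff_X_mul_derivative, coeff_ofNat_mul, coeff_C_mul,
    coeff_X_pow, coeff_X] at hco
  have hα : α = 0 := by
    have := hco 1
    simp [hS0, hS1, coeff_mul, Nat.sum_antidiagonal_eq_sum_range_succ_mk, sum_range_succ,
      coeff_X] at this
    exact this.symm
  subst hα
  have hβ : β = 6 * logCoeff f 2 := by
    have := hco 2
    simp [hS0, hS1, hS2, coeff_mul, Nat.sum_antidiagonal_eq_sum_range_succ_mk, sum_range_succ,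
      coeff_X_pow] at this
    linear_combination -this
  subst hβ
  induction k using Nat.strong_induction_on with
  | _ k ih =>
    match k with
    | 0 => omega
    | 1 => rw [odeCoeff]
    | 2 => rw [odeCoeff]
    | 3 => rw [odeCoeff]
    | 4 => rw [odeCoeff]
    | k + 5 =>
      have e1 := hco (k + 5)
      have e2 := odeCoeff_add_five a (logCoeff f 2) (logCoeff f 3) (logCoeff f 4) k
      set S' := tail (odeCoeff a (logCoeff f 2) (logCoeff f 3) (logCoeff f 4)) with hS'
      have hS0' : coeff 0 S' = 0 := by simp [hS', tail]
      have e : ∀ m < k + 5, coeff m S = coeff m S' := by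
        intro m hm
        by_cases h2 : 2 ≤ m
        · simp only [hS, hS', tail, coeff_mk, h2, if_true]
          exact ih m hm (by omega)
        · simp [hS, hS', tail, h2]
      have q2 : ∀ m ≤ k + 5, coeff m (S * S) = coeff m (S' * S') := fun m hm =>
        coeff_mul_congr (fun i hi => e i (by omega)) (fun i hi => e i (by omega))
          hS0 hS0 hS0' hS0'
      have q3 : coeff (k + 5) (S * S * S) = coeff (k + 5) (S' * S' * S') := by
        refine coeff_mul_congr (fun i hi => q2 i (by omega)) e ?_ hS0 ?_ hS0'
        · simp [coeff_mul, hS0]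
        · simp [coeff_mul, hS0']
      have q1 : coeff (k + 5) (X ^ 2 * S) = coeff (k + 5) (X ^ 2 * S') := by
        rw [show k + 5 = (k + 3) + 2 by ring, coeff_X_pow_mul, coeff_X_pow_mul, e _ (by omega)]
      have h5 := hSk (k + 3)
      simp only [show k + 3 + 2 = k + 5 by ring] at h5
      simp only [map_sub, coeff_ofNat_mul, coeff_C_mul] at e2
      rw [q1, q2 _ le_rfl, q3, h5] at e1
      have n1 : k + 5 ≠ 1 := by omega
      have n2 : k + 5 ≠ 2 := by omega
      have n3 : k + 5 ≠ 3 := by omega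
      simp only [n1, n2, n3, if_false] at e1
      push_cast at e1
      have k1 : (k : ℂ) + 1 ≠ 0 := Nat.cast_add_one_ne_zero k
      have k6 : (k : ℂ) + 6 ≠ 0 := by exact_mod_cast (by omega : k + 6 ≠ 0)
      refine mul_left_cancel₀ (mul_ne_zero k1 k6) ?_
      linear_combination -e1 - e2

/-! ### The Todd functions -/

/-- The functional equation along the line `(0, 1, 2, 3, 5)` for the Todd function, with `x` in the
role of `exp ((a - b) * X)`. -/
lemma todd_line_identity {K : Type*} [Field K] (a b x : K) (h1 : x - 1 ≠ 0) (h2 : x ^ 2 - 1 ≠ 0)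
    (h3 : x ^ 3 - 1 ≠ 0) (h4 : x ^ 4 - 1 ≠ 0) (h5 : x ^ 5 - 1 ≠ 0) :
    (a - b * x) / (x - 1) * ((a - b * x ^ 2) / (x ^ 2 - 1)) * ((a - b * x ^ 3) / (x ^ 3 - 1)) *
        ((a - b * x ^ 5) / (x ^ 5 - 1)) +
      (-((a * x - b) / (x - 1))) * ((a - b * x) / (x - 1)) * ((a - b * x ^ 2) / (x ^ 2 - 1)) *
        ((a - b * x ^ 4) / (x ^ 4 - 1)) +
      (-((a * x ^ 2 - b) / (x ^ 2 - 1))) * (-((a * x - b) / (x - 1))) * ((a - b * x) / (x - 1)) *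
        ((a - b * x ^ 3) / (x ^ 3 - 1)) +
      (-((a * x ^ 3 - b) / (x ^ 3 - 1))) * (-((a * x ^ 2 - b) / (x ^ 2 - 1))) *
        (-((a * x - b) / (x - 1))) * ((a - b * x ^ 2) / (x ^ 2 - 1)) +
      (-((a * x ^ 5 - b) / (x ^ 5 - 1))) * (-((a * x ^ 4 - b) / (x ^ 4 - 1))) *
        (-((a * x ^ 3 - b) / (x ^ 3 - 1))) * (-((a * x ^ 2 - b) / (x ^ 2 - 1))) =
    a ^ 4 + a ^ 3 * b + a ^ 2 * b ^ 2 + a * b ^ 3 + b ^ 4 := by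
  field_simp
  ring

lemma lineSeries_01235 (Q : PowerSeries ℂ) : lineSeries ![0, 1, 2, 3, 5] Q =
    C (1 / 30) * (rescale 1 Q * rescale 2 Q * rescale 3 Q * rescale 5 Q) +
    C (1 / (-8)) * (rescale (-1) Q * rescale 1 Q * rescale 2 Q * rescale 4 Q) +
    C (1 / 6) * (rescale (-2) Q * rescale (-1) Q * rescale 1 Q * rescale 3 Q) +
    C (1 / (-12)) * (rescale (-3) Q * rescale (-2) Q * rescale (-1) Q * rescale 2 Q) +
    C (1 / 120) * (rescale (-5) Q * rescale (-4) Q * rescale (-3) Q * rescale (-2) Q) := by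
  simp only [lineSeries, Fin.sum_univ_five, Fin.prod_univ_four]
  simp only [Fin.succAbove, Fin.lt_def]
  simp
  norm_num
  have c1 : (C (1 / 5) * (C (1 / 3) * C (1 / 2)) : PowerSeries ℂ) = C (1 / 30) := by
    simp only [← map_mul]; norm_num
  have c2 : (C (1 / 4) * C (1 / 2) : PowerSeries ℂ) = C (1 / 8) := by
    simp only [← map_mul]; norm_num
  have c3 : (C (1 / 3) * C (1 / 2) : PowerSeries ℂ) = C (1 / 6) := by
    simp only [← map_mul]; norm_num
  have c4 : (C (1 / 2) * (C (1 / 2) * C (1 / 3)) : PowerSeries ℂ) = C (1 / 12) := by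
    simp only [← map_mul]; norm_num
  have c5 : (C (1 / 2) * (C (1 / 3) * (C (1 / 4) * C (1 / 5))) : PowerSeries ℂ) = C (1 / 120) := by
    simp only [← map_mul]; norm_num
  rw [c1, c2, c3, c4, c5]

/-- The identity along the line `(0, 1, 2, 3, 5)` read off from the reciprocals of `f (n * X)`. -/
lemma lineSeries_eq_of_reciprocals {K : Type*} [Field K] (ψ : PowerSeries ℂ →+* K)
    (hψ : Function.Injective ψ) {f : PowerSeries ℂ} (hf : IsNormalized f) {c : ℂ} {G : ℂ → K}
    (hG : ∀ n : ℂ, n ≠ 0 → G n * ψ (rescale n f) = 1)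
    (h : G 1 * G 2 * G 3 * G 5 + G (-1) * G 1 * G 2 * G 4 + G (-2) * G (-1) * G 1 * G 3 +
      G (-3) * G (-2) * G (-1) * G 2 + G (-5) * G (-4) * G (-3) * G (-2) = ψ (C c)) :
    lineSeries ![0, 1, 2, 3, 5] (qSeries f) = C c * X ^ 4 := by
  have hQ : ∀ n : ℂ, n ≠ 0 → ψ (rescale n (qSeries f)) = ψ (C n) * ψ X * G n := by
    intro n hn
    have : rescale n f * rescale n (qSeries f) = C n * X := by
      rw [← map_mul, hf.mul_qSeries, rescale_X]
    have := congrArg ψ this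
    rw [map_mul, map_mul] at this
    linear_combination G n * this - ψ (rescale n (qSeries f)) * hG n hn
  have hC : ∀ x y z u v : ℂ, x * (y * z * u * v) = 1 →
      ψ (C x) * (ψ (C y) * ψ (C z) * ψ (C u) * ψ (C v)) = 1 := by
    intro x y z u v hxy
    simp only [← map_mul, hxy, map_one]
  apply hψ
  rw [map_mul, ← h, map_pow, lineSeries_01235]
  simp only [map_add, map_mul]
  rw [hQ 1 (by norm_num), hQ 2 (by norm_num), hQ 3 (by norm_num), hQ 4 (by norm_num),
    hQ 5 (by norm_num), hQ (-1) (by norm_num), hQ (-2) (by norm_num), hQ (-3) (by norm_num),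
    hQ (-4) (by norm_num), hQ (-5) (by norm_num)]
  linear_combination (ψ X) ^ 4 * (G 1 * G 2 * G 3 * G 5 * hC (1 / 30) 1 2 3 5 (by norm_num) +
    G (-1) * G 1 * G 2 * G 4 * hC (1 / (-8)) (-1) 1 2 4 (by norm_num) +
    G (-2) * G (-1) * G 1 * G 3 * hC (1 / 6) (-2) (-1) 1 3 (by norm_num) +
    G (-3) * G (-2) * G (-1) * G 2 * hC (1 / (-12)) (-3) (-2) (-1) 2 (by norm_num) +
    G (-5) * G (-4) * G (-3) * G (-2) * hC (1 / 120) (-5) (-4) (-3) (-2) (by norm_num))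

/-- The solution `(exp (α X) - exp (β X)) / (α exp (β X) - β exp (α X))` of the Riccati equation in
the case of distinct roots, written as `(E - 1) / (α - β E)` with `E = exp ((α - β) X)`. -/
lemma exists_todd_of_ne {α β : ℂ} (h : α ≠ β) : ∃ f : PowerSeries ℂ, IsNormalized f ∧
    d⁄dX ℂ f = 1 + C (α + β) * f + C (α * β) * f ^ 2 ∧
    ∃ c, lineSeries ![0, 1, 2, 3, 5] (qSeries f) = C c * X ^ 4 := by
  have hab : α - β ≠ 0 := sub_ne_zero.2 h
  set E : PowerSeries ℂ := rescale (α - β) (exp ℂ) with hE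
  set D : PowerSeries ℂ := C α - C β * E with hD
  have hE0 : coeff 0 E = 1 := by simp [hE]
  have hE1 : coeff 1 E = α - β := by simp [hE, coeff_exp]
  have hD0 : coeff 0 D = α - β := by
    rw [hD, map_sub, coeff_C_mul, hE0]; simp
  have hDne : constantCoeff D ≠ 0 := by rwa [← coeff_zero_eq_constantCoeff_apply, hD0]
  have hfD : (E - 1) * D⁻¹ * D = E - 1 := by
    rw [mul_assoc, PowerSeries.inv_mul_cancel _ hDne, mul_one]
  set f := (E - 1) * D⁻¹ with hfdef
  have hf : IsNormalized f := by
    have e0 : coeff 0 (E - 1) = 0 := by rw [map_sub, hE0]; simp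
    constructor
    · rw [coeff_zero_eq_constantCoeff_apply] at e0 ⊢
      rw [hfdef, map_mul, e0, zero_mul]
    · have := congrArg (coeff 1) hfD
      have h1 : coeff 1 (E - 1) = α - β := by simp [hE1, coeff_one]
      rw [coeff_mul, Nat.sum_antidiagonal_eq_sum_range_succ_mk, sum_range_succ,
        sum_range_one] at this
      simp only [Nat.sub_zero, Nat.sub_self, h1, hD0] at this
      rw [coeff_zero_eq_constantCoeff_apply, hfdef, map_mul,
        ← coeff_zero_eq_constantCoeff_apply, e0, zero_mul, zero_mul, zero_add] at this
      exact mul_right_cancel₀ hab (by rw [this, one_mul])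
  clear_value f
  have hdE : d⁄dX ℂ E = C (α - β) * E := by
    apply mul_left_cancel₀ (X_ne_zero (R := ℂ))
    rw [hE, X_mul_derivative_rescale, derivative_exp, map_mul, rescale_X]
    ring
  refine ⟨f, hf, ?_, ?_⟩
  · have e := congrArg (d⁄dX ℂ) hfD
    simp only [Derivation.leibniz, smul_eq_mul, map_sub, hD, hdE, derivative_C,
      Derivation.map_one_eq_zero] at e
    have hD' : D ^ 2 ≠ 0 := pow_ne_zero _ fun h => hDne (by simp [h])
    apply mul_right_cancel₀ hD'
    rw [sub_zero, zero_sub, mul_zero, add_zero, ← hD] at e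
    have hfD' : f * D = E - 1 := hfD
    simp only [map_add, map_mul] at e ⊢
    linear_combination D * e + (C β * (C α - C β) * E - (C α + C β) * D
      - C α * C β * (f * D + E - 1)) * hfD' + ((C α - C β) * E - D - C α * (E - 1)) * hD
  · have hEn : ∀ n : ℕ, rescale (n : ℂ) E = E ^ n := by
      intro n
      rw [hE, rescale_rescale, mul_comm, ← rescale_rescale, ← exp_pow_eq_rescale_exp, map_pow]
    have hrC : ∀ x y : ℂ, rescale x (C y) = (C y : PowerSeries ℂ) := by
      intro x y
      ext n
      rw [coeff_rescale, coeff_C]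
      split_ifs with h <;> simp [h]
    have hneg : E * rescale (-1) E = 1 := by
      rw [hE, rescale_rescale, mul_comm (α - β), ← rescale_rescale, ← map_mul]
      have := exp_mul_exp_neg_eq_one (A := ℂ)
      rw [evalNegHom] at this
      rw [this, map_one]
    have hpos : ∀ n : ℕ, rescale (n : ℂ) f * (C α - C β * E ^ n) = E ^ n - 1 := by
      intro n
      have := congrArg (rescale (n : ℂ)) hfD
      rw [map_mul, hD, map_sub, map_sub, map_mul, hEn, map_one, hrC, hrC] at this
      exact this
    have hneg' : ∀ n : ℕ, rescale (-(n : ℂ)) f * (C α * E ^ n - C β) = 1 - E ^ n := by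
      intro n
      have := congrArg (rescale (-1 : ℂ)) (hpos n)
      rw [map_mul, map_sub, map_sub, map_mul, map_pow, map_one, hrC, hrC,
        rescale_rescale, mul_neg_one] at this
      have h1 : E ^ n * rescale (-1) E ^ n = 1 := by rw [← mul_pow, hneg, one_pow]
      linear_combination E ^ n * this + (1 + C β * rescale (-(n : ℂ)) f) * h1
    have hE1' : ∀ n : ℕ, n ≠ 0 → E ^ n - 1 ≠ 0 := by
      intro n hn h0
      have := congrArg (coeff 1) h0
      rw [← hEn, map_sub, coeff_rescale, hE1] at this
      simp [coeff_one, hn, hab] at this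
    refine ⟨α ^ 4 + α ^ 3 * β + α ^ 2 * β ^ 2 + α * β ^ 3 + β ^ 4, ?_⟩
    let K := FractionRing (PowerSeries ℂ)
    have inj := IsFractionRing.injective (PowerSeries ℂ) K
    obtain ⟨ψ, hψ⟩ : ∃ ψ : PowerSeries ℂ →+* K, Function.Injective ψ := ⟨_, inj⟩
    have hψ0 : ∀ A, A ≠ 0 → ψ A ≠ 0 := fun A hA h0 => hA (hψ (by rw [h0, map_zero]))
    have hfn : ∀ n : ℂ, n ≠ 0 → ψ (rescale n f) ≠ 0 := by
      refine fun n hn => hψ0 _ fun h0 => hn ?_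
      have := congrArg (coeff 1) h0
      rwa [coeff_rescale, hf.2, pow_one, mul_one, map_zero] at this
    have hx : ∀ n : ℕ, n ≠ 0 → ψ E ^ n - 1 ≠ 0 := by
      intro n hn
      have := hψ0 _ (hE1' n hn)
      rwa [map_sub, map_pow, map_one] at this
    have gpos : ∀ n : ℕ, n ≠ 0 → (ψ (rescale (n : ℂ) f))⁻¹ =
        (ψ (C α) - ψ (C β) * ψ E ^ n) / (ψ E ^ n - 1) := by
      intro n hn
      have := congrArg ψ (hpos n)
      simp only [map_mul, map_sub, map_pow, map_one] at this
      rw [eq_div_iff (hx n hn), ← this, inv_mul_cancel_left₀ (hfn _ (by exact_mod_cast hn))]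
    have gneg : ∀ n : ℕ, n ≠ 0 → (ψ (rescale (-(n : ℂ)) f))⁻¹ =
        -((ψ (C α) * ψ E ^ n - ψ (C β)) / (ψ E ^ n - 1)) := by
      intro n hn
      have := congrArg ψ (hneg' n)
      simp only [map_mul, map_sub, map_pow, map_one] at this
      rw [← neg_div, eq_div_iff (hx n hn), ← neg_sub 1 (ψ E ^ n), ← this, mul_neg,
        inv_mul_cancel_left₀ (hfn _ (by simpa using hn))]
    have p1 := gpos 1 (by norm_num)
    have p2 := gpos 2 (by norm_num)
    have p3 := gpos 3 (by norm_num)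
    have p4 := gpos 4 (by norm_num)
    have p5 := gpos 5 (by norm_num)
    have m1 := gneg 1 (by norm_num)
    have m2 := gneg 2 (by norm_num)
    have m3 := gneg 3 (by norm_num)
    have m4 := gneg 4 (by norm_num)
    have m5 := gneg 5 (by norm_num)
    push_cast at p1 p2 p3 p4 p5 m1 m2 m3 m4 m5
    refine lineSeries_eq_of_reciprocals ψ hψ hf (G := fun n => (ψ (rescale n f))⁻¹)
      (fun n hn => inv_mul_cancel₀ (hfn n hn)) ?_
    simp only [p1, p2, p3, p4, p5, m1, m2, m3, m4, m5, pow_one, map_add, map_mul, map_pow]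
    exact todd_line_identity _ _ _ (by simpa using hx 1 (by norm_num)) (hx 2 (by norm_num))
      (hx 3 (by norm_num)) (hx 4 (by norm_num)) (hx 5 (by norm_num))

/-- The solution `X / (1 - α X)` of the Riccati equation in the case of a double root. -/
lemma exists_todd_of_eq (α : ℂ) : ∃ f : PowerSeries ℂ, IsNormalized f ∧
    d⁄dX ℂ f = 1 + C (α + α) * f + C (α * α) * f ^ 2 ∧
    ∃ c, lineSeries ![0, 1, 2, 3, 5] (qSeries f) = C c * X ^ 4 := by
  set D : PowerSeries ℂ := 1 - C α * X with hD
  have hD0 : constantCoeff D = 1 := by simp [hD]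
  have hDi : D * D⁻¹ = 1 := PowerSeries.mul_inv_cancel _ (by simp [hD0])
  have hD' : D ≠ 0 := fun h => by simp [h] at hD0
  have hf : IsNormalized (X * D⁻¹) := by
    constructor
    · simp
    · rw [show 1 = 0 + 1 by rfl, coeff_succ_X_mul]
      simp [hD0]
  have hQ : qSeries (X * D⁻¹) = D := by
    have hX : (X : PowerSeries ℂ) ≠ 0 := X_ne_zero
    have := hf.mul_qSeries
    apply mul_left_cancel₀ hX
    linear_combination D * this - X * qSeries (X * D⁻¹) * hDi
  refine ⟨X * D⁻¹, hf, ?_, 5 * α ^ 4, ?_⟩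
  · have hdD : d⁄dX ℂ D = -C α := by
      rw [hD, map_sub, Derivation.leibniz, Derivation.map_one_eq_zero, derivative_X, derivative_C]
      simp
    have e : d⁄dX ℂ (X * D⁻¹ * D) = 1 := by
      rw [mul_assoc, mul_comm D⁻¹, hDi, mul_one, derivative_X]
    have hfD : X * D⁻¹ * D = X := by linear_combination X * hDi
    rw [Derivation.leibniz, hdD, smul_eq_mul, smul_eq_mul] at e
    generalize X * D⁻¹ = f at *
    apply mul_right_cancel₀ (pow_ne_zero 2 hD')
    simp only [map_add, map_mul]
    linear_combination D * e + (C α - 2 * C α * D - C α ^ 2 * (f * D + X)) * hfD -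
      (D + C α * X) * hD
  · have hrD : ∀ x : ℂ, rescale x D = 1 - C α * (C x * X) := by
      intro x
      rw [hD, map_sub, map_one, map_mul, rescale_X]
      congr 2
      ext n
      rw [coeff_rescale, coeff_C]
      split_ifs with h <;> simp [h]
    rw [hQ, lineSeries_01235]
    simp only [hrD]
    have hn (n : ℕ) [n.AtLeastTwo] :
        (C (OfNat.ofNat n : ℂ) : PowerSeries ℂ) = OfNat.ofNat n := rfl
    have hu : (120 : PowerSeries ℂ) * C (1 / 120) = 1 := by
      rw [← hn 120, ← map_mul]; norm_num
    have hcu (m x : ℂ) (h : x = m * (1 / 120)) : (C x : PowerSeries ℂ) = C m * C (1 / 120) := by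
      rw [h, map_mul]
    rw [hcu 4 (1 / 30) (by norm_num), hcu (-15) (1 / (-8)) (by norm_num),
      hcu 20 (1 / 6) (by norm_num), hcu (-10) (1 / (-12)) (by norm_num)]
    simp only [map_neg, hn, map_one, map_mul, map_pow]
    linear_combination (5 * C α ^ 4 * X ^ 4) * hu

/-- Every Riccati equation `f' = 1 + s f + p f²` has a normalized solution that satisfies the
functional equation along the line `(0, 1, 2, 3, 5)`. -/
lemma exists_todd (s p : ℂ) : ∃ f : PowerSeries ℂ, IsNormalized f ∧
    d⁄dX ℂ f = 1 + C s * f + C p * f ^ 2 ∧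
    ∃ c, lineSeries ![0, 1, 2, 3, 5] (qSeries f) = C c * X ^ 4 := by
  obtain ⟨r, hr⟩ := IsAlgClosed.exists_pow_nat_eq (s ^ 2 - 4 * p) (n := 2) (by norm_num)
  have h1 : (s + r) / 2 + (s - r) / 2 = s := by ring
  have h2 : (s + r) / 2 * ((s - r) / 2) = p := by linear_combination -hr / 4
  by_cases h : (s + r) / 2 = (s - r) / 2
  · have := exists_todd_of_eq ((s + r) / 2)
    rw [← h] at h1 h2
    rwa [h1, h2] at this
  · have := exists_todd_of_ne h
    rwa [h1, h2] at this

/-- The coefficients of `X * Q' / Q` for the solution of the Riccati equation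
`f' = 1 + s f + p f ^ 2`. -/
lemma logCoeff_of_riccati {f : PowerSeries ℂ} (hf : IsNormalized f) {s p : ℂ}
    (h : d⁄dX ℂ f = 1 + C s * f + C p * f ^ 2) :
    logCoeff f 1 = -s / 2 ∧ logCoeff f 2 = -s ^ 2 / 12 - 2 * p / 3 ∧
    logCoeff f 3 = -p * s / 2 ∧
    logCoeff f 4 = s ^ 4 / 720 - 8 / 45 * p * s ^ 2 - 14 / 45 * p ^ 2 ∧
    logCoeff f 5 = -(logCoeff f 2 * logCoeff f 3) := by
  have hW : logSeries (qSeries f) = 1 - qSeries f - C s * X - C p * (X * f) := by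
    have hQ : qSeries f ≠ 0 := fun h => by
      have := hf.coeff_zero_qSeries
      simp [h] at this
    have e := congrArg (fun g => X * d⁄dX ℂ g) hf.mul_qSeries
    have e2 := logSeries_mul hf.coeff_zero_qSeries
    have e3 := hf.mul_qSeries
    simp only [Derivation.leibniz, smul_eq_mul, derivative_X, h] at e
    have hX : (X : PowerSeries ℂ) ≠ 0 := X_ne_zero
    apply mul_left_cancel₀ hX
    linear_combination e + f * e2 - (C s * X + logSeries (qSeries f) + C p * X * f) * e3
  have hw : ∀ k, logCoeff f (k + 2) = -expCoeff (logCoeff f) (k + 2) - p * coeff (k + 1) f := by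
    intro k
    rw [← hf.coeff_qSeries, logCoeff, hW]
    simp [coeff_one, coeff_succ_X_mul]
  have hw1 : logCoeff f 1 = -expCoeff (logCoeff f) 1 - s := by
    rw [← hf.coeff_qSeries, logCoeff, hW]
    have : constantCoeff f = 0 := by simpa using hf.1
    simp [coeff_one, coeff_succ_X_mul, this]
  have hr : ∀ k, coeff (k + 2) f * (k + 1 + 1) =
      s * coeff (k + 1) f + p * coeff (k + 1) (f * f) := by
    intro k
    have := congrArg (coeff (k + 1)) h
    rw [coeff_derivative] at this
    simpa [pow_two, coeff_one] using this
  have hf0 := hf.1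
  have hf1 := hf.2
  have r2 := hr 0
  have r3 := hr 1
  have r4 := hr 2
  simp only [coeff_mul, Nat.sum_antidiagonal_eq_sum_range_succ_mk, sum_range_succ, sum_range_zero,
    Nat.reduceAdd, Nat.reduceSub, hf0, hf1] at r2 r3 r4
  have w2 := hw 0
  have w3 := hw 1
  have w4 := hw 2
  have w5 := hw 3
  simp only [Nat.reduceAdd, expCoeff_one, expCoeff_two, expCoeff_three, expCoeff_four,
    expCoeff_five, hf1] at hw1 w2 w3 w4 w5
  push_cast at r2 r3 r4
  have f2 : coeff 2 f = s / 2 := by linear_combination r2 / 2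
  rw [f2] at r3 r4 w3
  have f3 : coeff 3 f = (s ^ 2 + 2 * p) / 6 := by linear_combination r3 / 3
  rw [f3] at r4 w4
  have f4 : coeff 4 f = (s ^ 3 + 8 * p * s) / 24 := by linear_combination r4 / 4
  rw [f4] at w5
  have l1 : logCoeff f 1 = -s / 2 := by linear_combination hw1 / 2
  rw [l1] at w2 w3 w4 w5
  have l2 : logCoeff f 2 = -s ^ 2 / 12 - 2 * p / 3 := by linear_combination 2 / 3 * w2
  rw [l2] at w3 w4 w5
  have l3 : logCoeff f 3 = -p * s / 2 := by linear_combination 3 / 4 * w3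
  rw [l3] at w4 w5
  have l4 : logCoeff f 4 = s ^ 4 / 720 - 8 / 45 * p * s ^ 2 - 14 / 45 * p ^ 2 := by
    linear_combination 4 / 5 * w4
  rw [l4] at w5
  refine ⟨l1, l2, l3, l4, ?_⟩
  rw [l2, l3]
  linear_combination 5 / 6 * w5

/-- On the Todd surface a solution of the functional equation satisfies a Riccati equation. -/
theorem riccati_of_isToddPoint {f : PowerSeries ℂ} (hf : IsNormalized f)
    (hL : LineRel ![0, 1, 2, 3, 5] (logCoeff f))
    (h5 : logCoeff f 5 = -(logCoeff f 2 * logCoeff f 3))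
    (hT : IsToddPoint (logCoeff f 1) (logCoeff f 2) (logCoeff f 3) (logCoeff f 4)) :
    ∃ s p, d⁄dX ℂ f = 1 + C s * f + C p * f ^ 2 := by
  set a := logCoeff f 1 with ha
  set b := logCoeff f 2 with hb
  obtain ⟨hT1, hT2⟩ := hT
  obtain ⟨g, hg, hgr, c, hgL⟩ := exists_todd (-2 * a) (-(3 / 2) * b - a ^ 2 / 2)
  obtain ⟨l1, l2, l3, l4, l5⟩ := logCoeff_of_riccati hg hgr
  have h1 : logCoeff g 1 = logCoeff f 1 := by rw [l1, ← ha]; ring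
  have h2 : logCoeff g 2 = logCoeff f 2 := by rw [l2, ← hb]; ring
  have h3 : logCoeff g 3 = logCoeff f 3 := by rw [l3]; linear_combination -hT1 / 2
  have h4 : logCoeff g 4 = logCoeff f 4 := by
    rw [l4]; linear_combination -hT2 / 60 + 2 / 3 * a * hT1
  have : f = g := by
    refine hf.eq_of_logCoeff_eq hg fun k hk => ?_
    refine hL.eq_of_eq_le_five (lineRel_logCoeff hg hgL) (fun k h1k hk5 => ?_) hk
    interval_cases k
    · exact h1.symm
    · exact h2.symm
    · exact h3.symm
    · exact h4.symm
    · rw [h5, l5, h2, h3]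
  exact ⟨_, _, by rw [this]; exact hgr⟩

lemma solvesODE_of_riccati {f : PowerSeries ℂ} {s p : ℂ}
    (h : d⁄dX ℂ f = 1 + C s * f + C p * f ^ 2) : SolvesODE f := by
  refine ⟨-s / 2, (s ^ 2 - 4 * p) / 12, 0, ?_⟩
  simp only [Function.iterate_succ, Function.iterate_zero, Function.comp, id, smul_eq_C_mul]
  have c1 : (C (6 * (-s / 2)) : PowerSeries ℂ) = -3 * C s := by
    rw [show 6 * (-s / 2) = -3 * s by ring, map_mul, map_neg]; rfl
  have c2 : (C (12 * ((s ^ 2 - 4 * p) / 12)) : PowerSeries ℂ) = C s ^ 2 - 4 * C p := by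
    rw [show 12 * ((s ^ 2 - 4 * p) / 12) = s ^ 2 - 4 * p by ring, map_sub, map_mul, map_pow]; rfl
  rw [c1, c2, mul_zero, map_zero, zero_mul, add_zero]
  have h2 : d⁄dX ℂ (d⁄dX ℂ f) = (C s + 2 * C p * f) * d⁄dX ℂ f := by
    have := congrArg (d⁄dX ℂ) h
    simp only [map_add, Derivation.leibniz, smul_eq_mul, derivative_C, pow_two,
      Derivation.map_one_eq_zero] at this
    linear_combination this
  have h3 : d⁄dX ℂ (d⁄dX ℂ (d⁄dX ℂ f)) =
      2 * C p * (d⁄dX ℂ f) ^ 2 + (C s + 2 * C p * f) ^ 2 * d⁄dX ℂ f := by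
    have t2 : d⁄dX ℂ (2 * C p * f) = 2 * C p * d⁄dX ℂ f := by
      rw [show (2 * C p : PowerSeries ℂ) = C (2 * p) by rw [map_mul]; rfl, Derivation.leibniz,
        derivative_C]
      simp
    rw [h2, Derivation.leibniz, smul_eq_mul, smul_eq_mul, map_add, derivative_C, t2, h2]
    ring
  rw [h3, h2]
  linear_combination (-4 * C p * f * d⁄dX ℂ f) * h

lemma params_mem_toddManifold {f : PowerSeries ℂ} (hf : IsNormalized f)
    (hT : IsToddPoint (logCoeff f 1) (logCoeff f 2) (logCoeff f 3) (logCoeff f 4)) :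
    params f ∈ toddManifold := by
  obtain ⟨hT1, hT2⟩ := hT
  have e3 : expCoeff (logCoeff f) 3 = 0 := by
    rw [expCoeff_three]; linear_combination hT1 / 6
  simp only [toddManifold, params, Set.mem_ofPred_eq, Fin.val_one, Fin.val_two, hf.coeff_qSeries]
  refine ⟨e3, ?_⟩
  simp only [show ((3 : Fin 4) : ℕ) = 3 from rfl, Nat.reduceAdd, expCoeff_four, expCoeff_two]
  linear_combination hT2 / 48

/-- A solution of the functional equation on the Todd surface corresponds to a Todd function. -/
theorem correspondsToTodd_of_isToddPoint {f : PowerSeries ℂ} (hf : IsNormalized f)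
    (hL : LineRel ![0, 1, 2, 3, 5] (logCoeff f))
    (h5 : logCoeff f 5 = -(logCoeff f 2 * logCoeff f 3))
    (hT : IsToddPoint (logCoeff f 1) (logCoeff f 2) (logCoeff f 3) (logCoeff f 4)) :
    CorrespondsToTodd f := by
  obtain ⟨s, p, h⟩ := riccati_of_isToddPoint hf hL h5 hT
  exact ⟨hf, solvesODE_of_riccati h, params_mem_toddManifold hf hT⟩

end HirzebruchFE

namespace HirzebruchFE

open Complex

/-! ### The theta function -/

/-- The infinite product `∏_{n ≥ 0} (1 - q ^ n x)`. -/
noncomputable def qProd (q x : ℂ) : ℂ := ∏' n : ℕ, (1 + -(q ^ n * x))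

theorem summable_norm_neg_pow_mul {q : ℂ} (hq : ‖q‖ < 1) (x : ℂ) :
    Summable fun n : ℕ => ‖-(q ^ n * x)‖ := by
  simpa [norm_mul] using (summable_geometric_of_lt_one (norm_nonneg q) hq).mul_right ‖x‖

theorem qProd_eq {q : ℂ} (hq : ‖q‖ < 1) (x : ℂ) : qProd q x = (1 - x) * qProd q (q * x) := by
  have h1 : (fun n : ℕ => 1 + -(q ^ (n + 1) * x)) = fun n => 1 + -(q ^ n * (q * x)) :=
    funext fun n => by ring
  have hm : Multipliable fun n : ℕ => 1 + -(q ^ (n + 1) * x) :=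
    h1 ▸ multipliable_one_add_of_summable (summable_norm_neg_pow_mul hq (q * x))
  have h2 := tprod_eq_zero_mul' (f := fun n : ℕ => 1 + -(q ^ n * x)) hm
  rw [h1] at h2
  unfold qProd
  rw [h2, pow_zero, one_mul, ← sub_eq_add_neg]

theorem qProd_eq_zero_iff {q : ℂ} (hq : ‖q‖ < 1) (x : ℂ) :
    qProd q x = 0 ↔ ∃ n : ℕ, q ^ n * x = 1 := by
  constructor
  · intro h
    by_contra! hne
    exact tprod_one_add_ne_zero_of_summable (f := fun n : ℕ => -(q ^ n * x))
      (fun n h0 => hne n (by linear_combination -h0)) (summable_norm_neg_pow_mul hq x) h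
  · rintro ⟨n, hn⟩
    exact tprod_of_exists_eq_zero ⟨n, by rw [hn]; ring⟩

theorem differentiable_qProd {q : ℂ} (hq : ‖q‖ < 1) : Differentiable ℂ (qProd q) := by
  intro x
  have hx : x ∈ Metric.ball (0 : ℂ) (‖x‖ + 1) := by simp
  refine DifferentiableOn.differentiableAt (s := Metric.ball (0 : ℂ) (‖x‖ + 1)) ?_
    (Metric.isOpen_ball.mem_nhds hx)
  have hsum : Summable fun n : ℕ => ‖q‖ ^ n * (‖x‖ + 1) :=
    (summable_geometric_of_lt_one (norm_nonneg q) hq).mul_right _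
  have := hsum.hasProdLocallyUniformlyOn_nat_one_add
    (f := fun (n : ℕ) (y : ℂ) => -(q ^ n * y)) (Metric.isOpen_ball (x := (0 : ℂ)) (ε := ‖x‖ + 1))
    (Filter.Eventually.of_forall fun n y hy => by
      rw [norm_neg, norm_mul, norm_pow]
      exact mul_le_mul_of_nonneg_left (mem_ball_zero_iff.1 hy).le (by positivity))
    (fun n => by fun_prop)
  exact this.differentiableOn
    (.of_forall fun _ => by simpa [Finset.prod_fn] using
      DifferentiableOn.finsetProd (fun _ _ => by fun_prop)) Metric.isOpen_ball

/-- The function `z ↦ exp (2πiz)`. -/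
noncomputable def expTwoPiI (z : ℂ) : ℂ := exp (2 * Real.pi * I * z)

theorem expTwoPiI_add (z w : ℂ) : expTwoPiI (z + w) = expTwoPiI z * expTwoPiI w := by
  rw [expTwoPiI, mul_add, exp_add, expTwoPiI, expTwoPiI]

theorem expTwoPiI_zero : expTwoPiI 0 = 1 := by simp [expTwoPiI]

theorem expTwoPiI_ne_zero (z : ℂ) : expTwoPiI z ≠ 0 := exp_ne_zero _

theorem expTwoPiI_neg (z : ℂ) : expTwoPiI (-z) = (expTwoPiI z)⁻¹ := by
  rw [expTwoPiI, mul_neg, exp_neg, expTwoPiI]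

theorem expTwoPiI_nat_mul (n : ℕ) (z : ℂ) : expTwoPiI (n * z) = expTwoPiI z ^ n := by
  rw [expTwoPiI, expTwoPiI, ← exp_nat_mul]
  congr 1
  ring

theorem expTwoPiI_eq_one_iff (z : ℂ) : expTwoPiI z = 1 ↔ ∃ n : ℤ, z = n := by
  rw [expTwoPiI, exp_eq_one_iff]
  refine exists_congr fun n => ?_
  rw [mul_comm (n : ℂ)]
  exact mul_right_inj' two_pi_I_ne_zero

theorem expTwoPiI_one : expTwoPiI 1 = 1 := (expTwoPiI_eq_one_iff 1).2 ⟨1, by simp⟩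

theorem norm_expTwoPiI_lt_one {τ : ℂ} (hτ : 0 < τ.im) : ‖expTwoPiI τ‖ < 1 := by
  rw [expTwoPiI, norm_exp, Real.exp_lt_one_iff]
  simp only [mul_re, re_ofNat, ofReal_re, im_ofNat, ofReal_im, mul_zero, sub_zero, I_re, mul_im,
    zero_mul, add_zero, I_im, mul_one, sub_self, zero_sub, Left.neg_neg_iff]
  positivity

theorem differentiable_expTwoPiI : Differentiable ℂ expTwoPiI := by
  unfold expTwoPiI
  fun_prop

/-- The lattice `ℤ + ℤτ`. -/
def latticeOf (τ : ℂ) : AddSubgroup ℂ := AddSubgroup.closure {1, τ}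

theorem mem_latticeOf {τ z : ℂ} : z ∈ latticeOf τ ↔ ∃ m n : ℤ, (m : ℂ) + n * τ = z := by
  rw [latticeOf, AddSubgroup.mem_closure_pair]
  simp

/-- The even, nonvanishing-at-`0` factor of the theta function. -/
noncomputable def thetaCore (τ z : ℂ) : ℂ :=
  qProd (expTwoPiI τ) (expTwoPiI τ * expTwoPiI z) *
    qProd (expTwoPiI τ) (expTwoPiI τ * expTwoPiI (-z))

/-- The theta function `(1 - x) ∏_{n ≥ 1} (1 - q ^ n x) (1 - q ^ n x⁻¹)`, where
`x = exp (2πiz)` and `q = exp (2πiτ)`. -/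
noncomputable def theta (τ z : ℂ) : ℂ := (1 - expTwoPiI z) * thetaCore τ z

theorem thetaCore_neg (τ z : ℂ) : thetaCore τ (-z) = thetaCore τ z := by
  rw [thetaCore, thetaCore, neg_neg, mul_comm]

theorem theta_neg (τ z : ℂ) : theta τ (-z) = -expTwoPiI (-z) * theta τ z := by
  have := expTwoPiI_ne_zero z
  rw [theta, theta, thetaCore_neg, expTwoPiI_neg]
  field_simp
  ring

theorem theta_zero (τ : ℂ) : theta τ 0 = 0 := by simp [theta, expTwoPiI_zero]

theorem theta_add_one (τ z : ℂ) : theta τ (z + 1) = theta τ z := by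
  have h : expTwoPiI (z + 1) = expTwoPiI z := by rw [expTwoPiI_add, expTwoPiI_one, mul_one]
  rw [theta, theta, thetaCore, thetaCore, expTwoPiI_neg, expTwoPiI_neg, h]

section

variable {τ : ℂ} (hτ : 0 < τ.im)
include hτ

theorem theta_eq (z : ℂ) : theta τ z =
    qProd (expTwoPiI τ) (expTwoPiI z) * qProd (expTwoPiI τ) (expTwoPiI (τ - z)) := by
  rw [qProd_eq (norm_expTwoPiI_lt_one hτ) (expTwoPiI z), theta, thetaCore, sub_eq_add_neg τ,
    expTwoPiI_add]
  ring

theorem theta_add_tau (z : ℂ) : theta τ (z + τ) = -expTwoPiI (-z) * theta τ z := by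
  rw [theta_eq hτ (z + τ), ← theta_neg, theta_eq hτ (-z), mul_comm]
  congr 3 <;> ring

theorem differentiable_theta : Differentiable ℂ (theta τ) := by
  have h : Differentiable ℂ (fun z => qProd (expTwoPiI τ) (expTwoPiI z) *
      qProd (expTwoPiI τ) (expTwoPiI (τ - z))) :=
    ((differentiable_qProd (norm_expTwoPiI_lt_one hτ)).comp differentiable_expTwoPiI).mul
      ((differentiable_qProd (norm_expTwoPiI_lt_one hτ)).comp
        (differentiable_expTwoPiI.comp (by fun_prop)))
  exact (funext (theta_eq hτ) : theta τ = _) ▸ h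

theorem differentiable_thetaCore : Differentiable ℂ (thetaCore τ) := by
  have h := differentiable_qProd (norm_expTwoPiI_lt_one hτ)
  have h1 := differentiable_expTwoPiI
  exact (h.comp (h1.const_mul _)).mul
    (h.comp ((h1.comp differentiable_neg).const_mul _))

theorem theta_eq_zero_iff (z : ℂ) : theta τ z = 0 ↔ z ∈ latticeOf τ := by
  have hq := norm_expTwoPiI_lt_one hτ
  rw [theta_eq hτ, mul_eq_zero, qProd_eq_zero_iff hq, qProd_eq_zero_iff hq, mem_latticeOf]
  simp_rw [← expTwoPiI_nat_mul, ← expTwoPiI_add, expTwoPiI_eq_one_iff]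
  constructor
  · rintro (⟨n, m, h⟩ | ⟨n, m, h⟩)
    · exact ⟨m, -n, by push_cast; linear_combination -h⟩
    · exact ⟨-m, n + 1, by push_cast; linear_combination h⟩
  · rintro ⟨m, n, h⟩
    rcases le_or_gt n 0 with hn | hn
    · left
      obtain ⟨k, rfl⟩ := Int.exists_eq_neg_ofNat hn
      exact ⟨k, m, by rw [← h]; push_cast; ring⟩
    · right
      obtain ⟨k, rfl⟩ : ∃ k : ℕ, n = k + 1 := ⟨(n - 1).toNat, by omega⟩
      exact ⟨k, -m, by rw [← h]; push_cast; ring⟩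

theorem thetaCore_zero_ne_zero : thetaCore τ 0 ≠ 0 := by
  have hq := norm_expTwoPiI_lt_one hτ
  have : ∀ n : ℕ, expTwoPiI τ ^ n * expTwoPiI τ ≠ 1 := by
    intro n h
    have h2 : ‖expTwoPiI τ ^ (n + 1)‖ < 1 := by
      rw [norm_pow]
      exact pow_lt_one₀ (norm_nonneg _) hq (by omega)
    rw [pow_succ, h, norm_one] at h2
    exact lt_irrefl _ h2
  rw [thetaCore, neg_zero, expTwoPiI_zero, mul_one]
  simpa [qProd_eq_zero_iff hq] using this

theorem deriv_theta_zero_ne_zero : deriv (theta τ) 0 ≠ 0 := by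
  have h1 : HasDerivAt (fun z => 1 - expTwoPiI z) (-(2 * Real.pi * I)) 0 := by
    have h : HasDerivAt (fun z : ℂ => 2 * Real.pi * I * z) (2 * Real.pi * I) 0 := by
      simpa using (hasDerivAt_id (0 : ℂ)).const_mul (2 * Real.pi * I : ℂ)
    have := (h.cexp).const_sub 1
    simpa [expTwoPiI] using this
  have h2 := h1.mul (differentiable_thetaCore hτ 0).hasDerivAt
  have h3 : deriv (theta τ) 0 = -(2 * Real.pi * I) * thetaCore τ 0 := by
    have := h2.deriv
    simp only [expTwoPiI_zero, sub_self, zero_mul, add_zero] at this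
    exact this
  rw [h3]
  exact mul_ne_zero (neg_ne_zero.2 two_pi_I_ne_zero) (thetaCore_zero_ne_zero hτ)

end

end HirzebruchFE

namespace HirzebruchFE

open Complex Filter Topology

/-! ### Removable singularities and Liouville's theorem -/

/-- The function `h` has at worst a removable singularity at `z`. -/
def IsRemovableAt (h : ℂ → ℂ) (z : ℂ) : Prop :=
  ∃ G : ℂ → ℂ, AnalyticAt ℂ G z ∧ h =ᶠ[𝓝[≠] z] G

theorem isRemovableAt_of_analyticAt {h : ℂ → ℂ} {z : ℂ} (hh : AnalyticAt ℂ h z) :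
    IsRemovableAt h z := ⟨h, hh, EventuallyEq.rfl⟩

theorem tendsto_add_const_nhdsNE (z ω : ℂ) : Tendsto (fun x => x + ω) (𝓝[≠] z) (𝓝[≠] (z + ω)) :=
  tendsto_nhdsWithin_of_tendsto_nhds_of_eventually_within _
    (((continuous_add_const ω).tendsto z).mono_left nhdsWithin_le_nhds)
    (eventually_mem_nhdsWithin.mono fun x hx => by
      simpa only [Set.mem_compl_iff, Set.mem_singleton_iff, add_left_inj] using hx)

theorem tendsto_const_sub_nhdsNE (z ω : ℂ) : Tendsto (fun x => ω - x) (𝓝[≠] z) (𝓝[≠] (ω - z)) :=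
  tendsto_nhdsWithin_of_tendsto_nhds_of_eventually_within _
    (((continuous_const.sub continuous_id).tendsto z).mono_left nhdsWithin_le_nhds)
    (eventually_mem_nhdsWithin.mono fun x hx => by
      simpa only [Set.mem_compl_iff, Set.mem_singleton_iff, sub_right_inj] using hx)

/-- Removability is transported by a translation under which the function is multiplied by a
constant. -/
theorem IsRemovableAt.of_add {h : ℂ → ℂ} {z ω χ : ℂ} (hh : IsRemovableAt h (z + ω)) (hχ : χ ≠ 0)
    (hω : ∀ x, h (x + ω) = χ * h x) : IsRemovableAt h z := by
  obtain ⟨G, hG, e⟩ := hh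
  refine ⟨fun x => χ⁻¹ * G (x + ω), ?_, ?_⟩
  · exact analyticAt_const.fun_mul (hG.comp_of_eq (by fun_prop) rfl)
  · filter_upwards [(tendsto_add_const_nhdsNE z ω).eventually e] with x hx
    rw [← hx, hω, inv_mul_cancel_left₀ hχ]

/-- Removability is transported by a reflection that fixes the function. -/
theorem IsRemovableAt.of_const_sub {h : ℂ → ℂ} {z ω : ℂ} (hh : IsRemovableAt h (ω - z))
    (hω : ∀ x, h (ω - x) = h x) : IsRemovableAt h z := by
  obtain ⟨G, hG, e⟩ := hh
  refine ⟨fun x => G (ω - x), hG.comp_of_eq (by fun_prop) rfl, ?_⟩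
  filter_upwards [(tendsto_const_sub_nhdsNE z ω).eventually e] with x hx
  rw [← hx, hω]

/-- A function with only removable singularities agrees near every point, the point itself
possibly excepted, with an entire function. -/
theorem exists_entire_of_isRemovableAt {h : ℂ → ℂ} (hr : ∀ z, IsRemovableAt h z) :
    ∃ H : ℂ → ℂ, Differentiable ℂ H ∧ (∀ z, h =ᶠ[𝓝[≠] z] H) ∧
      ∀ z, Tendsto h (𝓝[≠] z) (𝓝 (H z)) := by
  have ht : ∀ z, ∃ y, Tendsto h (𝓝[≠] z) (𝓝 y) := fun z => by
    obtain ⟨G, hG, e⟩ := hr z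
    exact ⟨G z, (tendsto_congr' e).2 (hG.continuousAt.tendsto.mono_left nhdsWithin_le_nhds)⟩
  choose H hH using ht
  have key : ∀ z, ∃ G : ℂ → ℂ, AnalyticAt ℂ G z ∧ h =ᶠ[𝓝[≠] z] G ∧ H =ᶠ[𝓝 z] G := by
    intro z
    obtain ⟨G, hG, e⟩ := hr z
    refine ⟨G, hG, e, ?_⟩
    rw [EventuallyEq, eventually_nhdsWithin_iff, ← eventually_eventually_nhds] at e
    filter_upwards [e, hG.eventually_analyticAt] with w hw hGw
    refine tendsto_nhds_unique (hH w) ?_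
    rcases eq_or_ne w z with rfl | hwz
    · refine (tendsto_congr' ?_).2 (hGw.continuousAt.tendsto.mono_left nhdsWithin_le_nhds)
      exact eventually_nhdsWithin_iff.2 hw
    · refine (tendsto_congr' ?_).2 (hGw.continuousAt.tendsto.mono_left nhdsWithin_le_nhds)
      refine Filter.Eventually.filter_mono nhdsWithin_le_nhds ?_
      filter_upwards [hw, isOpen_ne.mem_nhds hwz] with y hy1 hy2 using hy1 hy2
  refine ⟨H, fun z => ?_, fun z => ?_, hH⟩
  · obtain ⟨G, hG, -, e⟩ := key z
    exact (hG.congr e.symm).differentiableAt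
  · obtain ⟨G, hG, e1, e2⟩ := key z
    exact e1.trans (e2.symm.filter_mono nhdsWithin_le_nhds)

/-- Every complex number is congruent modulo `ℤ + ℤτ` to a point of a fixed compact set. -/
theorem exists_reduction {τ : ℂ} (hτ : 0 < τ.im) (z : ℂ) :
    ∃ w ∈ Set.Icc (0 : ℝ) 1 ×ℂ Set.Icc (0 : ℝ) τ.im, ∃ m n : ℤ, z = w + n * τ + m := by
  set n : ℤ := ⌊z.im / τ.im⌋ with hn
  set y : ℂ := z - n * τ with hy
  refine ⟨y - ⌊y.re⌋, ?_, ⌊y.re⌋, n, by rw [hy]; ring⟩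
  have h1 : (n : ℝ) * τ.im ≤ z.im := (le_div_iff₀ hτ).1 (Int.floor_le _)
  have h2 : z.im < ((n : ℝ) + 1) * τ.im := (div_lt_iff₀ hτ).1 (Int.lt_floor_add_one _)
  have h3 : y.im = z.im - n * τ.im := by simp [hy]
  rw [mem_reProdIm]
  refine ⟨⟨?_, ?_⟩, ⟨?_, ?_⟩⟩
  · simp
  · simpa using (Int.fract_lt_one y.re).le
  · simp [h3, h1]
  · simp only [sub_im, h3, intCast_im]
    nlinarith

/-- A function with only removable singularities whose absolute value has the periods `1` and `τ`
is constant. -/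
theorem exists_const_of_isRemovableAt {τ : ℂ} (hτ : 0 < τ.im) {h : ℂ → ℂ}
    (hr : ∀ z, IsRemovableAt h z) (h1 : ∀ z, ‖h (z + 1)‖ = ‖h z‖)
    (h2 : ∀ z, ‖h (z + τ)‖ = ‖h z‖) : ∃ c, ∀ z, ∀ᶠ x in 𝓝[≠] z, h x = c := by
  obtain ⟨H, hH, e, ht⟩ := exists_entire_of_isRemovableAt hr
  have hper : ∀ ω, (∀ z, ‖h (z + ω)‖ = ‖h z‖) → Function.Periodic (fun z => ‖H z‖) ω := by
    intro ω hω z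
    refine tendsto_nhds_unique ?_ (ht z).norm
    have := ((ht (z + ω)).comp (tendsto_add_const_nhdsNE z ω)).norm
    simpa only [Function.comp_def, hω] using this
  have hb : Bornology.IsBounded (Set.range H) := by
    obtain ⟨C, hC⟩ := (isCompact_Icc.reProdIm isCompact_Icc :
      IsCompact (Set.Icc (0 : ℝ) 1 ×ℂ Set.Icc (0 : ℝ) τ.im)).exists_bound_of_continuousOn
        hH.continuous.continuousOn
    rw [isBounded_iff_forall_norm_le]
    refine ⟨C, ?_⟩
    rintro _ ⟨z, rfl⟩
    obtain ⟨w, hw, m, n, rfl⟩ := exists_reduction hτ z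
    have e1 := (hper 1 h1).int_mul m (w + n * τ)
    have e2 := (hper τ h2).int_mul n w
    rw [mul_one] at e1
    exact (e1.trans e2).trans_le (hC w hw)
  refine ⟨H 0, fun z => ?_⟩
  filter_upwards [e z] with x hx
  rw [hx, hH.apply_eq_apply_of_bounded hb x 0]

/-! ### The function of level five -/

/-- The function `F` with multipliers `1` and `exp (-2πi/5)` along the periods `1` and `τ`, with
simple zeros on the lattice and simple poles on its translate by `1/5`, and with `F'(0) = 1`. -/
noncomputable def levelFun (τ z : ℂ) : ℂ :=
  theta τ (-(1 / 5)) / deriv (theta τ) 0 * theta τ z / theta τ (z - 1 / 5)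

theorem levelFun_add_one (τ z : ℂ) : levelFun τ (z + 1) = levelFun τ z := by
  rw [levelFun, levelFun, theta_add_one, show z + 1 - 1 / 5 = z - 1 / 5 + 1 by ring, theta_add_one]

theorem fifth_notMem_latticeOf {τ : ℂ} (hτ : 0 < τ.im) : (1 / 5 : ℂ) ∉ latticeOf τ := by
  rw [mem_latticeOf]
  rintro ⟨m, n, h⟩
  have h1 := congrArg im h
  have h2 := congrArg re h
  simp only [add_im, intCast_im, mul_im, intCast_re, zero_add, zero_mul, add_zero, one_div,
    inv_im, im_ofNat, neg_zero, zero_div] at h1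
  have hn : n = 0 := by
    rcases mul_eq_zero.1 h1 with h | h
    · exact_mod_cast h
    · exact absurd h hτ.ne'
  subst hn
  have h3 : ((5 * m : ℤ) : ℂ) = (1 : ℤ) := by
    push_cast
    linear_combination 5 * h
  have := Int.cast_injective h3
  omega

/-- The value `exp (2πi/5)`. -/
noncomputable def zetaFive : ℂ := expTwoPiI (1 / 5)

theorem zetaFive_pow_eq_one_iff (n : ℕ) : zetaFive ^ n = 1 ↔ 5 ∣ n := by
  rw [zetaFive, ← expTwoPiI_nat_mul, expTwoPiI_eq_one_iff]
  constructor
  · rintro ⟨m, h⟩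
    have h3 : ((n : ℤ) : ℂ) = ((5 * m : ℤ) : ℂ) := by
      push_cast
      linear_combination 5 * h
    have := Int.cast_injective h3
    omega
  · rintro ⟨m, rfl⟩
    exact ⟨m, by push_cast; ring⟩

theorem zetaFive_ne_zero : zetaFive ≠ 0 := expTwoPiI_ne_zero _

theorem norm_zetaFive : ‖zetaFive‖ = 1 :=
  norm_eq_one_of_pow_eq_one ((zetaFive_pow_eq_one_iff 5).2 dvd_rfl) (by norm_num)

section

variable {τ : ℂ} (hτ : 0 < τ.im)
include hτ

theorem levelFun_add_tau (z : ℂ) : levelFun τ (z + τ) = zetaFive⁻¹ * levelFun τ z := by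
  have h1 := expTwoPiI_ne_zero z
  have h2 := zetaFive_ne_zero
  rw [levelFun, levelFun, theta_add_tau hτ, show z + τ - 1 / 5 = z - 1 / 5 + τ by ring,
    theta_add_tau hτ, neg_sub, sub_eq_add_neg (1 / 5 : ℂ), expTwoPiI_add, ← zetaFive,
    expTwoPiI_neg]
  generalize theta τ (z - 1 / 5) = B
  by_cases h3 : B = 0
  · simp [h3]
  · field_simp

/-- Along a period the function is multiplied by a fifth root of unity. -/
theorem exists_levelFun_add {ω : ℂ} (hω : ω ∈ latticeOf τ) :
    ∃ χ : ℂ, χ ^ 5 = 1 ∧ ∀ z, levelFun τ (z + ω) = χ * levelFun τ z := by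
  induction hω using AddSubgroup.closure_induction with
  | mem x hx =>
    rcases hx with rfl | hx
    · exact ⟨1, by simp, fun z => by rw [levelFun_add_one, one_mul]⟩
    · rw [Set.mem_singleton_iff.1 hx]
      refine ⟨zetaFive⁻¹, ?_, fun z => levelFun_add_tau hτ z⟩
      rw [inv_pow, (zetaFive_pow_eq_one_iff 5).2 dvd_rfl, inv_one]
  | zero => exact ⟨1, by simp, by simp⟩
  | add x y _ _ hx hy =>
    obtain ⟨χ, h1, h2⟩ := hx
    obtain ⟨χ', h1', h2'⟩ := hy
    exact ⟨χ' * χ, by rw [mul_pow, h1, h1', mul_one], fun z => by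
      rw [← add_assoc, h2', h2, mul_assoc]⟩
  | neg x _ hx =>
    obtain ⟨χ, h1, h2⟩ := hx
    have h0 : χ ≠ 0 := by
      rintro rfl
      simp at h1
    refine ⟨χ⁻¹, by rw [inv_pow, h1, inv_one], fun z => ?_⟩
    rw [eq_inv_mul_iff_mul_eq₀ h0, ← h2, neg_add_cancel_right]

theorem levelFun_const_ne_zero : theta τ (-(1 / 5)) / deriv (theta τ) 0 ≠ 0 := by
  refine div_ne_zero ?_ (deriv_theta_zero_ne_zero hτ)
  rw [Ne, theta_eq_zero_iff hτ, neg_mem_iff]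
  exact fifth_notMem_latticeOf hτ

theorem levelFun_eq_zero_iff (z : ℂ) :
    levelFun τ z = 0 ↔ z ∈ latticeOf τ ∨ z - 1 / 5 ∈ latticeOf τ := by
  rw [levelFun, div_eq_zero_iff, mul_eq_zero, or_iff_right (levelFun_const_ne_zero hτ),
    theta_eq_zero_iff hτ, theta_eq_zero_iff hτ]

theorem analyticAt_theta (z : ℂ) : AnalyticAt ℂ (theta τ) z :=
  (differentiable_theta hτ).analyticAt z

theorem analyticAt_levelFun {z : ℂ} (hz : z - 1 / 5 ∉ latticeOf τ) :
    AnalyticAt ℂ (levelFun τ) z := by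
  refine AnalyticAt.fun_div (analyticAt_const.fun_mul (analyticAt_theta hτ z))
    ((analyticAt_theta hτ _).comp_of_eq (f := fun z : ℂ => z - 1 / 5) (by fun_prop) rfl) ?_
  rwa [Ne, theta_eq_zero_iff hτ]

omit hτ in
theorem levelFun_zero : levelFun τ 0 = 0 := by simp [levelFun, theta_zero]

theorem zero_sub_fifth_notMem : (0 - 1 / 5 : ℂ) ∉ latticeOf τ := by
  rw [zero_sub, neg_mem_iff]
  exact fifth_notMem_latticeOf hτ

theorem analyticAt_levelFun_zero : AnalyticAt ℂ (levelFun τ) 0 :=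
  analyticAt_levelFun hτ (zero_sub_fifth_notMem hτ)

theorem deriv_levelFun_zero : deriv (levelFun τ) 0 = 1 := by
  have h0 : theta τ (0 - 1 / 5) ≠ 0 := by
    rw [Ne, theta_eq_zero_iff hτ]
    exact zero_sub_fifth_notMem hτ
  have h2 : HasDerivAt (fun z => theta τ (z - 1 / 5)) (deriv (theta τ) (0 - 1 / 5)) 0 :=
    HasDerivAt.comp_sub_const 0 (1 / 5) (differentiable_theta hτ _).hasDerivAt
  have h1 := (((differentiable_theta hτ 0).hasDerivAt.const_mul
    (theta τ (-(1 / 5)) / deriv (theta τ) 0)).fun_div h2 h0).deriv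
  have h3 := deriv_theta_zero_ne_zero hτ
  rw [show levelFun τ = fun z => theta τ (-(1 / 5)) / deriv (theta τ) 0 * theta τ z /
    theta τ (z - 1 / 5) from rfl, h1, theta_zero]
  rw [zero_sub] at h0 ⊢
  field_simp
  ring

/-- The reflection `z ↦ 1/5 - z` exchanges zeros and poles: up to a constant it inverts the
function. -/
theorem levelFun_fifth_sub_mul (z : ℂ) (h1 : z ∉ latticeOf τ) (h2 : z - 1 / 5 ∉ latticeOf τ) :
    levelFun τ (1 / 5 - z) * levelFun τ z =
      (theta τ (-(1 / 5)) / deriv (theta τ) 0) ^ 2 * zetaFive := by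
  rw [← theta_eq_zero_iff hτ] at h1 h2
  have h3 := expTwoPiI_ne_zero z
  rw [levelFun, levelFun, show 1 / 5 - z - 1 / 5 = -z by ring,
    show 1 / 5 - z = -(z - 1 / 5) by ring]
  generalize theta τ (-(1 / 5)) / deriv (theta τ) 0 = κ
  rw [theta_neg, theta_neg, neg_sub, sub_eq_add_neg (1 / 5 : ℂ), expTwoPiI_add, ← zetaFive,
    expTwoPiI_neg]
  generalize theta τ (z - 1 / 5) = B at h2 ⊢
  field_simp

end

/-! ### The functional equation for the function of level five -/

theorem analyticAt_dslope {G : ℂ → ℂ} {z : ℂ} (hG : AnalyticAt ℂ G z) :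
    AnalyticAt ℂ (dslope G z) z := by
  obtain ⟨p, hp⟩ := hG
  exact ⟨_, hp.has_fpower_series_dslope_fslope⟩

section

variable {τ : ℂ} (hτ : 0 < τ.im)
include hτ

theorem analyticAt_inv_levelFun {z : ℂ} (hz : z ∉ latticeOf τ) :
    AnalyticAt ℂ (fun z => (levelFun τ z)⁻¹) z := by
  have h1 : (fun z => (levelFun τ z)⁻¹) = fun z => theta τ (z - 1 / 5) /
      (theta τ (-(1 / 5)) / deriv (theta τ) 0 * theta τ z) := by
    funext z
    rw [levelFun, inv_div]
  rw [h1]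
  refine AnalyticAt.fun_div ((analyticAt_theta hτ _).comp_of_eq (f := fun z : ℂ => z - 1 / 5)
    (by fun_prop) rfl) (analyticAt_const.fun_mul (analyticAt_theta hτ z)) ?_
  rw [← theta_eq_zero_iff hτ] at hz
  exact mul_ne_zero (levelFun_const_ne_zero hτ) hz

/-- The reciprocal has a simple pole with residue `1` at the origin. -/
theorem exists_inv_levelFun_eq : ∃ A : ℂ → ℂ, AnalyticAt ℂ A 0 ∧
    ∀ᶠ z in 𝓝[≠] 0, (levelFun τ z)⁻¹ = z⁻¹ + A z := by
  have hE := analyticAt_dslope (analyticAt_levelFun_zero hτ)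
  have hE0 : dslope (levelFun τ) 0 0 = 1 := by rw [dslope_same, deriv_levelFun_zero hτ]
  have hI := hE.fun_inv (by rw [hE0]; exact one_ne_zero)
  refine ⟨_, analyticAt_dslope hI, ?_⟩
  filter_upwards [self_mem_nhdsWithin] with z hz
  have hz : z ≠ 0 := hz
  rw [dslope_of_ne _ hz, slope_def_field, hE0, dslope_of_ne _ hz, slope_def_field, levelFun_zero]
  field_simp
  ring

/-- As a function of one of the five variables, the left side of the functional equation is
multiplied by fifth roots of unity along the periods, and its poles cancel in pairs. It is therefore
constant by Liouville's theorem; the constant is `0` because the multiplier along `τ` is not `1`. -/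
theorem inv_levelFun_functional_equation_aux (z : Fin 4 → ℂ)
    (hz : ∀ i j, i ≠ j → z j - z i ∉ latticeOf τ) (x : ℂ) (hx : ∀ i, z i - x ∉ latticeOf τ) :
    ∏ j, (levelFun τ (z j - x))⁻¹ + ∑ i, (levelFun τ (x - z i))⁻¹ *
      ∏ j : Fin 3, (levelFun τ (z (i.succAbove j) - z i))⁻¹ = 0 := by
  set h : ℂ → ℂ := fun x => ∏ j, (levelFun τ (z j - x))⁻¹ + ∑ i, (levelFun τ (x - z i))⁻¹ *
      ∏ j : Fin 3, (levelFun τ (z (i.succAbove j) - z i))⁻¹ with hh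
  -- analyticity of the two kinds of factors
  have hA1 : ∀ w y : ℂ, w - y ∉ latticeOf τ →
      AnalyticAt ℂ (fun x => (levelFun τ (w - x))⁻¹) y := fun w y hy =>
    (analyticAt_inv_levelFun hτ hy).comp_of_eq (f := fun x : ℂ => w - x) (by fun_prop) rfl
  have hA2 : ∀ w y : ℂ, y - w ∉ latticeOf τ →
      AnalyticAt ℂ (fun x => (levelFun τ (x - w))⁻¹) y := fun w y hy =>
    (analyticAt_inv_levelFun hτ hy).comp_of_eq (f := fun x : ℂ => x - w) (by fun_prop) rfl
  have hreg : ∀ y, (∀ i, z i - y ∉ latticeOf τ) → AnalyticAt ℂ h y := by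
    intro y hy
    refine AnalyticAt.fun_add (Finset.analyticAt_fun_prod _ fun j _ => hA1 _ _ (hy j))
      (Finset.analyticAt_fun_sum _ fun i _ => AnalyticAt.fun_mul (hA2 _ _ ?_) analyticAt_const)
    rw [← neg_mem_iff, neg_sub]
    exact hy i
  -- the multiplier of `h` along a period is the inverse of the multiplier of `F`
  have hmul : ∀ ω χ, χ ^ 5 = 1 → (∀ y, levelFun τ (y + ω) = χ * levelFun τ y) →
      ∀ y, h (y + ω) = χ⁻¹ * h y := by
    intro ω χ hχ hF y
    have hχ0 : χ ≠ 0 := by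
      rintro rfl
      simp at hχ
    have e1 : ∀ w, (levelFun τ (w - (y + ω)))⁻¹ = χ * (levelFun τ (w - y))⁻¹ := fun w => by
      rw [show w - y = w - (y + ω) + ω by ring, hF, mul_inv, mul_inv_cancel_left₀ hχ0]
    have e2 : ∀ w, (levelFun τ (y + ω - w))⁻¹ = χ⁻¹ * (levelFun τ (y - w))⁻¹ := fun w => by
      rw [show y + ω - w = y - w + ω by ring, hF, mul_inv]
    simp only [hh, e1, e2, Finset.prod_mul_distrib, mul_assoc, ← Finset.mul_sum, mul_add,
      Finset.prod_const, Finset.card_univ, Fintype.card_fin]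
    rw [eq_inv_of_mul_eq_one_left (show χ ^ 4 * χ = 1 by rw [← pow_succ, hχ])]
  -- at `z k` the two polar terms cancel
  have hpole : ∀ k, IsRemovableAt h (z k) := by
    intro k
    obtain ⟨A, hA, e⟩ := exists_inv_levelFun_eq hτ
    set P : ℂ → ℂ := fun x => ∏ j : Fin 3, (levelFun τ (z (k.succAbove j) - x))⁻¹ with hP
    have hPa : AnalyticAt ℂ P (z k) := Finset.analyticAt_fun_prod _ fun j _ =>
      hA1 _ _ (hz _ _ (Fin.succAbove_ne k j).symm)
    refine ⟨fun x => -dslope P (z k) x + A (z k - x) * P x + A (x - z k) * P (z k) +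
      ∑ i : Fin 3, (levelFun τ (x - z (k.succAbove i)))⁻¹ *
        ∏ j : Fin 3, (levelFun τ (z ((k.succAbove i).succAbove j) - z (k.succAbove i)))⁻¹, ?_, ?_⟩
    · have h1 : AnalyticAt ℂ (fun x => A (z k - x)) (z k) :=
        hA.comp_of_eq (f := fun x : ℂ => z k - x) (by fun_prop) (sub_self _)
      have h2 : AnalyticAt ℂ (fun x => A (x - z k)) (z k) :=
        hA.comp_of_eq (f := fun x : ℂ => x - z k) (by fun_prop) (sub_self _)
      exact (((analyticAt_dslope hPa).fun_neg.fun_add (h1.fun_mul hPa)).fun_add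
        (h2.fun_mul analyticAt_const)).fun_add (Finset.analyticAt_fun_sum _ fun i _ =>
          AnalyticAt.fun_mul (hA2 _ _ (hz _ _ (Fin.succAbove_ne k i))) analyticAt_const)
    · have t1 := tendsto_const_sub_nhdsNE (z k) (z k)
      have t2 := tendsto_add_const_nhdsNE (z k) (-z k)
      rw [sub_self] at t1
      rw [add_neg_cancel] at t2
      filter_upwards [t1.eventually e, t2.eventually e, self_mem_nhdsWithin] with x h1 h2 h3
      have h3 : x ≠ z k := h3
      rw [← sub_eq_add_neg] at h2
      simp only [hh]
      rw [Fin.prod_univ_succAbove _ k, Fin.sum_univ_succAbove _ k, h1, h2]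
      change (_ + _) * P x + ((_ + _) * P (z k) + _) = _
      rw [dslope_of_ne _ h3, slope_def_field]
      have h4 : x - z k ≠ 0 := sub_ne_zero.2 h3
      have h5 : (z k - x)⁻¹ = -(x - z k)⁻¹ := by rw [← neg_sub, neg_inv, inv_neg]
      rw [h5]
      field_simp
      ring
  have hrem : ∀ y, IsRemovableAt h y := by
    intro y
    by_cases hy : ∀ i, z i - y ∉ latticeOf τ
    · exact isRemovableAt_of_analyticAt (hreg y hy)
    · push Not at hy
      obtain ⟨k, hk⟩ := hy
      obtain ⟨χ, h1, h2⟩ := exists_levelFun_add hτ hk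
      refine IsRemovableAt.of_add (ω := z k - y) (by simpa using hpole k) ?_ (hmul _ χ h1 h2)
      rintro h0
      rw [inv_eq_zero.1 h0] at h1
      simp at h1
  have hm1 := hmul 1 1 (one_pow 5) fun y => by rw [levelFun_add_one, one_mul]
  have hm2 := hmul τ zetaFive⁻¹
    (by rw [inv_pow, (zetaFive_pow_eq_one_iff 5).2 dvd_rfl, inv_one]) (levelFun_add_tau hτ)
  rw [inv_inv] at hm2
  obtain ⟨c, hc⟩ := exists_const_of_isRemovableAt hτ hrem
    (fun y => by rw [hm1, inv_one, one_mul])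
    (fun y => by rw [hm2, norm_mul, norm_zetaFive, one_mul])
  have hc0 : c = 0 := by
    obtain ⟨y, h1, h2⟩ := ((hc 0).and
      ((tendsto_add_const_nhdsNE 0 τ).eventually (hc (0 + τ)))).exists
    rw [hm2, h1] at h2
    have h3 : zetaFive - 1 ≠ 0 := sub_ne_zero.2 fun h => by
      have := (zetaFive_pow_eq_one_iff 1).1 (by rw [pow_one, h])
      omega
    exact (mul_eq_zero.1 (by linear_combination h2 : (zetaFive - 1) * c = 0)).resolve_left h3
  have h1 := (hreg x hx).continuousAt.tendsto.mono_left (nhdsWithin_le_nhds (s := {x}ᶜ))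
  exact tendsto_nhds_unique h1
    ((tendsto_congr' (hc x)).2 (hc0 ▸ tendsto_const_nhds))

/-- The function of level five satisfies the functional equation with constant `0`. -/
theorem inv_levelFun_functional_equation (z : Fin 5 → ℂ)
    (hz : ∀ i j, i ≠ j → z j - z i ∉ latticeOf τ) :
    ∑ i, ∏ j : Fin 4, (levelFun τ (z (i.succAbove j) - z i))⁻¹ = 0 := by
  have := inv_levelFun_functional_equation_aux hτ (fun i => z i.succ)
    (fun i j hij => hz _ _ ((Fin.succ_injective _).ne hij)) (z 0)
    (fun i => hz _ _ (Fin.succ_ne_zero i).symm)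
  rw [Fin.sum_univ_succ]
  refine Eq.trans (congrArg₂ (· + ·) ?_ (Finset.sum_congr rfl fun i _ => ?_)) this
  · rfl
  · rw [Fin.prod_univ_succ]
    simp only [Fin.succ_succAbove_zero, Fin.succ_succAbove_succ]

end

/-! ### Taylor series at the origin -/

/-- The Taylor series at `0` of a function `ℂ → ℂ`. -/
noncomputable def taylorSeries (G : ℂ → ℂ) : PowerSeries ℂ :=
  PowerSeries.mk fun n => iteratedDeriv n G 0 / n.factorial

theorem coeff_taylorSeries (G : ℂ → ℂ) (n : ℕ) :
    PowerSeries.coeff n (taylorSeries G) = iteratedDeriv n G 0 / n.factorial :=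
  PowerSeries.coeff_mk _ _

theorem isExpansionAtZero_taylorSeries {G : ℂ → ℂ} (hG : AnalyticAt ℂ G 0) :
    IsExpansionAtZero (taylorSeries G) G := by
  simpa only [IsExpansionAtZero, coeff_taylorSeries] using hG.hasFPowerSeriesAt

theorem taylorSeries_congr {G H : ℂ → ℂ} (h : G =ᶠ[𝓝 0] H) : taylorSeries G = taylorSeries H := by
  ext n
  rw [coeff_taylorSeries, coeff_taylorSeries, h.iteratedDeriv_eq]

theorem eventually_eq_zero_of_taylorSeries {G : ℂ → ℂ} (hG : AnalyticAt ℂ G 0)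
    (h : taylorSeries G = 0) : ∀ᶠ z in 𝓝 0, G z = 0 := by
  have h1 := isExpansionAtZero_taylorSeries hG
  rw [h, IsExpansionAtZero] at h1
  filter_upwards [hasFPowerSeriesAt_iff.1 h1] with z hz
  have : HasSum (fun _ : ℕ => (0 : ℂ)) (G (0 + z)) := by
    simpa [FormalMultilinearSeries.coeff_ofScalars] using hz
  simpa using this.unique hasSum_zero

theorem taylorSeries_add {G H : ℂ → ℂ} (hG : AnalyticAt ℂ G 0) (hH : AnalyticAt ℂ H 0) :
    taylorSeries (fun z => G z + H z) = taylorSeries G + taylorSeries H := by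
  ext n
  rw [map_add, coeff_taylorSeries, coeff_taylorSeries, coeff_taylorSeries, ← add_div]
  congr 1
  exact iteratedDeriv_add hG.contDiffAt hH.contDiffAt

theorem taylorSeries_mul {G H : ℂ → ℂ} (hG : AnalyticAt ℂ G 0) (hH : AnalyticAt ℂ H 0) :
    taylorSeries (fun z => G z * H z) = taylorSeries G * taylorSeries H := by
  ext n
  rw [PowerSeries.coeff_mul, coeff_taylorSeries,
    Finset.Nat.sum_antidiagonal_eq_sum_range_succ_mk]
  have h := iteratedDeriv_mul (n := n) (x := (0 : ℂ)) hG.contDiffAt hH.contDiffAt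
  rw [show (fun z => G z * H z) = G * H from rfl, h, Finset.sum_div]
  refine Finset.sum_congr rfl fun i hi => ?_
  rw [coeff_taylorSeries, coeff_taylorSeries,
    Nat.cast_choose ℂ (Nat.lt_succ_iff.1 (Finset.mem_range.1 hi))]
  have h1 : (n.factorial : ℂ) ≠ 0 := Nat.cast_ne_zero.2 n.factorial_ne_zero
  have h2 : (i.factorial : ℂ) ≠ 0 := Nat.cast_ne_zero.2 i.factorial_ne_zero
  have h3 : ((n - i).factorial : ℂ) ≠ 0 := Nat.cast_ne_zero.2 (n - i).factorial_ne_zero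
  field_simp

theorem taylorSeries_const (c : ℂ) : taylorSeries (fun _ => c) = PowerSeries.C c := by
  ext n
  rw [coeff_taylorSeries, iteratedDeriv_const, PowerSeries.coeff_C]
  split_ifs with h <;> simp [h]

theorem taylorSeries_id : taylorSeries (fun z => z) = PowerSeries.X := by
  ext n
  rw [coeff_taylorSeries, PowerSeries.coeff_X]
  rcases n with _ | _ | n
  · simp
  · simp [iteratedDeriv_one]
  · rw [iteratedDeriv_succ', iteratedDeriv_succ']
    simp

theorem taylorSeries_sum {ι : Type*} (s : Finset ι) {G : ι → ℂ → ℂ}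
    (hG : ∀ i ∈ s, AnalyticAt ℂ (G i) 0) :
    taylorSeries (fun z => ∑ i ∈ s, G i z) = ∑ i ∈ s, taylorSeries (G i) := by
  classical
  induction s using Finset.induction_on with
  | empty => simp [taylorSeries_const]
  | insert i s hi ih =>
    simp_rw [Finset.sum_insert hi]
    have h := fun j hj => hG j (Finset.mem_insert_of_mem hj)
    rw [taylorSeries_add (hG i (Finset.mem_insert_self i s)) (Finset.analyticAt_fun_sum s h), ih h]

theorem taylorSeries_prod {ι : Type*} (s : Finset ι) {G : ι → ℂ → ℂ}
    (hG : ∀ i ∈ s, AnalyticAt ℂ (G i) 0) :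
    taylorSeries (fun z => ∏ i ∈ s, G i z) = ∏ i ∈ s, taylorSeries (G i) := by
  classical
  induction s using Finset.induction_on with
  | empty => simp [taylorSeries_const]
  | insert i s hi ih =>
    simp_rw [Finset.prod_insert hi]
    have h := fun j hj => hG j (Finset.mem_insert_of_mem hj)
    rw [taylorSeries_mul (hG i (Finset.mem_insert_self i s)) (Finset.analyticAt_fun_prod s h), ih h]

theorem taylorSeries_deriv (G : ℂ → ℂ) :
    taylorSeries (deriv G) = PowerSeries.derivative ℂ (taylorSeries G) := by
  ext n
  rw [PowerSeries.coeff_derivative, coeff_taylorSeries, coeff_taylorSeries, iteratedDeriv_succ',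
    Nat.factorial_succ]
  have h1 : (n.factorial : ℂ) ≠ 0 := Nat.cast_ne_zero.2 n.factorial_ne_zero
  have h2 : (n + 1 : ℂ) ≠ 0 := by exact_mod_cast n.succ_ne_zero
  push_cast
  field_simp

theorem iteratedDeriv_comp_mul_left (G : ℂ → ℂ) (c : ℂ) (n : ℕ) :
    iteratedDeriv n (fun z => G (c * z)) = fun z => c ^ n * iteratedDeriv n G (c * z) := by
  induction n with
  | zero => simp
  | succ n ih =>
    rw [iteratedDeriv_succ, ih, iteratedDeriv_succ]
    funext z
    rw [deriv_const_mul_field, deriv_comp_mul_left]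
    simp only [smul_eq_mul]
    ring

theorem taylorSeries_comp_mul_left (G : ℂ → ℂ) (c : ℂ) :
    taylorSeries (fun z => G (c * z)) = PowerSeries.rescale c (taylorSeries G) := by
  ext n
  rw [PowerSeries.coeff_rescale, coeff_taylorSeries, coeff_taylorSeries,
    iteratedDeriv_comp_mul_left]
  simp only [mul_zero, mul_div_assoc]

/-- The Taylor series at `0` of the function of level five. -/
noncomputable def levelSeries (τ : ℂ) : PowerSeries ℂ := taylorSeries (levelFun τ)

section

variable {τ : ℂ} (hτ : 0 < τ.im)
include hτ

theorem isNormalized_levelSeries : IsNormalized (levelSeries τ) := by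
  constructor
  · simp [levelSeries, coeff_taylorSeries, levelFun_zero]
  · simp [levelSeries, coeff_taylorSeries, iteratedDeriv_one, deriv_levelFun_zero hτ]

omit hτ in
theorem levelFun_eq_mul_dslope (z : ℂ) : levelFun τ z = z * dslope (levelFun τ) 0 z := by
  have := sub_smul_dslope (levelFun τ) 0 z
  rw [levelFun_zero, sub_zero, sub_zero, smul_eq_mul] at this
  exact this.symm

theorem dslope_levelFun_zero : dslope (levelFun τ) 0 0 = 1 := by
  rw [dslope_same, deriv_levelFun_zero hτ]

theorem analyticAt_dslope_levelFun_inv :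
    AnalyticAt ℂ (fun z => (dslope (levelFun τ) 0 z)⁻¹) 0 :=
  (analyticAt_dslope (analyticAt_levelFun_zero hτ)).fun_inv
    (by rw [dslope_levelFun_zero hτ]; exact one_ne_zero)

theorem eventually_dslope_levelFun_ne_zero : ∀ᶠ z in 𝓝 0, dslope (levelFun τ) 0 z ≠ 0 :=
  (analyticAt_dslope (analyticAt_levelFun_zero hτ)).continuousAt.eventually_ne
    (by rw [dslope_levelFun_zero hτ]; exact one_ne_zero)

/-- The lattice `ℤ + ℤτ` is discrete. -/
theorem eventually_notMem_latticeOf : ∀ᶠ z in 𝓝[≠] 0, z ∉ latticeOf τ := by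
  filter_upwards [(eventually_dslope_levelFun_ne_zero hτ).filter_mono nhdsWithin_le_nhds,
    self_mem_nhdsWithin] with z hz h0 h
  have := (levelFun_eq_zero_iff hτ z).2 (Or.inl h)
  rw [levelFun_eq_mul_dslope] at this
  exact (mul_ne_zero h0 hz) this

theorem taylorSeries_dslope_levelFun_inv :
    taylorSeries (fun z => (dslope (levelFun τ) 0 z)⁻¹) = qSeries (levelSeries τ) := by
  have hf := isNormalized_levelSeries hτ
  have hE := analyticAt_dslope (analyticAt_levelFun_zero hτ)
  have h1 : levelSeries τ = PowerSeries.X * taylorSeries (dslope (levelFun τ) 0) := by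
    rw [levelSeries, ← taylorSeries_id,
      ← taylorSeries_mul (G := fun z => z) analyticAt_id hE]
    exact congrArg _ (funext levelFun_eq_mul_dslope)
  have h2 : taylorSeries (dslope (levelFun τ) 0) *
      taylorSeries (fun z => (dslope (levelFun τ) 0 z)⁻¹) = 1 := by
    rw [← taylorSeries_mul hE (analyticAt_dslope_levelFun_inv hτ),
      ← map_one PowerSeries.C, ← taylorSeries_const]
    refine taylorSeries_congr ?_
    filter_upwards [eventually_dslope_levelFun_ne_zero hτ] with z hz
    exact mul_inv_cancel₀ hz
  have h0 : levelSeries τ ≠ 0 := by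
    intro h
    have := hf.2
    rw [h] at this
    simp at this
  refine mul_left_cancel₀ h0 ?_
  rw [hf.mul_qSeries, h1, mul_assoc, h2, mul_one]

/-- The functional equation along a line: the analytic identity holds at all small `t ≠ 0`, where
the points `a i * t` are pairwise incongruent, hence for the Taylor series. -/
theorem lineSeries_levelSeries (a : Fin 5 → ℂ) (ha : Function.Injective a) :
    lineSeries a (qSeries (levelSeries τ)) = 0 := by
  have hQ := analyticAt_dslope_levelFun_inv hτ
  have hQc : ∀ c : ℂ, AnalyticAt ℂ (fun t => (dslope (levelFun τ) 0 (c * t))⁻¹) 0 := fun c =>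
    hQ.comp_of_eq (f := fun t : ℂ => c * t) (by fun_prop) (mul_zero c)
  set G : ℂ → ℂ := fun t => ∑ i : Fin 5, (∏ j : Fin 4, (a (i.succAbove j) - a i))⁻¹ *
    ∏ j : Fin 4, (dslope (levelFun τ) 0 ((a (i.succAbove j) - a i) * t))⁻¹ with hG
  have hGa : AnalyticAt ℂ G 0 := Finset.analyticAt_fun_sum _ fun i _ =>
    analyticAt_const.fun_mul (Finset.analyticAt_fun_prod _ fun j _ => hQc _)
  have hT : taylorSeries G = lineSeries a (qSeries (levelSeries τ)) := by
    rw [hG, lineSeries, taylorSeries_sum _ fun i _ =>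
      analyticAt_const.fun_mul (Finset.analyticAt_fun_prod _ fun j _ => hQc _)]
    refine Finset.sum_congr rfl fun i _ => ?_
    rw [taylorSeries_mul analyticAt_const (Finset.analyticAt_fun_prod _ fun j _ => hQc _),
      taylorSeries_const, taylorSeries_prod _ fun j _ => hQc _]
    congr 1
    refine Finset.prod_congr rfl fun j _ => ?_
    rw [taylorSeries_comp_mul_left (fun z => (dslope (levelFun τ) 0 z)⁻¹),
      taylorSeries_dslope_levelFun_inv hτ]
  have hsmall : ∀ᶠ t in 𝓝[≠] (0 : ℂ), ∀ i j, i ≠ j → a j * t - a i * t ∉ latticeOf τ := by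
    rw [eventually_all]
    intro i
    rw [eventually_all]
    intro j
    by_cases hij : i = j
    · exact Eventually.of_forall fun t h => absurd hij h
    have hne : a j - a i ≠ 0 := sub_ne_zero.2 fun h => hij (ha h).symm
    have ht : Tendsto (fun t => (a j - a i) * t) (𝓝[≠] 0) (𝓝[≠] 0) := by
      refine tendsto_nhdsWithin_of_tendsto_nhds_of_eventually_within _ ?_
        (eventually_mem_nhdsWithin.mono fun t ht => mul_ne_zero hne ht)
      have : Continuous fun t : ℂ => (a j - a i) * t := by fun_prop
      simpa using (this.tendsto 0).mono_left nhdsWithin_le_nhds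
    filter_upwards [ht.eventually (eventually_notMem_latticeOf hτ)] with t h _
    rwa [← sub_mul]
  have h0 : ∀ᶠ t in 𝓝[≠] (0 : ℂ), G t = 0 := by
    filter_upwards [hsmall, self_mem_nhdsWithin] with t ht ht0
    have ht0 : t ≠ 0 := ht0
    have h := inv_levelFun_functional_equation hτ (fun i => a i * t) ht
    have h1 : t⁻¹ ^ 4 * G t = 0 := by
      rw [← h, hG, Finset.mul_sum]
      refine Finset.sum_congr rfl fun i _ => ?_
      have e : ∀ c, (levelFun τ (c * t))⁻¹ = c⁻¹ * t⁻¹ * (dslope (levelFun τ) 0 (c * t))⁻¹ :=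
        fun c => by rw [levelFun_eq_mul_dslope, mul_inv, mul_inv]
      simp_rw [← sub_mul, e, Finset.prod_mul_distrib, Finset.prod_const, Finset.prod_inv_distrib]
      simp only [Finset.card_univ, Fintype.card_fin]
      ring
    exact (mul_eq_zero.1 h1).resolve_left (pow_ne_zero _ (inv_ne_zero ht0))
  have h1 : ∀ᶠ t in 𝓝 (0 : ℂ), G t = 0 :=
    hGa.frequently_zero_iff_eventually_zero.1 h0.frequently
  rw [← hT, taylorSeries_congr h1, taylorSeries_const, map_zero]

theorem lineRel_levelSeries (a : Fin 5 → ℂ) (ha : Function.Injective a) :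
    LineRel a (logCoeff (levelSeries τ)) :=
  lineRel_logCoeff (isNormalized_levelSeries hτ) (c := 0)
    (by rw [lineSeries_levelSeries hτ a ha, map_zero, zero_mul])

end

/-! ### The differential equation for the function of level five -/

/-- Division by a power of the variable when the first Taylor coefficients vanish. -/
theorem exists_eq_pow_mul_of_taylorSeries (n : ℕ) {G : ℂ → ℂ} (hG : AnalyticAt ℂ G 0)
    (h : ∀ k < n, PowerSeries.coeff k (taylorSeries G) = 0) :
    ∃ K : ℂ → ℂ, AnalyticAt ℂ K 0 ∧ ∀ z, G z = z ^ n * K z := by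
  induction n with
  | zero => exact ⟨G, hG, by simp⟩
  | succ n ih =>
    obtain ⟨K, hK, e⟩ := ih fun k hk => h k (by omega)
    have h1 : taylorSeries G = PowerSeries.X ^ n * taylorSeries K := by
      rw [← taylorSeries_id, funext e, taylorSeries_mul (G := fun z => z ^ n) (by fun_prop) hK]
      have := taylorSeries_prod (Finset.range n) (G := fun _ z => z) fun i _ => analyticAt_id
      simp only [Finset.prod_const, Finset.card_range] at this
      rw [this]
    have h0 : K 0 = 0 := by
      have := h n (by omega)
      rw [h1, PowerSeries.coeff_X_pow_mul', if_pos le_rfl, Nat.sub_self, coeff_taylorSeries] at this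
      simpa using this
    refine ⟨dslope K 0, analyticAt_dslope hK, fun z => ?_⟩
    rw [e, pow_succ, mul_assoc]
    congr 1
    have := sub_smul_dslope K 0 z
    rw [h0, sub_zero, sub_zero, smul_eq_mul] at this
    exact this.symm

theorem deriv_add_period {G : ℂ → ℂ} {ω χ : ℂ} (h : ∀ z, G (z + ω) = χ * G z) (z : ℂ) :
    deriv G (z + ω) = χ * deriv G z := by
  rw [← deriv_comp_add_const, funext h, deriv_const_mul_field]

section

variable {τ : ℂ} (hτ : 0 < τ.im)
include hτ

theorem isOpen_notMem_latticeOf : IsOpen {z | z ∉ latticeOf τ} := by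
  have : {z | z ∉ latticeOf τ} = theta τ ⁻¹' {0}ᶜ := by
    ext z
    simp [theta_eq_zero_iff hτ]
  rw [this]
  exact isOpen_compl_singleton.preimage (differentiable_theta hτ).continuous

/-- The logarithmic derivative is invariant under the reflection that exchanges zeros and poles. -/
theorem logDeriv_levelFun_fifth_sub (z : ℂ) :
    logDeriv (levelFun τ) (1 / 5 - z) = logDeriv (levelFun τ) z := by
  by_cases hz : z ∈ latticeOf τ ∨ z - 1 / 5 ∈ latticeOf τ
  · have h1 := (levelFun_eq_zero_iff hτ z).2 hz
    have h2 := (levelFun_eq_zero_iff hτ (1 / 5 - z)).2 (by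
      rw [← neg_mem_iff, neg_sub, ← neg_mem_iff (x := 1 / 5 - z - 1 / 5), or_comm]
      simpa using hz)
    rw [logDeriv_apply, logDeriv_apply, h1, h2, div_zero, div_zero]
  · push Not at hz
    have hF := mt (levelFun_eq_zero_iff hτ z).1 (by push Not; exact hz)
    set κ := (theta τ (-(1 / 5)) / deriv (theta τ) 0) ^ 2 * zetaFive
    have hκ : κ ≠ 0 := mul_ne_zero (pow_ne_zero 2 (levelFun_const_ne_zero hτ)) zetaFive_ne_zero
    have hopen : ∀ᶠ x in 𝓝 z, x ∉ latticeOf τ ∧ x - 1 / 5 ∉ latticeOf τ := by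
      refine Eventually.and ((isOpen_notMem_latticeOf hτ).mem_nhds hz.1) ?_
      exact ((isOpen_notMem_latticeOf hτ).preimage (continuous_sub_right _)).mem_nhds hz.2
    have e1 : (fun x => levelFun τ (1 / 5 - x)) =ᶠ[𝓝 z] fun x => κ * (levelFun τ x)⁻¹ := by
      filter_upwards [hopen] with x hx
      have := levelFun_fifth_sub_mul hτ x hx.1 hx.2
      have h0 := mt (levelFun_eq_zero_iff hτ x).1 (by push Not; exact hx)
      rw [eq_mul_inv_iff_mul_eq₀ h0, this]
    have e2 := e1.deriv_eq
    rw [deriv_comp_const_sub, deriv_const_mul_field] at e2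
    have e3 := ((analyticAt_levelFun hτ hz.2).differentiableAt.hasDerivAt.fun_inv hF).deriv
    rw [e3] at e2
    have e4 := e1.eq_of_nhds
    rw [logDeriv_apply, logDeriv_apply, e4, neg_eq_iff_eq_neg.1 e2]
    field_simp

omit hτ in
/-- The expression `G² (u'' - 2 u³)` for `u = G' / G`. -/
theorem deriv_deriv_logDeriv_sub {G : ℂ → ℂ} {z : ℂ} (hG : AnalyticAt ℂ G z) (h0 : G z ≠ 0) :
    (deriv (deriv (logDeriv G)) z - 2 * logDeriv G z ^ 3) * G z ^ 2 =
      G z * deriv (deriv (deriv G)) z - 3 * (deriv G z * deriv (deriv G) z) := by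
  have e1 : deriv (logDeriv G) =ᶠ[𝓝 z]
      fun x => (deriv (deriv G) x * G x - deriv G x * deriv G x) / G x ^ 2 := by
    filter_upwards [hG.eventually_analyticAt, hG.continuousAt.eventually_ne h0] with x hx hx0
    exact (hx.deriv.differentiableAt.hasDerivAt.fun_div hx.differentiableAt.hasDerivAt hx0).deriv
  have d0 := hG.differentiableAt.hasDerivAt
  have d1 := hG.deriv.differentiableAt.hasDerivAt
  have d2 := hG.deriv.deriv.differentiableAt.hasDerivAt
  rw [e1.deriv_eq, (((d2.fun_mul d0).fun_sub (d1.fun_mul d1)).fun_div (d0.fun_pow 2)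
    (pow_ne_zero 2 h0)).deriv, logDeriv_apply]
  field_simp
  push_cast
  ring

/-- The function of level five satisfies the differential equation: in terms of `u = F' / F` the
defect `u'' - 2 u³ - 6 p₁ u² - 12 p₂ u - 12 p₃` is elliptic, invariant under `z ↦ 1/5 - z`, and
for suitable `p₁, p₂, p₃` it has a removable zero at the origin. -/
theorem solvesODE_levelSeries : SolvesODE (levelSeries τ) := by
  have hfn := isNormalized_levelSeries hτ
  have hA := analyticAt_levelFun_zero hτ
  have hper0 := fun ω (hω : ω ∈ latticeOf τ) => exists_levelFun_add hτ hω
  have hsym0 := logDeriv_levelFun_fifth_sub hτ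
  have hFa := fun z (hz : z - 1 / 5 ∉ latticeOf τ) => analyticAt_levelFun hτ hz
  have hF0 := levelFun_eq_zero_iff hτ
  have hfF : levelSeries τ = taylorSeries (levelFun τ) := rfl
  have hslope := analyticAt_dslope_levelFun_inv hτ
  have hslope0 := eventually_dslope_levelFun_ne_zero hτ
  have hFs := levelFun_eq_mul_dslope (τ := τ)
  generalize levelSeries τ = f at *
  generalize levelFun τ = F at *
  have hA1 := hA.deriv
  have hA2 := hA1.deriv
  have hA3 := hA2.deriv
  have f1 : taylorSeries (deriv F) = PowerSeries.derivative ℂ f := by rw [taylorSeries_deriv, hfF]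
  have f2 : taylorSeries (deriv (deriv F)) =
      PowerSeries.derivative ℂ (PowerSeries.derivative ℂ f) := by
    rw [taylorSeries_deriv, f1]
  have f3 : taylorSeries (deriv (deriv (deriv F))) =
      PowerSeries.derivative ℂ (PowerSeries.derivative ℂ (PowerSeries.derivative ℂ f)) := by
    rw [taylorSeries_deriv, f2]
  set f' := PowerSeries.derivative ℂ f with hf'
  set r : PowerSeries ℂ := f * PowerSeries.derivative ℂ (PowerSeries.derivative ℂ f') -
    3 * (f' * PowerSeries.derivative ℂ f') with hr
  have hT : ∀ p₁ p₂ p₃ : ℂ, taylorSeries (fun z => F z * deriv (deriv (deriv F)) z +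
      -3 * (deriv F z * deriv (deriv F) z) + (-6 * p₁ * (deriv F z * deriv F z) +
        -12 * p₂ * (F z * deriv F z) + -12 * p₃ * (F z * F z))) =
      r + (PowerSeries.C (-6 * p₁) * (f' * f') + PowerSeries.C (-12 * p₂) * (f * f') +
        PowerSeries.C (-12 * p₃) * (f * f)) := by
    intro p₁ p₂ p₃
    have n3 : (PowerSeries.C (-3 : ℂ) : PowerSeries ℂ) = -3 := by rw [map_neg]; rfl
    rw [taylorSeries_add (by fun_prop) (by fun_prop), taylorSeries_add (by fun_prop) (by fun_prop),
      taylorSeries_add (by fun_prop) (by fun_prop), taylorSeries_add (by fun_prop) (by fun_prop),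
      taylorSeries_mul hA hA3, taylorSeries_mul analyticAt_const (hA1.fun_mul hA2),
      taylorSeries_mul hA1 hA2, taylorSeries_mul analyticAt_const (hA1.fun_mul hA1),
      taylorSeries_mul hA1 hA1, taylorSeries_mul analyticAt_const (hA.fun_mul hA1),
      taylorSeries_mul hA hA1, taylorSeries_mul analyticAt_const (hA.fun_mul hA),
      taylorSeries_mul hA hA]
    simp only [taylorSeries_const, f1, f2, f3, ← hfF, n3]
    rw [hr]
    ring
  -- the coefficients are determined by the terms of order at most two
  obtain ⟨p₁, p₂, p₃, hp⟩ : ∃ p₁ p₂ p₃ : ℂ, ∀ k < 3, PowerSeries.coeff k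
      (r + (PowerSeries.C (-6 * p₁) * (f' * f') + PowerSeries.C (-12 * p₂) * (f * f') +
        PowerSeries.C (-12 * p₃) * (f * f))) = 0 := by
    have g0 : PowerSeries.coeff 0 f = 0 := hfn.1
    have g1 : PowerSeries.coeff 1 f = 1 := hfn.2
    have g0' : PowerSeries.coeff 0 f' = 1 := by
      rw [hf', PowerSeries.coeff_derivative, zero_add, g1]
      simp
    have a0 : PowerSeries.coeff 0 (f' * f') = 1 := by simp [PowerSeries.coeff_mul, g0']
    have b0 : PowerSeries.coeff 0 (f * f') = 0 := by simp [PowerSeries.coeff_mul, g0]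
    have b1 : PowerSeries.coeff 1 (f * f') = 1 := by
      simp [PowerSeries.coeff_mul, Finset.Nat.sum_antidiagonal_eq_sum_range_succ_mk,
        Finset.sum_range_succ, g0, g1, g0', -PowerSeries.coeff_zero_eq_constantCoeff]
    have c0 : PowerSeries.coeff 0 (f * f) = 0 := by simp [PowerSeries.coeff_mul, g0]
    have c1 : PowerSeries.coeff 1 (f * f) = 0 := by
      simp [PowerSeries.coeff_mul, Finset.Nat.sum_antidiagonal_eq_sum_range_succ_mk,
        Finset.sum_range_succ, g0, g1, -PowerSeries.coeff_zero_eq_constantCoeff]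
    have c2 : PowerSeries.coeff 2 (f * f) = 1 := by
      simp [PowerSeries.coeff_mul, Finset.Nat.sum_antidiagonal_eq_sum_range_succ_mk,
        Finset.sum_range_succ, g0, g1, -PowerSeries.coeff_zero_eq_constantCoeff]
    set x := PowerSeries.coeff 0 r / 6 with hx
    set y := (PowerSeries.coeff 1 r - 6 * x * PowerSeries.coeff 1 (f' * f')) / 12 with hy
    refine ⟨x, y, (PowerSeries.coeff 2 r - 6 * x * PowerSeries.coeff 2 (f' * f') -
      12 * y * PowerSeries.coeff 2 (f * f')) / 12, fun k hk => ?_⟩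
    simp only [map_add, PowerSeries.coeff_C_mul]
    interval_cases k
    · rw [a0, b0, c0, hx]
      ring
    · rw [b1, c1, hy]
      ring
    · rw [c2]
      ring
  rw [← hT] at hp
  set E : ℂ → ℂ := fun z => F z * deriv (deriv (deriv F)) z +
      -3 * (deriv F z * deriv (deriv F) z) + (-6 * p₁ * (deriv F z * deriv F z) +
        -12 * p₂ * (F z * deriv F z) + -12 * p₃ * (F z * F z)) with hE
  have hEa : AnalyticAt ℂ E 0 := by fun_prop
  obtain ⟨K, hK, hEK⟩ := exists_eq_pow_mul_of_taylorSeries 3 hEa hp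
  set u := logDeriv F with hu
  set D : ℂ → ℂ := fun z => deriv (deriv u) z - 2 * u z ^ 3 - 6 * p₁ * u z ^ 2 - 12 * p₂ * u z
    - 12 * p₃ with hDdef
  have hua : ∀ z, z ∉ latticeOf τ → z - 1 / 5 ∉ latticeOf τ → AnalyticAt ℂ u z := by
    intro z h1 h2
    have := hFa z h2
    exact this.deriv.div this (mt (hF0 z).1 (by push Not; exact ⟨h1, h2⟩))
  have hDa : ∀ z, z ∉ latticeOf τ → z - 1 / 5 ∉ latticeOf τ → AnalyticAt ℂ D z := by
    intro z h1 h2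
    have h := hua z h1 h2
    have h' := h.deriv.deriv
    fun_prop
  have hDE : ∀ᶠ z in 𝓝[≠] 0, D z * F z ^ 2 = E z ∧ F z ≠ 0 := by
    filter_upwards [hA.eventually_analyticAt.filter_mono nhdsWithin_le_nhds,
      hslope0.filter_mono nhdsWithin_le_nhds, self_mem_nhdsWithin] with z h1 h2 h3
    have h4 : F z ≠ 0 := by
      rw [hFs]
      exact mul_ne_zero h3 h2
    refine ⟨?_, h4⟩
    have h5 := deriv_deriv_logDeriv_sub h1 h4
    have h6 : u z * F z = deriv F z := by rw [hu, logDeriv_apply, div_mul_cancel₀ _ h4]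
    simp only [hDdef, hE]
    linear_combination h5 - 6 * p₁ * (u z * F z + deriv F z) * h6 - 12 * p₂ * F z * h6
  have hDK : ∀ᶠ z in 𝓝[≠] 0, D z = z * (K z * (dslope F 0 z)⁻¹ ^ 2) := by
    filter_upwards [hDE, self_mem_nhdsWithin] with z h1 h3
    have h3 : z ≠ 0 := h3
    obtain ⟨h1, h4⟩ := h1
    rw [hEK, hFs] at h1
    rw [hFs] at h4
    have h2 := right_ne_zero_of_mul h4
    field_simp
    apply mul_left_cancel₀ (pow_ne_zero 2 h3)
    linear_combination h1
  have hD0 : IsRemovableAt D 0 := by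
    exact ⟨_, analyticAt_id.fun_mul (hK.fun_mul (hslope.fun_pow 2)), hDK⟩
  have hsym : ∀ z, D (1 / 5 - z) = D z := by
    have h1 : ∀ z, deriv u (1 / 5 - z) = -deriv u z := fun z => by
      have := deriv_comp_const_sub u (1 / 5) z
      rw [funext hsym0] at this
      rw [this, neg_neg]
    have h2 : ∀ z, deriv (deriv u) (1 / 5 - z) = deriv (deriv u) z := fun z => by
      have := deriv_comp_const_sub (deriv u) (1 / 5) z
      rw [funext h1, deriv.fun_neg, neg_inj] at this
      exact this.symm
    intro z
    simp only [hDdef, h2, hsym0]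
  have hper : ∀ ω ∈ latticeOf τ, ∀ z, D (z + ω) = D z := by
    intro ω hω
    obtain ⟨χ, h1, h2⟩  := hper0 ω hω
    have hχ : χ ≠ 0 := by
      rintro rfl
      simp at h1
    have h3 : ∀ z, u (z + ω) = 1 * u z := fun z => by
      rw [hu, logDeriv_apply, logDeriv_apply, deriv_add_period h2, h2, mul_div_mul_left _ _ hχ,
        one_mul]
    have h4 := deriv_add_period (deriv_add_period h3)
    intro z
    simp only [hDdef, h4, h3, one_mul]
  have hrem : ∀ z, IsRemovableAt D z := by
    have hlat : ∀ z ∈ latticeOf τ, IsRemovableAt D z := fun z hz =>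
      IsRemovableAt.of_add (ω := -z) (by simpa using hD0) one_ne_zero fun x => by
        rw [one_mul, hper _ (neg_mem hz)]
    intro z
    by_cases h1 : z ∈ latticeOf τ
    · exact hlat z h1
    by_cases h2 : z - 1 / 5 ∈ latticeOf τ
    · exact IsRemovableAt.of_const_sub (hlat _ (by rwa [← neg_mem_iff, neg_sub])) hsym
    · exact isRemovableAt_of_analyticAt (hDa z h1 h2)
  obtain ⟨c, hc⟩ := exists_const_of_isRemovableAt hτ hrem
    (fun z => by rw [hper 1 (AddSubgroup.subset_closure (by simp))])
    (fun z => by rw [hper τ (AddSubgroup.subset_closure (by simp))])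
  have hc0 : c = 0 := by
    have t1 : Tendsto D (𝓝[≠] 0) (𝓝 (0 * (K 0 * (dslope F 0 0)⁻¹ ^ 2))) :=
      (tendsto_congr' hDK).2 ((analyticAt_id.fun_mul (hK.fun_mul
        (hslope.fun_pow 2))).continuousAt.tendsto.mono_left nhdsWithin_le_nhds)
    rw [zero_mul] at t1
    exact tendsto_nhds_unique ((tendsto_congr' (hc 0)).2 tendsto_const_nhds) t1
  have hE0 : ∀ᶠ z in 𝓝 0, E z = 0 := by
    refine hEa.frequently_zero_iff_eventually_zero.1 (Eventually.frequently ?_)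
    filter_upwards [hDE, hc 0] with z h1 h2
    rw [← h1.1, h2, hc0, zero_mul]
  refine ⟨p₁, p₂, p₃, ?_⟩
  have hs := hT p₁ p₂ p₃
  rw [taylorSeries_congr hE0, taylorSeries_const, map_zero] at hs
  simp only [Function.iterate_succ, Function.iterate_zero, Function.comp, id,
    PowerSeries.smul_eq_C_mul]
  simp only [neg_mul, map_neg] at hs
  linear_combination -hs

end

/-! ### Comparison of the functions of level five -/

theorem injective_01235 : Function.Injective (![0, 1, 2, 3, 5] : Fin 5 → ℂ) := by
  have h : (![0, 1, 2, 3, 5] : Fin 5 → ℂ) = fun i => ((![0, 1, 2, 3, 5] : Fin 5 → ℕ) i : ℂ) := by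
    ext i
    fin_cases i <;> simp
  rw [h]
  exact Nat.cast_injective.comp (by decide)

theorem injective_01236 : Function.Injective (![0, 1, 2, 3, 6] : Fin 5 → ℂ) := by
  have h : (![0, 1, 2, 3, 6] : Fin 5 → ℂ) = fun i => ((![0, 1, 2, 3, 6] : Fin 5 → ℕ) i : ℂ) := by
    ext i
    fin_cases i <;> simp
  rw [h]
  exact Nat.cast_injective.comp (by decide)

theorem injective_01245 : Function.Injective (![0, 1, 2, 4, 5] : Fin 5 → ℂ) := by
  have h : (![0, 1, 2, 4, 5] : Fin 5 → ℂ) = fun i => ((![0, 1, 2, 4, 5] : Fin 5 → ℕ) i : ℂ) := by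
    ext i
    fin_cases i <;> simp
  rw [h]
  exact Nat.cast_injective.comp (by decide)

/-- The values `1/5 + ω` at which the function of level five has its poles do not disconnect
the plane. -/
theorem isPreconnected_notMem_latticeOf (τ : ℂ) : IsPreconnected {z | z - 1 / 5 ∉ latticeOf τ} := by
  have hc : (latticeOf τ : Set ℂ).Countable := by
    refine (Set.countable_range fun p : ℤ × ℤ => (p.1 : ℂ) + p.2 * τ).mono fun z hz => ?_
    obtain ⟨m, n, h⟩ := mem_latticeOf.1 hz
    exact ⟨(m, n), h⟩
  have h2 : ((fun z : ℂ => z - 1 / 5) ⁻¹' (latticeOf τ : Set ℂ)).Countable :=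
    hc.preimage (sub_left_injective)
  exact (h2.isConnected_compl_of_one_lt_rank (by simp [Complex.rank_real_complex])).isPreconnected

section

variable {τ : ℂ} (hτ : 0 < τ.im)
include hτ

theorem tau_sub_fifth_notMem : τ - 1 / 5 ∉ latticeOf τ := by
  have h : τ ∈ latticeOf τ := AddSubgroup.subset_closure (by simp)
  rw [sub_eq_add_neg, AddSubgroup.add_mem_cancel_left _ h, neg_mem_iff]
  exact fifth_notMem_latticeOf hτ

/-- A Riccati equation would force `F'(τ) = F'(0)`. -/
theorem not_riccati_levelSeries (s p : ℂ) :
    PowerSeries.derivative ℂ (levelSeries τ) ≠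
      1 + PowerSeries.C s * levelSeries τ + PowerSeries.C p * levelSeries τ ^ 2 := by
  intro h
  have hA := analyticAt_levelFun_zero hτ
  set H : ℂ → ℂ := fun z => deriv (levelFun τ) z +
    (-1 + (-s * levelFun τ z + -p * (levelFun τ z * levelFun τ z))) with hH
  have hHa : AnalyticOnNhd ℂ H {z | z - 1 / 5 ∉ latticeOf τ} := by
    intro z hz
    have h1 := analyticAt_levelFun hτ hz
    have h2 := h1.deriv
    fun_prop
  have hT : taylorSeries H = 0 := by
    have h2 := hA.deriv
    rw [hH, taylorSeries_add (by fun_prop) (by fun_prop), taylorSeries_add (by fun_prop)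
      (by fun_prop), taylorSeries_add (by fun_prop) (by fun_prop),
      taylorSeries_mul analyticAt_const hA, taylorSeries_mul analyticAt_const (hA.fun_mul hA),
      taylorSeries_mul hA hA, taylorSeries_deriv,
      show taylorSeries (levelFun τ) = levelSeries τ from rfl, h]
    simp only [taylorSeries_const, map_neg, map_one]
    ring
  have h1 := eventually_eq_zero_of_taylorSeries (hHa 0 (zero_sub_fifth_notMem hτ)) hT
  have h2 := hHa.eqOn_zero_of_preconnected_of_eventuallyEq_zero
    (isPreconnected_notMem_latticeOf τ) (zero_sub_fifth_notMem hτ) h1 (tau_sub_fifth_notMem hτ)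
  have h3 : levelFun τ τ = 0 := by
    have := levelFun_add_tau hτ 0
    rwa [zero_add, levelFun_zero, mul_zero] at this
  have h4 : deriv (levelFun τ) τ = zetaFive⁻¹ := by
    have := deriv_add_period (levelFun_add_tau hτ) 0
    rwa [zero_add, deriv_levelFun_zero hτ, mul_one] at this
  simp only [hH, h3, h4, Pi.zero_apply] at h2
  have h5 : zetaFive⁻¹ = 1 := by linear_combination h2
  have := (zetaFive_pow_eq_one_iff 1).1 (by rw [pow_one, inv_eq_one.1 h5])
  omega

/-- The parameters of the function of level five lie on the elliptic surface: the Todd surface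
consists of solutions of Riccati equations, which the function does not satisfy. -/
theorem components_levelSeries :
    logCoeff (levelSeries τ) 5 = -(logCoeff (levelSeries τ) 2 * logCoeff (levelSeries τ) 3) ∧
    IsEllipticPoint (logCoeff (levelSeries τ) 1) (logCoeff (levelSeries τ) 2)
      (logCoeff (levelSeries τ) 3) (logCoeff (levelSeries τ) 4) := by
  have hA := lineRel_levelSeries hτ ![0, 1, 2, 3, 5] injective_01235
  obtain ⟨h5, h⟩ := components_of_lineRel hA
    (lineRel_levelSeries hτ ![0, 1, 2, 3, 6] injective_01236)
    (lineRel_levelSeries hτ ![0, 1, 2, 4, 5] injective_01245)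
  refine ⟨h5, h.resolve_left fun hT => ?_⟩
  obtain ⟨s, p, e⟩ := riccati_of_isToddPoint (isNormalized_levelSeries hτ) hA h5 hT
  exact not_riccati_levelSeries hτ s p e

end

end HirzebruchFE

namespace HirzebruchFE

open PowerSeries

/-! ### Homotheties -/

/-- The series `μ⁻¹ f(μz)`. -/
noncomputable def scaleSeries (μ : ℂ) (f : PowerSeries ℂ) : PowerSeries ℂ :=
  C μ⁻¹ * rescale μ f

theorem derivative_rescale (μ : ℂ) (f : PowerSeries ℂ) :
    d⁄dX ℂ (rescale μ f) = C μ * rescale μ (d⁄dX ℂ f) := by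
  ext n
  simp only [coeff_derivative, coeff_rescale, coeff_C_mul]
  ring

section

variable {μ : ℂ} (hμ : μ ≠ 0) {f : PowerSeries ℂ}
include hμ

theorem C_inv_mul_C : (C μ⁻¹ : PowerSeries ℂ) * C μ = 1 := by
  rw [← map_mul, inv_mul_cancel₀ hμ, map_one]

theorem IsNormalized.scaleSeries (hf : IsNormalized f) : IsNormalized (scaleSeries μ f) := by
  refine ⟨?_, ?_⟩
  · rw [HirzebruchFE.scaleSeries, coeff_C_mul, coeff_rescale, hf.1, mul_zero, mul_zero]
  · rw [HirzebruchFE.scaleSeries, coeff_C_mul, coeff_rescale, hf.2, pow_one, mul_one,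
      inv_mul_cancel₀ hμ]

theorem SolvesODE.scaleSeries (hf : SolvesODE f) : SolvesODE (scaleSeries μ f) := by
  obtain ⟨p₁, p₂, p₃, h⟩ := hf
  refine ⟨μ * p₁, μ ^ 2 * p₂, μ ^ 3 * p₃, ?_⟩
  simp only [Function.iterate_succ, Function.iterate_zero, Function.comp, id, smul_eq_C_mul] at h ⊢
  have h' := congrArg (rescale μ) h
  have hC := C_inv_mul_C hμ
  have d : ∀ g : PowerSeries ℂ, d⁄dX ℂ (C μ⁻¹ * rescale μ g) = rescale μ (d⁄dX ℂ g) := fun g => by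
    rw [Derivation.leibniz, derivative_C, smul_zero, add_zero, smul_eq_mul, derivative_rescale,
      ← mul_assoc, hC, one_mul]
  have r : ∀ x, rescale μ (C x) = C x := fun x => by
    ext n
    rw [coeff_rescale, coeff_C]
    split_ifs with h <;> simp [h]
  have r3 : rescale μ (3 : PowerSeries ℂ) = 3 := map_ofNat _ _
  simp only [map_sub, map_mul, map_add, map_pow, r, r3] at h'
  rw [HirzebruchFE.scaleSeries, d, derivative_rescale, Derivation.leibniz, derivative_C, smul_zero,
    add_zero, smul_eq_mul, derivative_rescale]
  simp only [map_mul, map_pow] at h' ⊢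
  linear_combination C μ * h' + (C μ * rescale μ f * rescale μ (d⁄dX ℂ (d⁄dX ℂ (d⁄dX ℂ f))) -
    C 12 * C p₂ * C μ * rescale μ f * rescale μ (d⁄dX ℂ f) -
    C 12 * C p₃ * C μ * (C μ⁻¹ * C μ + 1) * rescale μ f ^ 2) * hC

theorem qSeries_scaleSeries (hf : IsNormalized f) :
    qSeries (scaleSeries μ f) = rescale μ (qSeries f) := by
  have h := hf.scaleSeries hμ
  have h0 : HirzebruchFE.scaleSeries μ f ≠ 0 := fun e => by
    have := h.2
    simp [e] at this
  refine mul_left_cancel₀ h0 ?_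
  rw [h.mul_qSeries, HirzebruchFE.scaleSeries, mul_assoc, ← map_mul, hf.mul_qSeries]
  ext n
  rw [coeff_C_mul, coeff_rescale, coeff_X]
  split_ifs with h <;> simp [h, hμ]

theorem logCoeff_scaleSeries (hf : IsNormalized f) (k : ℕ) :
    logCoeff (scaleSeries μ f) k = μ ^ k * logCoeff f k := by
  rw [logCoeff, logCoeff, qSeries_scaleSeries hμ hf, ← coeff_rescale]
  congr 1
  have h0 := hf.coeff_zero_qSeries
  have h1 : coeff 0 (rescale μ (qSeries f)) = 1 := by rw [coeff_rescale, h0, pow_zero, one_mul]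
  have h2 : rescale μ (qSeries f) ≠ 0 := fun e => by simp [e] at h1
  refine mul_right_cancel₀ h2 ?_
  rw [logSeries_mul h1, X_mul_derivative_rescale, ← logSeries_mul h0, map_mul]

theorem lineSeries_scaleSeries (hf : IsNormalized f) {a : Fin 5 → ℂ}
    (h : lineSeries a (qSeries f) = 0) : lineSeries a (qSeries (scaleSeries μ f)) = 0 := by
  have e := congrArg (rescale μ) h
  rw [qSeries_scaleSeries hμ hf, ← e.trans (map_zero _), lineSeries, lineSeries, map_sum]
  refine Finset.sum_congr rfl fun i _ => ?_
  rw [map_mul, map_prod]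
  congr 1
  · ext n
    rw [coeff_rescale, coeff_C]
    split_ifs with h <;> simp [h]
  · refine Finset.prod_congr rfl fun j _ => ?_
    rw [rescale_rescale, rescale_rescale, mul_comm]

end

end HirzebruchFE

namespace HirzebruchFE

open Complex Filter Topology

/-! ### Elliptic functions of level five -/

section

variable {τ : ℂ} (hτ : 0 < τ.im)
include hτ

theorem sub_fifth_notMem_of_mem {z : ℂ} (hz : z ∈ latticeOf τ) : z - 1 / 5 ∉ latticeOf τ := by
  rw [sub_eq_add_neg, AddSubgroup.add_mem_cancel_left _ hz, neg_mem_iff]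
  exact fifth_notMem_latticeOf hτ

/-- The zeros of the theta function are simple. -/
theorem deriv_theta_ne_zero {ω : ℂ} (hω : ω ∈ latticeOf τ) : deriv (theta τ) ω ≠ 0 := by
  have hω' := sub_fifth_notMem_of_mem hτ hω
  have hB : theta τ (ω - 1 / 5) ≠ 0 := by rwa [Ne, theta_eq_zero_iff hτ]
  set κ := theta τ (-(1 / 5)) / deriv (theta τ) 0 with hκdef
  have hκ : κ ≠ 0 := levelFun_const_ne_zero hτ
  have hd : deriv (levelFun τ) ω ≠ 0 := by
    obtain ⟨χ, h1, h2⟩ := exists_levelFun_add hτ hω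
    have := deriv_add_period h2 0
    rw [zero_add, deriv_levelFun_zero hτ, mul_one] at this
    rw [this]
    rintro rfl
    simp at h1
  intro h0
  have h1 := (((differentiable_theta hτ ω).hasDerivAt.const_mul κ).fun_div
    (HasDerivAt.comp_sub_const ω (1 / 5) (differentiable_theta hτ _).hasDerivAt) hB).deriv
  rw [h0, (theta_eq_zero_iff hτ ω).2 hω] at h1
  refine hd (Eq.trans ?_ (h1.trans (by simp)))
  rfl

open Classical in
theorem meromorphicOrderAt_theta (z : ℂ) :
    meromorphicOrderAt (theta τ) z = ((if z ∈ latticeOf τ then 1 else 0 : ℤ) : WithTop ℤ) := by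
  have ha := analyticAt_theta hτ z
  rw [ha.meromorphicOrderAt_eq]
  split_ifs with hz
  · rw [ha.analyticOrderAt_eq_one_of_zero_deriv_ne_zero ((theta_eq_zero_iff hτ z).2 hz)
      (deriv_theta_ne_zero hτ hz)]
    rfl
  · rw [ha.analyticOrderAt_eq_zero.2 (mt (theta_eq_zero_iff hτ z).1 hz)]
    rfl

/-- The function `μ⁻¹ F(μz)`. -/
noncomputable def scaledLevelFun (τ μ z : ℂ) : ℂ := μ⁻¹ * levelFun τ (μ * z)

omit hτ in
theorem scaledLevelFun_eq_div (τ μ : ℂ) : scaledLevelFun τ μ =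
    (fun z => μ⁻¹ * (theta τ (-(1 / 5)) / deriv (theta τ) 0) * theta τ (μ * z)) /
      fun z => theta τ (μ * z - 1 / 5) := by
  funext z
  rw [scaledLevelFun, levelFun, Pi.div_apply]
  ring

variable {μ : ℂ} (hμ : μ ≠ 0)
include hμ

theorem meromorphicNFAt_scaledLevelFun (z : ℂ) : MeromorphicNFAt (scaledLevelFun τ μ) z := by
  have h1 := differentiable_theta hτ
  rw [scaledLevelFun_eq_div]
  refine MeromorphicNFOn.div ?_ (AnalyticAt.meromorphicNFAt ?_) ?_
  · exact (Differentiable.analyticAt ((h1.comp (differentiable_id.const_mul μ)).const_mul _) z)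
  · exact (Differentiable.analyticAt
      (h1.comp ((differentiable_id.const_mul μ).sub_const (1 / 5))) z)
  · by_contra! h
    obtain ⟨h2, h3⟩ := h
    rw [theta_eq_zero_iff hτ] at h2
    have h4 := (mul_eq_zero.1 h3).resolve_left
      (mul_ne_zero (inv_ne_zero hμ) (levelFun_const_ne_zero hτ))
    rw [theta_eq_zero_iff hτ] at h4
    exact sub_fifth_notMem_of_mem hτ h4 h2

open Classical in
theorem meromorphicOrderAt_scaledLevelFun (z : ℂ) : meromorphicOrderAt (scaledLevelFun τ μ) z =
    (((if μ * z ∈ latticeOf τ then 1 else 0) -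
      (if μ * z - 1 / 5 ∈ latticeOf τ then 1 else 0) : ℤ) : WithTop ℤ) := by
  have h1 := differentiable_theta hτ
  have hcomp : ∀ g : ℂ → ℂ, AnalyticAt ℂ g z → deriv g z = μ →
      meromorphicOrderAt (fun x => theta τ (g x)) z =
        ((if g z ∈ latticeOf τ then 1 else 0 : ℤ) : WithTop ℤ) := fun g hg hd => by
    rw [← meromorphicOrderAt_theta hτ]
    exact meromorphicOrderAt_comp_of_deriv_ne_zero (f := theta τ) hg (by rwa [hd])
  rw [scaledLevelFun_eq_div, meromorphicOrderAt_div]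
  · rw [hcomp (fun x => μ * x - 1 / 5) (by fun_prop) (by simp),
      show (fun x => μ⁻¹ * (theta τ (-(1 / 5)) / deriv (theta τ) 0) * theta τ (μ * x)) =
        (fun _ => μ⁻¹ * (theta τ (-(1 / 5)) / deriv (theta τ) 0)) * fun x => theta τ (μ * x) from
        rfl, meromorphicOrderAt_mul_of_ne_zero analyticAt_const
        (mul_ne_zero (inv_ne_zero hμ) (levelFun_const_ne_zero hτ)),
      hcomp (fun x => μ * x) (by fun_prop) (by simp)]
    rfl
  · exact (Differentiable.analyticAt
      ((h1.comp (differentiable_id.const_mul μ)).const_mul _) z).meromorphicAt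
  · exact (Differentiable.analyticAt
      (h1.comp ((differentiable_id.const_mul μ).sub_const (1 / 5))) z).meromorphicAt

omit hτ hμ in
theorem scaledLevelFun_zero : scaledLevelFun τ μ 0 = 0 := by
  rw [scaledLevelFun, mul_zero, levelFun_zero, mul_zero]

theorem deriv_scaledLevelFun_zero : deriv (scaledLevelFun τ μ) 0 = 1 := by
  unfold scaledLevelFun
  rw [deriv_const_mul_field, deriv_comp_mul_left, mul_zero, deriv_levelFun_zero hτ, smul_eq_mul,
    mul_one, inv_mul_cancel₀ hμ]

/-- The lattice `μ⁻¹ (ℤ + ℤτ)`. -/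
noncomputable def scaledPeriodPair : PeriodPair where
  ω₁ := μ⁻¹
  ω₂ := μ⁻¹ * τ
  indep := by
    rw [LinearIndependent.pair_iff' (inv_ne_zero hμ)]
    intro a ha
    rw [Complex.real_smul, mul_comm] at ha
    have h := mul_left_cancel₀ (inv_ne_zero hμ) ha
    rw [← h, Complex.ofReal_im] at hτ
    exact lt_irrefl _ hτ

theorem mem_scaledPeriodPair_lattice {z : ℂ} :
    z ∈ (scaledPeriodPair hτ hμ).lattice ↔ μ * z ∈ latticeOf τ := by
  rw [PeriodPair.mem_lattice, mem_latticeOf]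
  refine exists_congr fun m => exists_congr fun n => ?_
  change (m : ℂ) * μ⁻¹ + n * (μ⁻¹ * τ) = z ↔ _
  constructor
  · rintro rfl
    field_simp
  · intro h
    apply mul_left_cancel₀ hμ
    rw [← h]
    field_simp

/-- The rescaled functions are elliptic functions of level five. -/
theorem isEllipticOfLevel_scaledLevelFun : IsEllipticOfLevel 5 (scaledLevelFun τ μ) := by
  classical
  refine ⟨fun z _ => meromorphicNFAt_scaledLevelFun hτ hμ z, scaledLevelFun_zero,
    deriv_scaledLevelFun_zero hτ hμ, ⟨by norm_num, scaledPeriodPair hτ hμ, μ⁻¹ * (1 / 5), ?_⟩, ?_⟩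
  · refine ⟨fun z _ => ?_, fun w hw z => ?_, fun z => ?_⟩
    · exact_mod_cast (meromorphicNFAt_scaledLevelFun hτ hμ z).fun_zpow (n := 5)
    · rw [mem_scaledPeriodPair_lattice] at hw
      obtain ⟨χ, h1, h2⟩ := exists_levelFun_add hτ hw
      simp only [scaledLevelFun, mul_add, h2, mul_pow, h1, one_mul]
    · rw [fun_meromorphicOrderAt_pow (meromorphicNFAt_scaledLevelFun hτ hμ z).meromorphicAt,
        meromorphicOrderAt_scaledLevelFun hτ hμ]
      simp only [mem_scaledPeriodPair_lattice, mul_sub, mul_inv_cancel_left₀ hμ]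
      split_ifs <;> rfl
  · rintro M ⟨hM, L, ρ, h⟩
    -- the zeros of `G ^ M` are periods, so that the multiplier along `μ⁻¹ τ` has order dividing `M`
    have hmem : ∀ z, μ * z ∈ latticeOf τ → z ∈ L.lattice := by
      intro z hz
      have h1 := h.divisor z
      rw [fun_meromorphicOrderAt_pow (meromorphicNFAt_scaledLevelFun hτ hμ z).meromorphicAt,
        meromorphicOrderAt_scaledLevelFun hτ hμ, if_pos hz,
        if_neg (sub_fifth_notMem_of_mem hτ hz)] at h1
      by_contra hzL
      rw [if_neg hzL] at h1
      have h2 : ((M * (1 - 0) : ℤ) : WithTop ℤ) =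
        ((0 - (if z - ρ ∈ L.lattice then (M : ℤ) else 0) : ℤ) : WithTop ℤ) := by
        rw [← h1]
        rfl
      have h3 := WithTop.coe_injective h2
      split_ifs at h3 <;> omega
    have hper := h.periodic (μ⁻¹ * τ) (hmem _ (by
      rw [mul_inv_cancel_left₀ hμ]
      exact AddSubgroup.subset_closure (by simp)))
    obtain ⟨z, hz⟩ : ∃ z, levelFun τ z ≠ 0 := by
      by_contra! h0
      have := deriv_levelFun_zero hτ
      rw [funext h0, deriv_const] at this
      exact zero_ne_one this
    have h1 := hper (μ⁻¹ * z)
    simp only [scaledLevelFun, mul_add, mul_inv_cancel_left₀ hμ, levelFun_add_tau hτ, mul_pow] at h1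
    have h2 : (zetaFive⁻¹) ^ M = 1 := by
      have h3 : (μ⁻¹) ^ M * levelFun τ z ^ M ≠ 0 :=
        mul_ne_zero (pow_ne_zero _ (inv_ne_zero hμ)) (pow_ne_zero _ hz)
      apply mul_right_cancel₀ h3
      linear_combination h1
    rw [inv_pow, inv_eq_one, zetaFive_pow_eq_one_iff] at h2
    exact Nat.le_of_dvd hM h2

omit hμ in
theorem isExpansionAtZero_scaleSeries :
    IsExpansionAtZero (scaleSeries μ (levelSeries τ)) (scaledLevelFun τ μ) := by
  have hA := analyticAt_levelFun_zero hτ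
  have h1 : AnalyticAt ℂ (fun z => levelFun τ (μ * z)) 0 :=
    hA.comp_of_eq (f := fun z : ℂ => μ * z) (by fun_prop) (mul_zero μ)
  have h2 : scaleSeries μ (levelSeries τ) = taylorSeries (scaledLevelFun τ μ) := by
    unfold scaledLevelFun
    rw [taylorSeries_mul analyticAt_const h1, taylorSeries_const, taylorSeries_comp_mul_left]
    rfl
  rw [h2]
  exact isExpansionAtZero_taylorSeries (analyticAt_const.fun_mul h1)

theorem params_scaleSeries_mem_ellipticParams :
    params (scaleSeries μ (levelSeries τ)) ∈ ellipticParams 5 :=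
  ⟨_, (isNormalized_levelSeries hτ).scaleSeries hμ, (solvesODE_levelSeries hτ).scaleSeries hμ, rfl,
    _, isEllipticOfLevel_scaledLevelFun hτ hμ, isExpansionAtZero_scaleSeries hτ⟩

end

/-! ### Homothetic functions of level five -/

/-- If two of the functions of level five agree near the origin up to a homothety, then the
homothety carries the lattice of the first into that of the second. -/
theorem mul_mem_latticeOf_of_eventuallyEq {τ τ' μ : ℂ} (hτ : 0 < τ.im) (hτ' : 0 < τ'.im)
    (hμ : μ ≠ 0) (h : levelFun τ' =ᶠ[𝓝 0] scaledLevelFun τ μ) {ω : ℂ} (hω : ω ∈ latticeOf τ') :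
    μ * ω ∈ latticeOf τ := by
  have h1 := differentiable_theta hτ
  have h2 := differentiable_theta hτ'
  set κ := theta τ (-(1 / 5)) / deriv (theta τ) 0 with hκ
  set κ' := theta τ' (-(1 / 5)) / deriv (theta τ') 0 with hκ'
  have hB : ∀ᶠ z in 𝓝 0, theta τ (μ * z - 1 / 5) ≠ 0 := by
    have hc : Continuous fun z => theta τ (μ * z - 1 / 5) :=
      h1.continuous.comp (by fun_prop)
    refine hc.continuousAt.eventually_ne ?_
    rw [mul_zero, Ne, theta_eq_zero_iff hτ]
    exact zero_sub_fifth_notMem hτ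
  have hB' : ∀ᶠ z in 𝓝 0, theta τ' (z - 1 / 5) ≠ 0 := by
    have hc : Continuous fun z => theta τ' (z - 1 / 5) := h2.continuous.comp (by fun_prop)
    refine hc.continuousAt.eventually_ne ?_
    rw [Ne, theta_eq_zero_iff hτ']
    exact zero_sub_fifth_notMem hτ'
  have e : (fun z => κ' * theta τ' z * theta τ (μ * z - 1 / 5)) =ᶠ[𝓝 0]
      fun z => μ⁻¹ * κ * theta τ (μ * z) * theta τ' (z - 1 / 5) := by
    filter_upwards [h, hB, hB'] with z h3 h4 h5
    rw [scaledLevelFun, levelFun, levelFun, ← hκ, ← hκ'] at h3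
    generalize theta τ (μ * z - 1 / 5) = B at h3 h4 ⊢
    generalize theta τ' (z - 1 / 5) = B' at h3 h5 ⊢
    clear_value κ κ'
    field_simp at h3 ⊢
    linear_combination h3
  have hl : Differentiable ℂ fun z => κ' * theta τ' z * theta τ (μ * z - 1 / 5) :=
    (h2.const_mul κ').mul (h1.comp ((differentiable_id.const_mul μ).sub_const (1 / 5)))
  have hr : Differentiable ℂ fun z => μ⁻¹ * κ * theta τ (μ * z) * theta τ' (z - 1 / 5) :=
    ((h1.comp (differentiable_id.const_mul μ)).const_mul _).mul
      (h2.comp (differentiable_id.sub_const (1 / 5)))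
  have heq := congrFun (AnalyticOnNhd.eq_of_eventuallyEq (fun z _ => hl.analyticAt z)
    (fun z _ => hr.analyticAt z) e) ω
  simp only [(theta_eq_zero_iff hτ' ω).2 hω, mul_zero, zero_mul] at heq
  rw [← theta_eq_zero_iff hτ]
  have h6 := (mul_eq_zero.1 heq.symm).resolve_right
    (mt (theta_eq_zero_iff hτ' _).1 (sub_fifth_notMem_of_mem hτ' hω))
  exact (mul_eq_zero.1 h6).resolve_left
    (mul_ne_zero (inv_ne_zero hμ) (levelFun_const_ne_zero hτ))

/-- Only countably many functions of level five are homothetic, in terms of the first four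
coefficients, to a given one. -/
theorem countable_homothetic {τ : ℂ} (hτ : 0 < τ.im) :
    {τ' : ℂ | 0 < τ'.im ∧ ∃ μ : ℂ, μ ≠ 0 ∧ ∀ k, 1 ≤ k → k ≤ 4 →
      logCoeff (levelSeries τ') k = μ ^ k * logCoeff (levelSeries τ) k}.Countable := by
  refine (Set.countable_range fun p : (ℤ × ℤ) × (ℤ × ℤ) =>
    ((p.1.1 : ℂ) + p.1.2 * τ) / (p.2.1 + p.2.2 * τ)).mono ?_
  rintro τ' ⟨hτ', μ, hμ, h⟩
  have hn := isNormalized_levelSeries hτ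
  have hn' := isNormalized_levelSeries hτ'
  have hs := hn.scaleSeries hμ
  have hw : ∀ k, 1 ≤ k → k ≤ 4 → logCoeff (levelSeries τ') k =
      logCoeff (scaleSeries μ (levelSeries τ)) k := fun k h1 h2 => by
    rw [h k h1 h2, logCoeff_scaleSeries hμ hn]
  have heq : levelSeries τ' = scaleSeries μ (levelSeries τ) := by
    refine hn'.eq_of_logCoeff_eq hs fun k hk => ?_
    rw [logCoeff_of_solvesODE hn' (solvesODE_levelSeries hτ') hk,
      logCoeff_of_solvesODE hs ((solvesODE_levelSeries hτ).scaleSeries hμ) hk,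
      hw 1 le_rfl (by norm_num), hw 2 (by norm_num) (by norm_num),
      hw 3 (by norm_num) (by norm_num), hw 4 (by norm_num) (by norm_num)]
  have hF : levelFun τ' =ᶠ[𝓝 0] scaledLevelFun τ μ := by
    have e1 := isExpansionAtZero_taylorSeries (analyticAt_levelFun_zero hτ')
    have e2 := isExpansionAtZero_scaleSeries (μ := μ) hτ
    rw [← heq] at e2
    filter_upwards [hasFPowerSeriesAt_iff.1 e1, hasFPowerSeriesAt_iff.1 e2] with z h1 h2
    rw [zero_add] at h1 h2
    exact h1.unique h2
  have m1 := mul_mem_latticeOf_of_eventuallyEq hτ hτ' hμ hF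
    (AddSubgroup.subset_closure (by simp) : (1 : ℂ) ∈ latticeOf τ')
  have m2 := mul_mem_latticeOf_of_eventuallyEq hτ hτ' hμ hF
    (AddSubgroup.subset_closure (by simp) : τ' ∈ latticeOf τ')
  rw [mul_one] at m1
  obtain ⟨m, n, e1⟩ := mem_latticeOf.1 m1
  obtain ⟨m', n', e2⟩ := mem_latticeOf.1 m2
  refine ⟨((m', n'), (m, n)), ?_⟩
  simp only [e1, e2]
  exact mul_div_cancel_left₀ _ hμ

theorem not_countable_upperHalfPlane : ¬ {τ : ℂ | 0 < τ.im}.Countable := by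
  intro h
  have h1 : IsOpen {τ : ℂ | 0 < τ.im} := isOpen_lt continuous_const Complex.continuous_im
  obtain ⟨z, hz, hz'⟩ := (h.dense_compl ℝ).exists_mem_open h1 ⟨I, by simp⟩
  exact hz hz'

/-! ### Parametrization of the elliptic component -/

/-- The second coefficient at the parameter `(a, t)` of the elliptic component; the first one
is `a`. -/
noncomputable def paramTwo (x : ℂ × ℂ) : ℂ := 2 / 3 * x.2 ^ 2 - 25 / 3 * x.1 ^ 2

/-- The third coefficient at the parameter `(a, t)` of the elliptic component. -/
noncomputable def paramThree (x : ℂ × ℂ) : ℂ :=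
  125 / 2 * x.1 ^ 3 + 15 / 2 * x.1 * paramTwo x + 3 / 2 * x.2 ^ 3

/-- The fourth coefficient at the parameter `(a, t)` of the elliptic component. -/
noncomputable def paramFour (x : ℂ × ℂ) : ℂ :=
  -(125 / 6 * x.1 ^ 4 + 25 * x.1 ^ 2 * paramTwo x + 20 / 3 * x.1 * paramThree x +
    5 / 2 * paramTwo x ^ 2)

/-- With `b' = 3 b / 2 + 25 a² / 2` and `c' = c - 125 a³ / 2 - 15 a b / 2`, the equation of weight
`6` of the elliptic component becomes the cuspidal equation `c'² = 9 b'³ / 4`, which the parameter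
`t` uniformizes through `b' = t²`, `c' = 3 t³ / 2`. The equation of weight `4` determines `d`. -/
theorem IsEllipticPoint.exists_param {a b c d : ℂ} (h : IsEllipticPoint a b c d) :
    ∃ t, b = paramTwo (a, t) ∧ c = paramThree (a, t) ∧ d = paramFour (a, t) := by
  obtain ⟨h1, h2⟩ := h
  obtain ⟨s, hs⟩ := IsAlgClosed.exists_pow_nat_eq (3 / 2 * b + 25 / 2 * a ^ 2 : ℂ) two_pos
  have hb : b = 2 / 3 * s ^ 2 - 25 / 3 * a ^ 2 := by linear_combination -2 / 3 * hs
  have hc : (c - (125 / 2 * a ^ 3 + 15 / 2 * a * b) - 3 / 2 * s ^ 3) *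
      (c - (125 / 2 * a ^ 3 + 15 / 2 * a * b) + 3 / 2 * s ^ 3) = 0 := by
    subst hb
    linear_combination -1 / 64 * h2
  have hd : d = -(125 / 6 * a ^ 4 + 25 * a ^ 2 * b + 20 / 3 * a * c + 5 / 2 * b ^ 2) := by
    linear_combination 1 / 6 * h1
  rcases mul_eq_zero.1 hc with h0 | h0
  · have h3 : c = paramThree (a, s) := by
      rw [paramThree, paramTwo, ← hb]
      linear_combination h0
    refine ⟨s, hb, h3, ?_⟩
    rw [paramFour, ← h3, paramTwo, ← hb]
    exact hd
  · have hb' : b = paramTwo (a, -s) := by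
      rw [paramTwo]
      linear_combination hb
    have h3 : c = paramThree (a, -s) := by
      rw [paramThree, ← hb']
      linear_combination h0
    refine ⟨-s, hb', h3, ?_⟩
    rw [paramFour, ← h3, ← hb']
    exact hd

/-- The first coefficient of the function of level five. -/
noncomputable def levelParamOne (τ : ℂ) : ℂ := logCoeff (levelSeries τ) 1

theorem exists_levelParam (τ : ℂ) : ∃ t : ℂ, 0 < τ.im →
    logCoeff (levelSeries τ) 2 = paramTwo (levelParamOne τ, t) ∧
    logCoeff (levelSeries τ) 3 = paramThree (levelParamOne τ, t) ∧
    logCoeff (levelSeries τ) 4 = paramFour (levelParamOne τ, t) := by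
  by_cases hτ : 0 < τ.im
  · obtain ⟨t, ht⟩ := (components_levelSeries hτ).2.exists_param
    exact ⟨t, fun _ => ht⟩
  · exact ⟨0, fun h => absurd h hτ⟩

/-- A choice of the uniformizing parameter of the function of level five. -/
noncomputable def levelParamTwo (τ : ℂ) : ℂ := (exists_levelParam τ).choose

theorem levelParamTwo_spec {τ : ℂ} (hτ : 0 < τ.im) :
    logCoeff (levelSeries τ) 2 = paramTwo (levelParamOne τ, levelParamTwo τ) ∧
    logCoeff (levelSeries τ) 3 = paramThree (levelParamOne τ, levelParamTwo τ) ∧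
    logCoeff (levelSeries τ) 4 = paramFour (levelParamOne τ, levelParamTwo τ) :=
  (exists_levelParam τ).choose_spec hτ

/-- A set of moduli whose parameters are pairwise proportional is countable. -/
theorem countable_of_proportional {S : Set ℂ} (hS : ∀ τ ∈ S, 0 < τ.im)
    (h : ∀ τ ∈ S, ∀ τ' ∈ S, ∃ μ : ℂ, μ ≠ 0 ∧ levelParamOne τ' = μ * levelParamOne τ ∧
      levelParamTwo τ' = μ * levelParamTwo τ) : S.Countable := by
  rcases S.eq_empty_or_nonempty with rfl | ⟨τ, hτ⟩
  · exact Set.countable_empty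
  refine (countable_homothetic (hS τ hτ)).mono fun τ' hτ' => ?_
  obtain ⟨μ, hμ, h1, h2⟩ := h τ hτ τ' hτ'
  refine ⟨hS τ' hτ', μ, hμ, fun k hk1 hk4 => ?_⟩
  obtain ⟨e2, e3, e4⟩ := levelParamTwo_spec (hS τ hτ)
  obtain ⟨e2', e3', e4'⟩ := levelParamTwo_spec (hS τ' hτ')
  interval_cases k
  · rw [pow_one]
    exact h1
  · rw [e2, e2', h1, h2, paramTwo, paramTwo]
    ring
  · rw [e3, e3', h1, h2, paramThree, paramThree, paramTwo, paramTwo]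
    ring
  · rw [e4, e4', h1, h2, paramFour, paramFour, paramThree, paramThree, paramTwo, paramTwo]
    ring

/-! ### Density of the functions of level five -/

/-- The polynomial functions of two variables. -/
def polyFun : Subalgebra ℂ (ℂ × ℂ → ℂ) := Algebra.adjoin ℂ {Prod.fst, Prod.snd}

theorem fst_mem_polyFun : (fun x => x.1) ∈ polyFun := Algebra.subset_adjoin (Or.inl rfl)

theorem snd_mem_polyFun : (fun x => x.2) ∈ polyFun := Algebra.subset_adjoin (Or.inr rfl)

theorem const_mem_polyFun (c : ℂ) : (fun _ => c) ∈ polyFun := polyFun.algebraMap_mem c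

theorem exists_polynomial_of_mem_polyFun {g : ℂ × ℂ → ℂ} (hg : g ∈ polyFun) :
    (∀ a, ∃ P : Polynomial ℂ, ∀ t, g (a, t) = P.eval t) ∧
      ∀ t, ∃ P : Polynomial ℂ, ∀ a, g (a, t) = P.eval a := by
  induction hg using Algebra.adjoin_induction with
  | mem x hx =>
    rcases hx with rfl | hx
    · exact ⟨fun a => ⟨Polynomial.C a, by simp⟩, fun t => ⟨Polynomial.X, by simp⟩⟩
    · rw [Set.mem_singleton_iff.1 hx]
      exact ⟨fun a => ⟨Polynomial.X, by simp⟩, fun t => ⟨Polynomial.C t, by simp⟩⟩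
  | algebraMap r =>
    exact ⟨fun a => ⟨Polynomial.C r, by simp⟩, fun t => ⟨Polynomial.C r, by simp⟩⟩
  | add x y _ _ hx hy =>
    refine ⟨fun a => ?_, fun t => ?_⟩
    · obtain ⟨P, hP⟩ := hx.1 a
      obtain ⟨Q, hQ⟩ := hy.1 a
      exact ⟨P + Q, by simp [hP, hQ]⟩
    · obtain ⟨P, hP⟩ := hx.2 t
      obtain ⟨Q, hQ⟩ := hy.2 t
      exact ⟨P + Q, by simp [hP, hQ]⟩
  | mul x y _ _ hx hy =>
    refine ⟨fun a => ?_, fun t => ?_⟩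
    · obtain ⟨P, hP⟩ := hx.1 a
      obtain ⟨Q, hQ⟩ := hy.1 a
      exact ⟨P * Q, by simp [hP, hQ]⟩
    · obtain ⟨P, hP⟩ := hx.2 t
      obtain ⟨Q, hQ⟩ := hy.2 t
      exact ⟨P * Q, by simp [hP, hQ]⟩

/-- A polynomial function of the two parameters that vanishes at all rescaled functions of level
five is zero: there are uncountably many of them up to proportionality. -/
theorem eq_zero_of_mem_polyFun {g : ℂ × ℂ → ℂ} (hg : g ∈ polyFun)
    (h : ∀ τ, 0 < τ.im → ∀ μ, μ ≠ 0 → g (μ * levelParamOne τ, μ * levelParamTwo τ) = 0)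
    (x : ℂ × ℂ) : g x = 0 := by
  obtain ⟨hg1, hg2⟩ := exists_polynomial_of_mem_polyFun hg
  have key : ∀ a, a ≠ 0 → ∀ t, g (a, t) = 0 := by
    intro a ha
    obtain ⟨P, hP⟩ := hg1 a
    suffices hP0 : P = 0 by
      intro t
      rw [hP, hP0, Polynomial.eval_zero]
    by_contra hP0
    refine not_countable_upperHalfPlane (Set.Countable.mono (s₂ :=
      (⋃ y ∈ P.roots.toFinset, {τ : ℂ | 0 < τ.im ∧ levelParamOne τ ≠ 0 ∧
        a * levelParamTwo τ = y * levelParamOne τ}) ∪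
      {τ : ℂ | 0 < τ.im ∧ levelParamOne τ = 0 ∧ levelParamTwo τ ≠ 0} ∪
      {τ : ℂ | 0 < τ.im ∧ levelParamOne τ = 0 ∧ levelParamTwo τ = 0}) ?_ ?_)
    · intro τ hτ
      have hτ : 0 < τ.im := hτ
      by_cases h1 : levelParamOne τ = 0
      · by_cases h2 : levelParamTwo τ = 0
        · exact Or.inr ⟨hτ, h1, h2⟩
        · exact Or.inl (Or.inr ⟨hτ, h1, h2⟩)
      · refine Or.inl (Or.inl ?_)
        rw [Set.mem_iUnion₂]
        refine ⟨a / levelParamOne τ * levelParamTwo τ, ?_, hτ, h1, by field_simp⟩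
        rw [Multiset.mem_toFinset, Polynomial.mem_roots hP0, Polynomial.IsRoot, ← hP]
        have := h τ hτ _ (div_ne_zero ha h1)
        rwa [div_mul_cancel₀ _ h1] at this
    · refine ((Set.Countable.biUnion (Finset.countable_toSet _) fun y _ => ?_).union ?_).union ?_
      · refine countable_of_proportional (fun τ h => h.1) fun τ h1 τ' h2 => ?_
        obtain ⟨-, h1, e1⟩ := h1
        obtain ⟨-, h2, e2⟩ := h2
        refine ⟨levelParamOne τ' / levelParamOne τ, div_ne_zero h2 h1, by field_simp, ?_⟩
        rw [div_mul_eq_mul_div, eq_div_iff h1]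
        apply mul_left_cancel₀ ha
        linear_combination levelParamOne τ * e2 - levelParamOne τ' * e1
      · refine countable_of_proportional (fun τ h => h.1) fun τ h1 τ' h2 => ?_
        obtain ⟨-, h1, e1⟩ := h1
        obtain ⟨-, h2, e2⟩ := h2
        exact ⟨levelParamTwo τ' / levelParamTwo τ, div_ne_zero e2 e1, by rw [h1, h2, mul_zero],
          by field_simp⟩
      · refine countable_of_proportional (fun τ h => h.1) fun τ h1 τ' h2 => ?_
        obtain ⟨-, h1, e1⟩ := h1
        obtain ⟨-, h2, e2⟩ := h2
        exact ⟨1, one_ne_zero, by rw [h1, h2, mul_zero], by rw [e1, e2, mul_zero]⟩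
  obtain ⟨a, t⟩ := x
  obtain ⟨P, hP⟩ := hg2 t
  rw [hP]
  suffices hP0 : P = 0 by rw [hP0, Polynomial.eval_zero]
  refine Polynomial.eq_zero_of_infinite_isRoot P (Set.Infinite.mono (s := {0}ᶜ) (fun y hy => ?_)
    (Set.finite_singleton (0 : ℂ)).infinite_compl)
  change P.eval y = 0
  rw [← hP]
  exact key y hy t

end HirzebruchFE

namespace HirzebruchFE

open PowerSeries Finset

/-! ### Polynomiality of the coefficients -/

theorem coeff_mul_mem_polyFun {S T : ℂ × ℂ → PowerSeries ℂ}
    (hS : ∀ k, (fun x => coeff k (S x)) ∈ polyFun) (hT : ∀ k, (fun x => coeff k (T x)) ∈ polyFun)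
    (k : ℕ) : (fun x => coeff k (S x * T x)) ∈ polyFun := by
  simp only [coeff_mul]
  have := polyFun.sum_mem fun (p : ℕ × ℕ) (_ : p ∈ antidiagonal k) =>
    polyFun.mul_mem (hS p.1) (hT p.2)
  convert this using 1
  funext x
  simp

theorem paramTwo_mem_polyFun : paramTwo ∈ polyFun :=
  polyFun.sub_mem (polyFun.mul_mem (const_mem_polyFun _) (polyFun.pow_mem snd_mem_polyFun 2))
    (polyFun.mul_mem (const_mem_polyFun _) (polyFun.pow_mem fst_mem_polyFun 2))

theorem paramThree_mem_polyFun : paramThree ∈ polyFun :=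
  polyFun.add_mem (polyFun.add_mem
    (polyFun.mul_mem (const_mem_polyFun _) (polyFun.pow_mem fst_mem_polyFun 3))
    (polyFun.mul_mem (polyFun.mul_mem (const_mem_polyFun _) fst_mem_polyFun)
      paramTwo_mem_polyFun))
    (polyFun.mul_mem (const_mem_polyFun _) (polyFun.pow_mem snd_mem_polyFun 3))

theorem paramFour_mem_polyFun : paramFour ∈ polyFun :=
  polyFun.neg_mem (polyFun.add_mem (polyFun.add_mem (polyFun.add_mem
    (polyFun.mul_mem (const_mem_polyFun _) (polyFun.pow_mem fst_mem_polyFun 4))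
    (polyFun.mul_mem (polyFun.mul_mem (const_mem_polyFun _) (polyFun.pow_mem fst_mem_polyFun 2))
      paramTwo_mem_polyFun))
    (polyFun.mul_mem (polyFun.mul_mem (const_mem_polyFun _) fst_mem_polyFun)
      paramThree_mem_polyFun))
    (polyFun.mul_mem (const_mem_polyFun _) (polyFun.pow_mem paramTwo_mem_polyFun 2)))

/-- The coefficients of the solution of the differential equation with parameter `x` on the
elliptic component. -/
noncomputable def curveCoeff (x : ℂ × ℂ) : ℕ → ℂ :=
  odeCoeff x.1 (paramTwo x) (paramThree x) (paramFour x)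

theorem curveCoeff_mem_polyFun (k : ℕ) : (fun x => curveCoeff x k) ∈ polyFun := by
  unfold curveCoeff
  induction k using Nat.strong_induction_on with
  | _ k ih =>
    match k with
    | 0 => simpa only [odeCoeff] using const_mem_polyFun 0
    | 1 => simpa only [odeCoeff] using fst_mem_polyFun
    | 2 => simpa only [odeCoeff] using paramTwo_mem_polyFun
    | 3 => simpa only [odeCoeff] using paramThree_mem_polyFun
    | 4 => simpa only [odeCoeff] using paramFour_mem_polyFun
    | k + 5 =>
      simp only [odeCoeff]
      set T : ℂ × ℂ → PowerSeries ℂ := fun x => PowerSeries.mk fun m =>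
        if _h : 2 ≤ m ∧ m < k + 5 then
          odeCoeff x.1 (paramTwo x) (paramThree x) (paramFour x) m else 0 with hT
      have hTm : ∀ m, (fun x => coeff m (T x)) ∈ polyFun := by
        intro m
        simp only [hT, coeff_mk]
        split_ifs with h
        · exact ih m h.2
        · exact const_mem_polyFun 0
      have hTT := coeff_mul_mem_polyFun hTm hTm
      have hTTT := coeff_mul_mem_polyFun hTT hTm
      have hC : ∀ (c : PowerSeries ℂ) m, (fun _ : ℂ × ℂ => coeff m c) ∈ polyFun :=
        fun c m => const_mem_polyFun _
      have hb : ∀ m, (fun x => coeff m (C (6 * paramTwo x) : PowerSeries ℂ)) ∈ polyFun := by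
        intro m
        simp only [coeff_C]
        split_ifs
        · exact polyFun.mul_mem (const_mem_polyFun 6) paramTwo_mem_polyFun
        · exact const_mem_polyFun 0
      have h1 := coeff_mul_mem_polyFun hb (coeff_mul_mem_polyFun (hC (X ^ 2)) hTm) (k + 5)
      have h2 := coeff_mul_mem_polyFun (hC 2) hTTT (k + 5)
      have h3 := coeff_mul_mem_polyFun (hC 6) hTT (k + 5)
      have h4 := polyFun.mul_mem (polyFun.sub_mem (polyFun.add_mem h1 h2) h3)
        (const_mem_polyFun (((k : ℂ) + 1) * (k + 6))⁻¹)
      convert h4 using 1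
      funext x
      simp only [div_eq_mul_inv, map_sub, map_add, Pi.mul_apply, Pi.sub_apply, Pi.add_apply, hT]

theorem expCoeff_mem_polyFun {w : ℂ × ℂ → ℕ → ℂ} (hw : ∀ k, (fun x => w x k) ∈ polyFun) (k : ℕ) :
    (fun x => expCoeff (w x) k) ∈ polyFun := by
  induction k using Nat.strong_induction_on with
  | _ k ih =>
    match k with
    | 0 => simpa only [expCoeff_zero] using const_mem_polyFun 1
    | k + 1 =>
      have h1 := polyFun.sum_mem fun m (_ : m ∈ range (k + 1)) =>
        polyFun.mul_mem (hw (m + 1)) (ih (k - m) (by omega))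
      have h2 := polyFun.mul_mem h1 (const_mem_polyFun ((k : ℂ) + 1)⁻¹)
      convert h2 using 1
      funext x
      simp [expCoeff_succ, div_eq_mul_inv]

theorem lineSum_mem_polyFun (a : Fin 5 → ℂ) {w : ℂ × ℂ → ℕ → ℂ}
    (hw : ∀ k, (fun x => w x k) ∈ polyFun) (k : ℕ) : (fun x => lineSum a (w x) k) ∈ polyFun := by
  have h1 := polyFun.sum_mem fun i (_ : i ∈ (univ : Finset (Fin 5))) =>
    polyFun.mul_mem (const_mem_polyFun (∏ j : Fin 4, (a (i.succAbove j) - a i))⁻¹)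
      (expCoeff_mem_polyFun (w := fun x m => (∑ j : Fin 4, (a (i.succAbove j) - a i) ^ m) * w x m)
        (fun m => polyFun.mul_mem (const_mem_polyFun _) (hw m)) k)
  convert h1 using 1
  funext x
  simp [lineSum]

theorem eval_mem_polyFun {ι : Type*} {q : ℂ × ℂ → ι → ℂ} (hq : ∀ i, (fun x => q x i) ∈ polyFun)
    (P : MvPolynomial ι ℂ) : (fun x => MvPolynomial.eval (q x) P) ∈ polyFun := by
  induction P using MvPolynomial.induction_on with
  | C c => simpa using const_mem_polyFun c
  | add p q hp hq =>
    simp only [map_add]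
    exact polyFun.add_mem hp hq
  | mul_X p i hp =>
    simp only [map_mul, MvPolynomial.eval_X]
    exact polyFun.mul_mem hp (hq i)

/-! ### The elliptic case -/

theorem logCoeff_scaleSeries_levelSeries {τ μ : ℂ} (hτ : 0 < τ.im) (hμ : μ ≠ 0) {k : ℕ}
    (hk : 1 ≤ k) : logCoeff (scaleSeries μ (levelSeries τ)) k =
      curveCoeff (μ * levelParamOne τ, μ * levelParamTwo τ) k := by
  have hn := isNormalized_levelSeries hτ
  obtain ⟨e2, e3, e4⟩ := levelParamTwo_spec hτ
  rw [logCoeff_of_solvesODE (hn.scaleSeries hμ) ((solvesODE_levelSeries hτ).scaleSeries hμ) hk,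
    curveCoeff]
  simp only [logCoeff_scaleSeries hμ hn, e2, e3, e4]
  congr 1
  · rw [pow_one]
    rfl
  · rw [paramTwo, paramTwo]
    ring
  · rw [paramThree, paramThree, paramTwo, paramTwo]
    ring
  · rw [paramFour, paramFour, paramThree, paramThree, paramTwo, paramTwo]
    ring

/-- By density, the functional equation along a line holds on all of the elliptic component. -/
theorem lineRel_curveCoeff (x : ℂ × ℂ) : LineRel ![0, 1, 2, 3, 5] (curveCoeff x) := by
  intro k hk
  refine eq_zero_of_mem_polyFun (lineSum_mem_polyFun _ curveCoeff_mem_polyFun k)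
    (fun τ hτ μ hμ => ?_) x
  have h := lineRel_logCoeff ((isNormalized_levelSeries hτ).scaleSeries hμ) (c := 0)
    (a := ![0, 1, 2, 3, 5]) (by
      rw [lineSeries_scaleSeries hμ (isNormalized_levelSeries hτ)
        (lineSeries_levelSeries hτ _ injective_01235), map_zero, zero_mul]) k hk
  exact (lineSum_congr _ (fun m h1 => logCoeff_scaleSeries_levelSeries hτ hμ h1) k).symm.trans h

/-- By density, all points of the elliptic component lie in the Zariski closure `M₅`. -/
theorem expCoeff_curveCoeff_mem_ellipticManifold (x : ℂ × ℂ) :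
    (fun i : Fin 4 => expCoeff (curveCoeff x) ((i : ℕ) + 1)) ∈ ellipticManifold 5 := by
  rw [ellipticManifold, MvPolynomial.mem_zeroLocus_iff]
  intro P hP
  rw [MvPolynomial.mem_vanishingIdeal_iff] at hP
  refine eq_zero_of_mem_polyFun
    (g := fun x => MvPolynomial.aeval (fun i : Fin 4 => expCoeff (curveCoeff x) ((i : ℕ) + 1)) P)
    ?_ (fun τ hτ μ hμ => ?_) x
  · exact eval_mem_polyFun (fun i => expCoeff_mem_polyFun curveCoeff_mem_polyFun _) P
  · rw [← hP _ (params_scaleSeries_mem_ellipticParams hτ hμ)]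
    congr 2
    funext i
    rw [params, ((isNormalized_levelSeries hτ).scaleSeries hμ).coeff_qSeries]
    exact expCoeff_congr fun m h1 _ => (logCoeff_scaleSeries_levelSeries hτ hμ h1).symm

/-- By uniqueness, a solution of the functional equation on the elliptic component is the solution
of the differential equation with the same parameters. -/
theorem correspondsToElliptic_of_isEllipticPoint {f : PowerSeries ℂ} (hf : IsNormalized f)
    (hL : LineRel ![0, 1, 2, 3, 5] (logCoeff f))
    (h5 : logCoeff f 5 = -(logCoeff f 2 * logCoeff f 3))
    (hE : IsEllipticPoint (logCoeff f 1) (logCoeff f 2) (logCoeff f 3) (logCoeff f 4)) :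
    CorrespondsToElliptic 5 f := by
  obtain ⟨t, h2, h3, h4⟩ := hE.exists_param
  set x : ℂ × ℂ := (logCoeff f 1, t) with hx
  have hw : ∀ k, 1 ≤ k → logCoeff f k = curveCoeff x k := by
    intro k hk
    refine hL.eq_of_eq_le_five (lineRel_curveCoeff x) (fun k h1 h5' => ?_) hk
    interval_cases k
    · simp only [curveCoeff, odeCoeff, hx]
    · simp only [curveCoeff, odeCoeff, h2]
    · simp only [curveCoeff, odeCoeff, h3]
    · simp only [curveCoeff, odeCoeff, h4]
    · rw [h5, curveCoeff, ← h2, ← h3, odeCoeff_five]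
  refine ⟨hf, solvesODE_of_logCoeff hf hw, ?_⟩
  have := expCoeff_curveCoeff_mem_ellipticManifold x
  convert this using 1
  funext i
  rw [params, hf.coeff_qSeries]
  exact expCoeff_congr fun m h1 _ => hw m h1

end HirzebruchFE

theorem mainTheorem1 (f : PowerSeries ℂ) (hf : HirzebruchFE.IsNormalized f) (c : ℂ)
    (h : HirzebruchFE.HirzebruchEquation 5 c f) :
    HirzebruchFE.CorrespondsToTodd f ∨ HirzebruchFE.CorrespondsToElliptic 5 f := by
  open HirzebruchFE in
  have hL := fun a ha => lineRel_logCoeff hf (lineSeries_of_hirzebruchEquation (a := a) hf h ha)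
  have hA := hL ![0, 1, 2, 3, 5] injective_01235
  obtain ⟨h5, hT | hE⟩ := components_of_lineRel hA (hL ![0, 1, 2, 3, 6] injective_01236)
    (hL ![0, 1, 2, 4, 5] injective_01245)
  · exact Or.inl (correspondsToTodd_of_isToddPoint hf hA h5 hT)
  · exact Or.inr (correspondsToElliptic_of_isEllipticPoint hf hA h5 hE)
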